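/- **Theorem 7.2.** *Setting.* Let $M$ be a (Hausdorff) real-analytic surface, $p,f$ real-valued analytic functions on $T^*M$ with $H_pf=0$, where $H_p=p'_\xi\cdot\partial_x-p'_x\cdot\partial_\xi$. Assume that $p^{-1}(0)$ is compact and connected and that $dp\ne0$ on it. Put $J=f(p^{-1}(0))$ (a compact interval) and $\Lambda_a=p^{-1}(0)\cap f^{-1}(a)$, $a\in J$. Let $S\subset J$ be finite, and assume that for $a\in J\setminus S$ the $\Lambda_a$ are Lagrangian tori depending analytically on $a$: near each $\Lambda_{a_0}$, $a_0\in J\setminus S$, there are analytic action-angle coordinates $(x,\xi)\in\mathbf T^2\times B$, $\mathbf T^2=\mathbf R^2/2\pi\mathbf Z^2$, $B\subset\mathbf R^2$ open, such that $p=p(\xi)$ and, for $a\in J$ near $a_0$, $\Lambda_a=\{\xi=\xi(a)\}$ with $\xi(a)$ analytic. Let $\omega(a)=[\partial_{\xi_2}p:\partial_{\xi_1}p](\xi(a))\in\mathbf R\cup\{\infty\}$ be the rotation number, and for analytic $q:T^*M\to\mathbf R$ let $\langle q\rangle_{\Lambda_a}=(2\pi)^{-2}\int_{\mathbf T^2}q(x,\xi(a))\,dx$,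 $a\in J\setminus S$. Assume that $\omega$ is analytic on $J\setminus S$ (with values in the projective line) and not identically constant on any connected component of $J\setminus S$. For $a\in J$ let $\langle q\rangle_T=\frac1T\int_0^Tq\circ\exp(tH_p)\,dt$, and let $Q_\infty(a)=Q_\infty^q(a)$ be the union over the connected components $C$ of $\Lambda_a$ of the sets $\bigcap_{T\ge1}\langle q\rangle_T(C)$ (equivalently, of the intervals $[\lim_{T\to\infty}\inf_C\langle q\rangle_T,\ \lim_{T\to\infty}\sup_C\langle q\rangle_T]$). Let $|Q_\infty(a)|$ denote its length. Let $g:J\to\mathbf R$ be continuous, analytic on $J\setminus S$ and not identically constant on any connected component of $J\setminus S$. Let $\mathcal F$ be a family of analytic functions $q:T^*M\to\mathbf R$ such that $\langle q\rangle_{\Lambda_a}=g(a)$ for all $q\in\mathcal F$, $a\in J\setminus S$, and such that $\mathcal F$ is uniformly analytic on $p^{-1}(0)$: for every $z\in p^{-1}(0)$ there is $R$ such that $\|D^nq(z)\|\le R^{n+1}n!$ for all $n\ge 0$, $q\in\mathcal F$, in a fixed canonical chart at $z$. (One function $q$ alone always is such a family.) For $\alpha,d>0$ let $\widetilde\Omega_\alpha$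 be the set of $a\in J\setminus S$ with ${\rm dist}(a,S)\ge\alpha$, $\omega(a)\neq\infty$, $|\omega'(a)|\ge\alpha$, $|g'(a)|\ge\alpha$ and $|\omega(a)-\frac mn|\ge\frac{\alpha}{n^{2+d}}$ for all $m\in\mathbf Z$ and all integers $n\ge1$. The set of good values is $\mathcal G_\alpha=g(J)\setminus g(J\setminus\widetilde\Omega_\alpha)$. *Conclusion.* For every $d>0$: 1. The Lebesgue measure of $g(J)\setminus\mathcal G_\alpha$ tends to $0$ as $\alpha\to0^+$. 2. For all $\alpha>0$ and $F_0\in\mathcal G_\alpha$, the set $g^{-1}(F_0)\subset J$ is finite. 3. For $q\in\mathcal F$ and $a\in J\setminus S$, the limit of $\langle q\rangle_T$ as $T\to\infty$ exists pointwise on $\Lambda_a$, and $Q_\infty(a)$ is the range of this limit. 4. For every $\alpha>0$ and every compact $K\subset\mathcal G_\alpha$ (for instance $K=\{F_0\}$) there is $\sigma>0$, the same for all $q\in\mathcal F$ and $F_0\in K$, such that if $q\in\mathcal F$ and $\sup_{a\in J}|Q_\infty(a)|\le\sigma$, then for every $F_0\in K$ and every neighborhood $W$ of $g^{-1}(F_0)$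 there is $C(W)>0$ with $${\rm dist}(Q_\infty(a),F_0)\ge\frac1{C(W)},\qquad a\in J\setminus W.$$ -/

import Mathlib

open Set Filter Topology MeasureTheory
open scoped Manifold ContDiff Bundle

noncomputable section

/-- The model plane of a real-analytic surface. -/
abbrev Plane := EuclideanSpace ℝ (Fin 2)

/-- The model space of the cotangent bundle of a surface: positions and covectors. -/
abbrev PhaseModel := Plane × (Plane →L[ℝ] ℝ)

/-- The model with corners of the cotangent bundle of a surface. -/
abbrev phaseI : ModelWithCorners ℝ PhaseModel (ModelProd Plane (Plane →L[ℝ] ℝ)) :=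
  (𝓘(ℝ, Plane)).prod 𝓘(ℝ, Plane →L[ℝ] ℝ)

section Cotangent

variable (M : Type*) [TopologicalSpace M] [ChartedSpace Plane M] [IsManifold 𝓘(ℝ, Plane) ω M]

/-- The cotangent bundle `T*M`: the points are the pairs `(x, ξ)` with `ξ : T_x M → ℝ` linear. -/
abbrev Cotangent : Type _ :=
  Bundle.TotalSpace (Plane →L[ℝ] ℝ)
    (fun x : M => TangentSpace 𝓘(ℝ, Plane) x →L[ℝ] Bundle.Trivial M ℝ x)

end Cotangent

section Dynamics

variable {M : Type*} [TopologicalSpace M] [ChartedSpace Plane M] [IsManifold 𝓘(ℝ, Plane) ω M]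

/-- The canonical symplectic form `dξ ∧ dx` of `T*M` at the point `z`.
In Mathlib the tangent space at `z` is identified with the model space by the preferred chart
at `z`. For `T*M` this chart is the canonical chart `(x, ξ)` induced by a chart of `M`. -/
def symplecticForm (z : Cotangent M) (u v : TangentSpace phaseI z) : ℝ :=
  let u' : PhaseModel := u
  let v' : PhaseModel := v
  u'.2 v'.1 - v'.2 u'.1

/-- The differential `dp(z)`, a linear form on the tangent space of `T*M` at `z`. -/
def differential (p : Cotangent M → ℝ) (z : Cotangent M) : PhaseModel →L[ℝ] ℝ :=
  mfderiv phaseI 𝓘(ℝ, ℝ) p z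

/-- The Hamilton field `H_p = p'_ξ · ∂_x - p'_x · ∂_ξ`. -/
def hamiltonField (p : Cotangent M → ℝ) (z : Cotangent M) : TangentSpace phaseI z :=
  ((WithLp.toLp 2 fun i : Fin 2 => differential p z (0, EuclideanSpace.proj i),
    -(differential p z).comp (ContinuousLinearMap.inl ℝ Plane (Plane →L[ℝ] ℝ))) : PhaseModel)

open Classical in
/-- The Hamilton flow `exp(t H_p)(z)`; the value is `z` (a junk value) when the maximal integral
curve through `z` is not defined for all times, which does not occur on a compact energy surface. -/
def hamiltonFlow (p : Cotangent M → ℝ) (t : ℝ) (z : Cotangent M) : Cotangent M :=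
  if h : ∃ γ : ℝ → Cotangent M, γ 0 = z ∧ IsMIntegralCurve (I := phaseI) γ (hamiltonField p)
  then h.choose t else z

/-- The flow average `⟨q⟩_T = T⁻¹ ∫_0^T q ∘ exp(t H_p) dt`. -/
def flowAverage (p q : Cotangent M → ℝ) (T : ℝ) (z : Cotangent M) : ℝ :=
  T⁻¹ * ∫ t in (0 : ℝ)..T, q (hamiltonFlow p t z)

/-- The leaf `Λ_a = p⁻¹(0) ∩ f⁻¹(a)`. -/
def leaf (p f : Cotangent M → ℝ) (a : ℝ) : Set (Cotangent M) := {z | p z = 0 ∧ f z = a}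

/-- The parameter set `J = f(p⁻¹(0))`; it is a compact interval when `p⁻¹(0)` is compact and
connected. -/
def leafParams (p f : Cotangent M → ℝ) : Set ℝ := f '' (p ⁻¹' {0})

/-- `Q_∞(a)`: the union, over the connected components `C` of `Λ_a`, of the intersections of the
ranges of `⟨q⟩_T` on `C`, `T ≥ 1`. -/
def QInfty (p f q : Cotangent M → ℝ) (a : ℝ) : Set ℝ :=
  ⋃ z ∈ leaf p f a, ⋂ T ∈ Ici (1 : ℝ),
    flowAverage p q T '' connectedComponentIn (leaf p f a) z

/-- The point `[u : v]` of the real projective line `ℝ ∪ {∞}`, that is `u / v`, or `∞` if `v = 0`. -/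
def projRatio (u v : ℝ) : OnePoint ℝ :=
  open Classical in if v = 0 then OnePoint.infty else ((u / v : ℝ) : OnePoint ℝ)

/-- The real number represented by a point of the projective line (junk value `0` at `∞`). -/
def finitePart (r : OnePoint ℝ) : ℝ := r.elim 0 id

/-- Analyticity on `s` of a map into the real projective line: locally it can be written
`[u : v]` with `u`, `v` analytic and without common zero. -/
def ProjAnalyticOn (r : ℝ → OnePoint ℝ) (s : Set ℝ) : Prop :=
  ∀ a ∈ s, ∃ u v : ℝ → ℝ, AnalyticWithinAt ℝ u s a ∧ AnalyticWithinAt ℝ v s a ∧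
    (u a ≠ 0 ∨ v a ≠ 0) ∧ ∀ᶠ a' in 𝓝[s] a, r a' = projRatio (u a') (v a')

/-- Real-analytic action-angle coordinates near `Λ_{a₀}`, given through the inverse
`κ : 𝕋² × B → T*M`, `𝕋² = ℝ² / 2πℤ²`, of the coordinate map. The leaves `Λ_a` with `a` near `a₀`
are the tori `{ξ = action a}`, depending analytically on `a`. -/
structure ActionAngleChart (p f : Cotangent M → ℝ) (a₀ : ℝ) where
  /-- the parameters of the leaves in the range of the coordinates -/
  V : Set ℝ
  V_mem : V ∈ 𝓝 a₀
  /-- the range of the action variables -/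
  B : Set (Fin 2 → ℝ)
  isOpen_B : IsOpen B
  /-- the point with angles `x` and actions `ξ` -/
  κ : (Fin 2 → ℝ) × (Fin 2 → ℝ) → Cotangent M
  analytic_κ : ContMDiffOn 𝓘(ℝ, (Fin 2 → ℝ) × (Fin 2 → ℝ)) phaseI ω κ (univ ×ˢ B)
  κ_eq_iff : ∀ x x' : Fin 2 → ℝ, ∀ ξ ∈ B, ∀ ξ' ∈ B, κ (x, ξ) = κ (x', ξ') ↔
    ξ = ξ' ∧ ∃ k : Fin 2 → ℤ, ∀ i, x' i = x i + 2 * Real.pi * k i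
  symplectic_κ : ∀ x : Fin 2 → ℝ, ∀ ξ ∈ B, ∀ u v : (Fin 2 → ℝ) × (Fin 2 → ℝ),
    symplecticForm (κ (x, ξ))
        (mfderiv 𝓘(ℝ, (Fin 2 → ℝ) × (Fin 2 → ℝ)) phaseI κ (x, ξ) u)
        (mfderiv 𝓘(ℝ, (Fin 2 → ℝ) × (Fin 2 → ℝ)) phaseI κ (x, ξ) v) =
      (∑ i, u.2 i * v.1 i) - ∑ i, v.2 i * u.1 i
  p_indep_angle : ∀ x : Fin 2 → ℝ, ∀ ξ ∈ B, p (κ (x, ξ)) = p (κ (0, ξ))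
  /-- the actions of the leaf `Λ_a` -/
  action : ℝ → Fin 2 → ℝ
  analytic_action : AnalyticOn ℝ action (V ∩ leafParams p f)
  action_mem : ∀ a ∈ V ∩ leafParams p f, action a ∈ B
  leaf_eq : ∀ a ∈ V ∩ leafParams p f, leaf p f a = range fun x => κ (x, action a)

namespace ActionAngleChart

variable {p f : Cotangent M → ℝ} {a₀ : ℝ}

/-- The frequency `∂p/∂ξ_i` of the torus `Λ_a`, `p` being a function `p(ξ)` of the actions. -/
def frequency (c : ActionAngleChart p f a₀) (i : Fin 2) (a : ℝ) : ℝ :=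
  fderiv ℝ (fun ξ : Fin 2 → ℝ => p (c.κ (0, ξ))) (c.action a) (Pi.single i 1)

/-- The rotation number `[∂p/∂ξ₂ : ∂p/∂ξ₁]` of the torus `Λ_a`. -/
def rotationNumber (c : ActionAngleChart p f a₀) (a : ℝ) : OnePoint ℝ :=
  projRatio (c.frequency 1 a) (c.frequency 0 a)

/-- The average of `q` over the torus `Λ_a` for the measure `(2π)⁻² dx` of the angles. -/
def torusAverage (c : ActionAngleChart p f a₀) (q : Cotangent M → ℝ) (a : ℝ) : ℝ :=
  ((2 * Real.pi) ^ 2)⁻¹ *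
    ∫ x in Icc (0 : Fin 2 → ℝ) (fun _ => 2 * Real.pi), q (c.κ (x, c.action a))

end ActionAngleChart

/-- A family of functions is uniformly analytic along `K` if at each point of `K` its members
satisfy the Cauchy estimates with a common constant; for compact `K` this means that
they have uniformly bounded holomorphic extensions to a common complex neighborhood of `K`. -/
def UniformlyAnalyticOn (F : Set (Cotangent M → ℝ)) (K : Set (Cotangent M)) : Prop :=
  ∀ z ∈ K, ∃ R : ℝ, ∀ q ∈ F, ∀ n : ℕ,
    ‖iteratedFDeriv ℝ n (q ∘ (extChartAt phaseI z).symm) (extChartAt phaseI z z)‖ ≤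
      R ^ (n + 1) * n.factorial

end Dynamics

/-- `r` is not identically constant on any connected component of `s`. -/
def NonconstantOnComponents {X : Type*} (r : ℝ → X) (s : Set ℝ) : Prop :=
  ∀ a ∈ s, ¬ ∀ a' ∈ connectedComponentIn s a, r a' = r a

/-- `Ω_{α,d}`: the parameters `a ∈ J` with `dist(a, S) ≥ α`, for which the rotation number `r(a)`
is finite and `(α,d)`-Diophantine, and `|r'(a)| ≥ α`. -/
def diophantineParams (J S : Set ℝ) (r : ℝ → OnePoint ℝ) (α d : ℝ) : Set ℝ :=
  {a | a ∈ J ∧ (∀ s ∈ S, α ≤ |a - s|) ∧ r a ≠ OnePoint.infty ∧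
    α ≤ |derivWithin (fun a' => finitePart (r a')) J a| ∧
    ∀ m : ℤ, ∀ n : ℕ, 0 < n → α / (n : ℝ) ^ (2 + d) ≤ |finitePart (r a) - m / n|}

/-- `Ω̃_{α,d}`: the points of `Ω_{α,d}` at which `|g'| ≥ α`. -/
def regularParams (J S : Set ℝ) (r : ℝ → OnePoint ℝ) (g : ℝ → ℝ) (α d : ℝ) : Set ℝ :=
  diophantineParams J S r α d ∩ {a | a ∈ J \ S ∧ α ≤ |derivWithin g J a|}

/-- The set of good values `𝒢_α`: the complement in `g(J)` of `g(J \ Ω̃_{α,d})`. -/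
def goodValues (J S : Set ℝ) (r : ℝ → OnePoint ℝ) (g : ℝ → ℝ) (α d : ℝ) : Set ℝ :=
  (g '' J) \ (g '' (J \ regularParams J S r g α d))

end

/-! The lower bound rests on two facts. First, `g a` belongs to `QInfty p f q a` for every `a` in
`J`. On a regular torus the flow is linear in the angles, averaging along it preserves the torus
mean, and a continuous function on a connected torus takes its mean. At the finitely many
exceptional parameters this is inherited from nearby regular leaves: limits of points chosen on
connected leaves `Λ_a`, `a → s`, lie in a single component of `Λ_s` (`mem_QInfty_of_mem_closure`).
Second, as soon as the length of `Q_∞(a)` is at most `σ`, it is at most `|g(a) - F₀|/2`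
(`exists_diam_QInfty_le_half`). So the distance from `F₀` to `Q_∞(a)` is at least `|g(a) - F₀|/2`,
which is bounded below off a neighborhood of `g⁻¹(F₀)` by compactness.

In the second fact only `a` near a preimage `b` of `F₀` matters, since elsewhere `σ` can be taken
small. If `ω(a)` is irrational, the averages become constant and `Q_∞(a)` is a point. If `ω(a) =
m/n`, the averages over whole closed orbits are almost `2π/n`-periodic in one angle, so their
oscillation is `O(n^{-N})` for every fixed `N`, uniformly in the family
(`exists_lineAverage_osc_le_of_rational`). But `b` is Diophantine: `α/n^{2+d} ≤ |ω(b) - m/n| ≤ K|a -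
b|`. For `N ≥ 2(2+d)` this makes the length of `Q_∞(a)` quadratic in `|a - b|`
(`exists_diam_QInfty_le_near`), whereas `|g(a) - F₀|` is at least linear because `g'(b) ≠ 0`.
Compactness of `J × K` makes `σ` uniform.

For the measure statement, the bad parameters decrease as `α → 0`. Away from `S` and the poles of
`ω`, their intersection consists of isolated points and of points where `ω` is not Diophantine. The
latter form a null set since `ω` is a local diffeomorphism there, and `g` is locally Lipschitz. The
set `S` together with the poles is countable, so its image under `g` has small open neighborhoods.

The limit of the averages exists by approximation with trigonometric polynomials. Its values stay in
the range of each `⟨q⟩_T`, since `⟨q⟩_{nT}` is a convex combination of values of `⟨q⟩_T` and this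
range is a compact interval. -/

/-! ### Flows of vector fields on compact invariant sets -/

section Flow

variable {E : Type*} [NormedAddCommGroup E] [NormedSpace ℝ E] [CompleteSpace E]
  {H : Type*} [TopologicalSpace H] {I : ModelWithCorners ℝ E H}
  {N : Type*} [TopologicalSpace N] [ChartedSpace H N] [IsManifold I 1 N]
  [BoundarylessManifold I N] {v : (x : N) → TangentSpace I x}

/-- A `C¹` vector field has a local flow, continuous in time and initial point. -/
theorem exists_continuousOn_localFlow {x₀ : N}
    (hv : ContMDiffAt I I.tangent 1 (fun x ↦ (⟨x, v x⟩ : TangentBundle I N)) x₀) :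
    ∃ ε > 0, ∃ U ∈ 𝓝 x₀, ∃ Φ : N × ℝ → N, ContinuousOn Φ (U ×ˢ Ioo (-ε) ε) ∧
      ∀ x ∈ U, Φ (x, 0) = x ∧ IsMIntegralCurveOn (fun t => Φ (x, t)) v (Ioo (-ε) ε) := by
  rw [contMDiffAt_iff] at hv
  obtain ⟨_, hv⟩ := hv
  have hint : I.IsInteriorPoint x₀ := BoundarylessManifold.isInteriorPoint
  obtain ⟨ε, hε, a, r, L, K, hr, hpl⟩ := IsPicardLindelof.of_contDiffAt_one
    (hv.contDiffAt (range_mem_nhds_isInteriorPoint hint)).snd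
  obtain ⟨α, hα, hαc⟩ := (hpl 0).exists_forall_mem_closedBall_eq_hasDerivWithinAt_continuousOn
  set y₀ := extChartAt I x₀ x₀ with hy₀
  have hy₀b : y₀ ∈ Metric.closedBall y₀ (r : ℝ) := Metric.mem_closedBall_self r.2
  have hnh : (Metric.closedBall y₀ (r : ℝ) ×ˢ Icc (0 - ε) (0 + ε)) ∈ 𝓝 (y₀, (0 : ℝ)) :=
    prod_mem_nhds (Metric.closedBall_mem_nhds _ hr) (Icc_mem_nhds (by linarith) (by linarith))
  have hca : ContinuousAt α (y₀, 0) := hαc.continuousAt hnh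
  -- The solutions given by Picard–Lindelöf may leave the image of the chart. Shrinking the time and
  -- the set of initial points keeps them inside, so that they can be pulled back to `N`.
  have htar : interior (extChartAt I x₀).target ∈ 𝓝 (α (y₀, 0)) := by
    rw [(hα y₀ hy₀b).1]
    exact isOpen_interior.mem_nhds ((I.isInteriorPoint_iff).mp hint)
  have hev := inter_mem (hca.preimage_mem_nhds htar) hnh
  rw [mem_nhds_prod_iff] at hev
  obtain ⟨V, hV, T, hT, hVT⟩ := hev
  obtain ⟨δ, hδ, hδT⟩ := Metric.mem_nhds_iff.1 hT
  rw [Real.ball_eq_Ioo] at hδT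
  simp only [zero_sub, zero_add] at hδT
  have hUn : (extChartAt I x₀).source ∩ extChartAt I x₀ ⁻¹' V ∈ 𝓝 x₀ :=
    inter_mem (extChartAt_source_mem_nhds x₀)
      ((continuousAt_extChartAt x₀).preimage_mem_nhds hV)
  refine ⟨δ, hδ, _, hUn, fun p => (extChartAt I x₀).symm (α (extChartAt I x₀ p.1, p.2)), ?_, ?_⟩
  · have h1 : ContinuousOn (fun p : N × ℝ => (extChartAt I x₀ p.1, p.2))
        (((extChartAt I x₀).source ∩ extChartAt I x₀ ⁻¹' V) ×ˢ Ioo (-δ) δ) := by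
      refine ContinuousOn.prodMk ?_ continuousOn_snd
      exact (continuousOn_extChartAt x₀).comp continuousOn_fst (fun p hp => hp.1.1)
    refine (continuousOn_extChartAt_symm x₀).comp (hαc.comp h1 ?_) ?_
    · intro p hp
      exact (hVT (mk_mem_prod hp.1.2 (hδT hp.2))).2
    · intro p hp
      exact interior_subset (hVT (mk_mem_prod hp.1.2 (hδT hp.2))).1
  · rintro x ⟨hxs, hxV⟩
    have h0 : (0 : ℝ) ∈ Ioo (-δ) δ := ⟨by linarith, hδ⟩
    have hxb : extChartAt I x₀ x ∈ Metric.closedBall y₀ (r : ℝ) :=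
      (hVT (mk_mem_prod hxV (hδT h0))).2.1
    refine ⟨?_, ?_⟩
    · change (extChartAt I x₀).symm (α (extChartAt I x₀ x, 0)) = x
      rw [(hα _ hxb).1, (extChartAt I x₀).left_inv hxs]
    intro t ht
    have hmem := hVT (mk_mem_prod hxV (hδT ht))
    set f : ℝ → E := fun t => α (extChartAt I x₀ x, t) with hf
    set xₜ : N := (extChartAt I x₀).symm (f t) with hxt
    have htI : t ∈ Icc (0 - ε) (0 + ε) := hmem.2.2
    have htn : Icc (0 - ε) (0 + ε) ∈ 𝓝 t := by
      refine mem_of_superset (Ioo_mem_nhds ht.1 ht.2) fun s hs => ?_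
      exact (hVT (mk_mem_prod hxV (hδT hs))).2.2
    have h : HasDerivAt f (fderivWithin ℝ (extChartAt I x₀ ∘ (extChartAt I xₜ).symm)
        (range I) (extChartAt I xₜ xₜ) (v xₜ)) t := ((hα _ hxb).2 t htI).hasDerivAt htn
    rw [← tangentCoordChange_def] at h
    have hf3 : f t ∈ interior (extChartAt I x₀).target := hmem.1
    have hf3' := mem_of_mem_of_subset hf3 interior_subset
    have hft1 := mem_preimage.mp <|
      mem_of_mem_of_subset hf3' (extChartAt I x₀).target_subset_preimage_source
    have hft2 := mem_extChartAt_source (I := I) xₜ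
    apply HasMFDerivAt.hasMFDerivWithinAt
    suffices key : HasDerivAt ((extChartAt I xₜ ∘ (extChartAt I x₀).symm) ∘ f) (v xₜ : E) t from
      ⟨(continuousAt_extChartAt_symm'' hf3').comp h.continuousAt, key.hasFDerivAt.hasFDerivWithinAt⟩
    have hcoord : tangentCoordChange I x₀ xₜ xₜ (tangentCoordChange I xₜ x₀ xₜ (v xₜ : E)) = (v xₜ : E) :=
      (tangentCoordChange_comp ⟨⟨hft2, hft1⟩, hft2⟩).trans (tangentCoordChange_self hft2)
    refine HasDerivAt.congr_deriv ?_ hcoord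
    apply HasFDerivAt.comp_hasDerivAt _ _ h
    apply HasFDerivWithinAt.hasFDerivAt (s := range I) _ <|
      mem_nhds_iff.mpr ⟨interior (extChartAt I x₀).target,
        subset_trans interior_subset (extChartAt_target_subset_range ..),
        isOpen_interior, hf3⟩
    rw [← (extChartAt I x₀).right_inv hf3']
    exact hasFDerivWithinAt_tangentCoordChange ⟨hft1, hft2⟩

variable {K : Set N}

/-- On a compact set of initial points the local flow is defined for a uniform time. -/
theorem exists_uniform_localFlow
    (hv : ContMDiff I I.tangent 1 (fun x ↦ (⟨x, v x⟩ : TangentBundle I N))) (hK : IsCompact K) :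
    ∃ ε > 0, ∀ x ∈ K, ∃ U ∈ 𝓝 x, ∃ Φ : N × ℝ → N, ContinuousOn Φ (U ×ˢ Ioo (-ε) ε) ∧
      ∀ x ∈ U, Φ (x, 0) = x ∧ IsMIntegralCurveOn (fun t => Φ (x, t)) v (Ioo (-ε) ε) := by
  refine hK.induction_on (p := fun A => ∃ ε > 0, ∀ x ∈ A, ∃ U ∈ 𝓝 x, ∃ Φ : N × ℝ → N,
    ContinuousOn Φ (U ×ˢ Ioo (-ε) ε) ∧
      ∀ x ∈ U, Φ (x, 0) = x ∧ IsMIntegralCurveOn (fun t => Φ (x, t)) v (Ioo (-ε) ε)) ?_ ?_ ?_ ?_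
  · exact ⟨1, one_pos, fun x hx => hx.elim⟩
  · rintro s t hst ⟨ε, hε, h⟩
    exact ⟨ε, hε, fun x hx => h x (hst hx)⟩
  · rintro s t ⟨ε, hε, h⟩ ⟨ε', hε', h'⟩
    have key : ∀ η ≥ min ε ε', ∀ x, (∃ U ∈ 𝓝 x, ∃ Φ : N × ℝ → N,
        ContinuousOn Φ (U ×ˢ Ioo (-η) η) ∧
        ∀ x ∈ U, Φ (x, 0) = x ∧ IsMIntegralCurveOn (fun t => Φ (x, t)) v (Ioo (-η) η)) →
        ∃ U ∈ 𝓝 x, ∃ Φ : N × ℝ → N,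
        ContinuousOn Φ (U ×ˢ Ioo (-min ε ε') (min ε ε')) ∧
        ∀ x ∈ U, Φ (x, 0) = x ∧
          IsMIntegralCurveOn (fun t => Φ (x, t)) v (Ioo (-min ε ε') (min ε ε')) := by
      rintro η hη x ⟨U, hU, Φ, hΦ, hx⟩
      have hsub : Ioo (-min ε ε') (min ε ε') ⊆ Ioo (-η) η := Ioo_subset_Ioo (by linarith) hη
      exact ⟨U, hU, Φ, hΦ.mono (prod_mono le_rfl hsub),
        fun y hy => ⟨(hx y hy).1, (hx y hy).2.mono hsub⟩⟩
    refine ⟨min ε ε', lt_min hε hε', fun x hx => ?_⟩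
    rcases hx with hx | hx
    · exact key ε (min_le_left _ _) x (h x hx)
    · exact key ε' (min_le_right _ _) x (h' x hx)
  · intro x hx
    obtain ⟨ε, hε, U, hU, Φ, hΦ, h⟩ := exists_continuousOn_localFlow (hv x)
    refine ⟨interior U, mem_nhdsWithin_of_mem_nhds (interior_mem_nhds.2 hU), ε, hε, fun y hy => ?_⟩
    exact ⟨U, mem_interior_iff_mem_nhds.1 hy, Φ, hΦ, h⟩

variable [T2Space N]

/-- Integral curves starting in a compact invariant set are defined for all times. -/
theorem exists_isMIntegralCurve_of_compact_invariant
    (hv : ContMDiff I I.tangent 1 (fun x ↦ (⟨x, v x⟩ : TangentBundle I N))) (hK : IsCompact K)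
    (hinv : ∀ (γ : ℝ → N) (a : ℝ), IsMIntegralCurveOn γ v (Ioo (-a) a) → γ 0 ∈ K →
      ∀ t ∈ Ioo (-a) a, γ t ∈ K) {x : N} (hx : x ∈ K) :
    ∃ γ : ℝ → N, γ 0 = x ∧ IsMIntegralCurve γ v := by
  obtain ⟨ε, hε, hloc⟩ := exists_uniform_localFlow hv hK
  have hcur : ∀ y ∈ K, ∃ γ : ℝ → N, γ 0 = y ∧ IsMIntegralCurveOn γ v (Ioo (-ε) ε) := by
    intro y hy
    obtain ⟨U, hU, Φ, -, h⟩ := hloc y hy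
    exact ⟨fun t => Φ (y, t), h y (mem_of_mem_nhds hU)⟩
  rw [exists_isMIntegralCurve_iff_exists_isMIntegralCurveOn_Ioo hv]
  have hstep : ∀ n : ℕ, ∃ γ : ℝ → N, γ 0 = x ∧
      IsMIntegralCurveOn γ v (Ioo (-((n + 2) * (ε / 2))) ((n + 2) * (ε / 2))) := by
    intro n
    induction n with
    | zero =>
      obtain ⟨γ, h0, h⟩ := hcur x hx
      refine ⟨γ, h0, h.mono (Ioo_subset_Ioo ?_ ?_)⟩ <;> norm_num <;> linarith
    | succ n ih =>
      obtain ⟨γ, h0, hγ⟩ := ih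
      set a : ℝ := (n + 2) * (ε / 2) with ha
      -- New pieces of half-length `ε` are glued on at the times `±τ`. They overlap the old curve
      -- because `τ < a`, and they reach `τ + ε = a + 3ε/4`, beyond the required `a + ε/2`.
      set τ : ℝ := a - ε / 4 with hτ
      have hn : (0 : ℝ) ≤ n := n.cast_nonneg
      have haε : ε ≤ a := by rw [ha]; nlinarith
      -- Invariance is needed for curves on bounded intervals, since global ones are not yet
      -- available. It puts the gluing points in `K`, where the time `ε` is uniform.
      have hmem : ∀ t ∈ Ioo (-a) a, γ t ∈ K := hinv γ a hγ (h0 ▸ hx)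
      obtain ⟨γ1, h1, hγ1⟩ := hcur (γ (-τ)) (hmem _ ⟨by linarith, by linarith⟩)
      obtain ⟨γ2, h2, hγ2⟩ := hcur (γ τ) (hmem _ ⟨by linarith, by linarith⟩)
      rw [← isMIntegralCurveOn_comp_add (dt := τ)] at hγ1
      rw [← isMIntegralCurveOn_comp_sub (dt := τ)] at hγ2
      simp_rw [Set.mem_Ioo, ← sub_lt_iff_lt_add, ← lt_sub_iff_add_lt, ← Set.mem_Ioo] at hγ1
      simp_rw [Set.mem_Ioo, lt_sub_iff_add_lt, sub_lt_iff_lt_add, ← Set.mem_Ioo] at hγ2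
      have heq1 : γ (-τ) = (γ1 ∘ (· + τ)) (-τ) := by simp [h1]
      have heq2 : γ τ = (γ2 ∘ (· - τ)) τ := by simp [h2]
      have hτm : τ ∈ Ioo (-a) a := ⟨by linarith, by linarith⟩
      have h0m : (0 : ℝ) ∈ Ioo (-ε - τ) a := ⟨by linarith, by linarith⟩
      have h0m' : (0 : ℝ) ∈ Ioo (-a) a := ⟨by linarith, by linarith⟩
      have hA := isMIntegralCurveOn_piecewise (t₀ := -τ) hv hγ hγ1
        ⟨⟨by linarith, by linarith⟩, ⟨by linarith, by linarith⟩⟩ heq1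
      have hA' : IsMIntegralCurveOn (piecewise (Ioo (-a) a) γ (γ1 ∘ (· + τ))) v
          (Ioo (-ε - τ) a) :=
        hA.mono (union_comm _ _ ▸ Ioo_subset_Ioo_union_Ioo (by linarith) (by linarith) le_rfl)
      have hB := isMIntegralCurveOn_piecewise (t₀ := τ) hv hA' hγ2
        ⟨⟨by linarith, by linarith⟩, ⟨by linarith, by linarith⟩⟩
        (by rw [piecewise_eq_of_mem _ _ _ hτm, heq2])
      have hB' := hB.mono (s' := Ioo (-ε - τ) (ε + τ))
        (Ioo_subset_Ioo_union_Ioo le_rfl (by linarith) (by linarith))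
      refine ⟨_, ?_, hB'.mono (Ioo_subset_Ioo ?_ ?_)⟩
      · rw [piecewise_eq_of_mem _ _ _ h0m, piecewise_eq_of_mem _ _ _ h0m', h0]
      · push_cast; linarith
      · push_cast; linarith
  intro a
  obtain ⟨n, hn⟩ := exists_nat_gt (a / (ε / 2))
  obtain ⟨γ, h0, h⟩ := hstep n
  rw [div_lt_iff₀ (by positivity)] at hn
  exact ⟨γ, h0, h.mono (Ioo_subset_Ioo (by linarith) (by linarith))⟩

/-- The flow on a compact invariant set is continuous in the initial point. -/
theorem continuousOn_flow_of_compact_invariant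
    (hv : ContMDiff I I.tangent 1 (fun x ↦ (⟨x, v x⟩ : TangentBundle I N))) (hK : IsCompact K)
    {φ : ℝ → N → N} (hφ0 : ∀ x ∈ K, φ 0 x = x)
    (hφ : ∀ x ∈ K, IsMIntegralCurve (fun t => φ t x) v) (hmaps : ∀ t, MapsTo (φ t) K K)
    (t : ℝ) : ContinuousOn (φ t) K := by
  obtain ⟨ε, hε, hloc⟩ := exists_uniform_localFlow hv hK
  have hadd : ∀ s t, ∀ x ∈ K, φ (s + t) x = φ s (φ t x) := by
    intro s t x hx
    have := isMIntegralCurve_Ioo_eq_of_contMDiff_boundaryless (t₀ := 0) hv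
      ((hφ x hx).comp_add t) (hφ (φ t x) (hmaps t hx)) (by simp [hφ0 _ (hmaps t hx)])
    exact congrFun this s
  have hsmall : ∀ s ∈ Ioo (-ε) ε, ContinuousOn (φ s) K := by
    intro s hs x hx
    obtain ⟨U, hU, Φ, hΦ, h⟩ := hloc x hx
    have hc : ContinuousAt (fun y => Φ (y, s)) x := by
      have : ContinuousAt Φ (x, s) := hΦ.continuousAt (prod_mem_nhds hU (Ioo_mem_nhds hs.1 hs.2))
      exact ContinuousAt.comp (f := fun y : N => (y, s)) this (by fun_prop)
    refine hc.continuousWithinAt.congr_of_eventuallyEq ?_ ?_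
    · filter_upwards [mem_nhdsWithin_of_mem_nhds hU, self_mem_nhdsWithin] with y hyU hyK
      exact isMIntegralCurveOn_Ioo_eqOn_of_contMDiff_boundaryless (t₀ := 0)
        ⟨by linarith, hε⟩ hv ((hφ y hyK).isMIntegralCurveOn _) (h y hyU).2
        (by rw [hφ0 y hyK, (h y hyU).1]) hs
    · have hyU := mem_of_mem_nhds hU
      exact isMIntegralCurveOn_Ioo_eqOn_of_contMDiff_boundaryless (t₀ := 0)
        ⟨by linarith, hε⟩ hv ((hφ x hx).isMIntegralCurveOn _) (h x hyU).2
        (by rw [hφ0 x hx, (h x hyU).1]) hs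
  -- For large times the flow is the `n`-th iterate of the flow at time `t / n`, which lies within
  -- the uniform local time.
  obtain ⟨n, hn⟩ := exists_nat_gt (|t| / ε)
  have hn0 : (0 : ℝ) < n := lt_of_le_of_lt (by positivity) hn
  have hτ : t / n ∈ Ioo (-ε) ε := by
    rw [mem_Ioo, ← abs_lt, abs_div, abs_of_pos hn0, div_lt_iff₀ hn0]
    rwa [div_lt_iff₀ hε, mul_comm] at hn
  have hiter : ∀ k : ℕ, ContinuousOn (φ (k * (t / n))) K := by
    intro k
    induction k with
    | zero => simpa using continuousOn_id.congr hφ0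
    | succ k ih =>
      refine (ih.comp (hsmall _ hτ) (hmaps _)).congr fun x hx => ?_
      rw [Function.comp, ← hadd _ _ x hx]
      congr 1
      push_cast
      ring
  have := hiter n
  rwa [mul_div_cancel₀ t hn0.ne'] at this

end Flow

/-! ### Hausdorffness of the cotangent bundle -/

section FiberBundleSeparation

/-- The total space of a fiber bundle with Hausdorff base and fiber is Hausdorff. -/
theorem FiberBundle.t2Space_totalSpace {B F : Type*} [TopologicalSpace B] [TopologicalSpace F]
    (E : B → Type*) [TopologicalSpace (Bundle.TotalSpace F E)] [∀ b, TopologicalSpace (E b)]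
    [FiberBundle F E] [T2Space B] [T2Space F] : T2Space (Bundle.TotalSpace F E) := by
  refine ⟨fun x y hxy => ?_⟩
  by_cases hb : x.proj = y.proj
  · set e := trivializationAt F E x.proj
    have hx : x ∈ e.source := FiberBundle.mem_trivializationAt_proj_source
    have hy : y ∈ e.source := by
      rw [e.mem_source, ← hb]
      exact FiberBundle.mem_baseSet_trivializationAt' _
    obtain ⟨u, v, hu, hv, hxu, hyv, huv⟩ := t2_separation (e.injOn.ne hx hy hxy)
    refine ⟨e.source ∩ e ⁻¹' u, e.source ∩ e ⁻¹' v, e.continuousOn.isOpen_inter_preimage e.open_source hu,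
      e.continuousOn.isOpen_inter_preimage e.open_source hv, ⟨hx, hxu⟩, ⟨hy, hyv⟩, ?_⟩
    exact (huv.preimage e).mono inter_subset_right inter_subset_right
  · obtain ⟨u, v, hu, hv, hxu, hyv, huv⟩ := t2_separation hb
    exact ⟨_, _, hu.preimage (FiberBundle.continuous_proj F E),
      hv.preimage (FiberBundle.continuous_proj F E), hxu, hyv, huv.preimage _⟩

end FiberBundleSeparation

/-! ### Symplectic linear algebra -/

section ModelForm

variable {V : Type*} [NormedAddCommGroup V] [NormedSpace ℝ V]

/-- The standard symplectic form of `V × V*`. -/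
def modelForm (u v : V × (V →L[ℝ] ℝ)) : ℝ := u.2 v.1 - v.2 u.1

theorem modelForm_sub_left (u u' v : V × (V →L[ℝ] ℝ)) :
    modelForm (u - u') v = modelForm u v - modelForm u' v := by
  simp only [modelForm, Prod.fst_sub, Prod.snd_sub, sub_apply, map_sub]
  ring

/-- A map that preserves the tautological one-form preserves the symplectic form. -/
theorem symplectic_fderiv_of_tautological {W : Type*} [NormedAddCommGroup W] [NormedSpace ℝ W]
    (B : W →L[ℝ] V →L[ℝ] ℝ) {τ : V × W → V × W} {w₀ : V × W} (hτ : ContDiffAt ℝ 2 τ w₀)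
    (h : ∀ᶠ w in 𝓝 w₀, ∀ u, B (τ w).2 (fderiv ℝ τ w u).1 = B w.2 u.1) (u v : V × W) :
    B (fderiv ℝ τ w₀ u).2 (fderiv ℝ τ w₀ v).1 - B (fderiv ℝ τ w₀ v).2 (fderiv ℝ τ w₀ u).1 =
      B u.2 v.1 - B v.2 u.1 := by
  have hτd : HasFDerivAt τ (fderiv ℝ τ w₀) w₀ := (hτ.differentiableAt two_ne_zero).hasFDerivAt
  have hfd : HasFDerivAt (fderiv ℝ τ) (fderiv ℝ (fderiv ℝ τ) w₀) w₀ :=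
    ((hτ.fderiv_right (m := 1) (by norm_num)).differentiableAt one_ne_zero).hasFDerivAt
  have hsymm : IsSymmSndFDerivAt ℝ τ w₀ := hτ.isSymmSndFDerivAt (by simp)
  -- This is the derivative in direction `v` of the invariance of the tautological form. Exchanging
  -- `u` and `v` and subtracting cancels the second derivative of `τ` by symmetry, which is the
  -- statement `τ*(dθ) = d(τ*θ)` in coordinates.
  have key : ∀ u v : V × W, B (fderiv ℝ τ w₀ v).2 (fderiv ℝ τ w₀ u).1 +
      B (τ w₀).2 (fderiv ℝ (fderiv ℝ τ) w₀ v u).1 = B v.2 u.1 := by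
    intro u v
    have h1 : HasFDerivAt (fun w => (fderiv ℝ τ w u).1) _ w₀ :=
      (ContinuousLinearMap.fst ℝ V W).hasFDerivAt.comp w₀
        ((ContinuousLinearMap.apply ℝ (V × W) u).hasFDerivAt.comp w₀ hfd)
    have h2 := (B.hasFDerivAt.comp w₀ hτd.snd).clm_apply h1
    have h3 : HasFDerivAt (fun w : V × W => B w.2 u.1) _ w₀ :=
      (ContinuousLinearMap.apply ℝ ℝ u.1).hasFDerivAt.comp w₀
        (B.hasFDerivAt.comp w₀ hasFDerivAt_snd)
    have h4 := h2.congr_of_eventuallyEq (f₁ := fun w : V × W => B w.2 u.1)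
      (h.mono fun w hw => (hw u).symm)
    have := congrArg (fun L => L v) (h4.unique h3)
    simp at this
    linarith
  have e1 := key u v
  have e2 := key v u
  rw [hsymm.eq v u] at e1
  linarith

end ModelForm

theorem eq_zero_of_modelForm_eq_zero {u : PhaseModel} (h : ∀ v, modelForm u v = 0) : u = 0 := by
  refine Prod.ext ?_ ?_
  · ext i
    simpa [modelForm] using h (0, EuclideanSpace.proj i)
  · ext x
    simpa [modelForm] using h (x, 0)

/-- The Hamilton vector of a linear form. -/
noncomputable def modelHamilton (L : PhaseModel →L[ℝ] ℝ) : PhaseModel :=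
  (WithLp.toLp 2 fun i : Fin 2 => L (0, EuclideanSpace.proj i),
    -L.comp (ContinuousLinearMap.inl ℝ Plane (Plane →L[ℝ] ℝ)))

theorem covector_eq_sum (η : Plane →L[ℝ] ℝ) :
    η = ∑ i : Fin 2, η (EuclideanSpace.single i 1) • (EuclideanSpace.proj i : Plane →L[ℝ] ℝ) := by
  ext x
  have hx : x = ∑ i : Fin 2, x i • (EuclideanSpace.single i 1 : Plane) := by
    ext j; fin_cases j <;> simp [Fin.sum_univ_two]
  conv_lhs => rw [hx]
  simp [Fin.sum_univ_two, mul_comm]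

/-- Together with nondegeneracy of the form this characterizes the Hamilton vector without
coordinates. Every later change of coordinates for Hamilton fields goes through this
characterization. -/
theorem modelForm_modelHamilton (L : PhaseModel →L[ℝ] ℝ) (v : PhaseModel) :
    modelForm (modelHamilton L) v = -L v := by
  obtain ⟨y, η⟩ := v
  have hv : ((y, η) : PhaseModel) = (y, 0) + ∑ i : Fin 2, η (EuclideanSpace.single i 1) •
      ((0, EuclideanSpace.proj i) : PhaseModel) := by
    refine Prod.ext ?_ ?_
    · simp [Fin.sum_univ_two]
    · have := covector_eq_sum η
      simp only [Fin.sum_univ_two] at this ⊢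
      simpa using this
  have hη : ∀ w : Plane, η w = ∑ i : Fin 2, η (EuclideanSpace.single i 1) * w i := by
    intro w
    conv_lhs => rw [covector_eq_sum η]
    simp [Fin.sum_univ_two]
  have e1 : L (y, η) = L (y, 0) + ∑ i : Fin 2, η (EuclideanSpace.single i 1) *
      L (0, EuclideanSpace.proj i) := by
    rw [hv, map_add, map_sum]
    simp only [map_smul, smul_eq_mul]
  rw [e1]
  simp only [modelForm, modelHamilton]
  rw [hη]
  simp only [neg_apply, ContinuousLinearMap.comp_apply, ContinuousLinearMap.inl_apply]
  ring

set_option synthInstance.maxHeartbeats 200000 in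
theorem contDiff_modelHamilton {n : WithTop ℕ∞} : ContDiff ℝ n modelHamilton := by
  refine ContDiff.prodMk ?_ ?_
  · rw [contDiff_euclidean]
    intro i
    exact contDiff_id.clm_apply contDiff_const
  · exact (contDiff_id.clm_comp contDiff_const).neg

/-! ### Canonical charts of the cotangent bundle are symplectic -/

section Cotangent

variable {M : Type*} [TopologicalSpace M] [ChartedSpace Plane M] [IsManifold 𝓘(ℝ, Plane) ω M]

instance [T2Space M] : T2Space (Cotangent M) := FiberBundle.t2Space_totalSpace _

theorem extChartAt_cotangent_fst (z₀ z : Cotangent M) :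
    (extChartAt phaseI z₀ z).1 = extChartAt 𝓘(ℝ, Plane) z₀.1 z.1 :=
  rfl

theorem mem_extChartAt_cotangent_source (z₀ z : Cotangent M) :
    z ∈ (extChartAt phaseI z₀).source ↔ z.1 ∈ (chartAt Plane z₀.1).source := by
  rw [extChartAt_source, FiberBundle.chartedSpace_chartAt]
  simp [mfld_simps]
  intro h
  rw [hom_trivializationAt_apply]
  exact h

/-- Covectors are carried by the transpose of the inverse derivative. Tested on a vector, this is
exactly the invariance of the tautological one-form `ξ dx` under changes of chart. -/
theorem extChartAt_cotangent_snd (z₀ z : Cotangent M) (h : z ∈ (extChartAt phaseI z₀).source)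
    (u : Plane) : (extChartAt phaseI z₀ z).2 u =
      (show Plane →L[ℝ] ℝ from z.2) (tangentCoordChange 𝓘(ℝ, Plane) z₀.1 z.1 z.1 u) := by
  rw [mem_extChartAt_cotangent_source] at h
  have : extChartAt phaseI z₀ z = chartAt (ModelProd Plane (Plane →L[ℝ] ℝ)) z₀ z := rfl
  rw [this, hom_chart]
  simp only [ContinuousLinearMap.inCoordinates]
  rw [TangentBundle.symmL_trivializationAt_eq_core h]
  simp
  rfl

theorem hasFDerivAt_tangentCoordChange {E H N : Type*} [NormedAddCommGroup E] [NormedSpace ℝ E]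
    [TopologicalSpace H] {I : ModelWithCorners ℝ E H} [TopologicalSpace N] [ChartedSpace H N]
    [IsManifold I 1 N] [I.Boundaryless] {x y z : N}
    (h : z ∈ (extChartAt I x).source ∩ (extChartAt I y).source) :
    HasFDerivAt (extChartAt I y ∘ (extChartAt I x).symm) (tangentCoordChange I x y z)
      (extChartAt I x z) := by
  simpa [I.range_eq_univ] using hasFDerivWithinAt_tangentCoordChange h

theorem eventually_mem_target_and_symm_mem_source {E H N : Type*} [NormedAddCommGroup E]
    [NormedSpace ℝ E] [TopologicalSpace H] {I : ModelWithCorners ℝ E H} [TopologicalSpace N]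
    [ChartedSpace H N] [I.Boundaryless] {x y z : N}
    (h : z ∈ (extChartAt I x).source ∩ (extChartAt I y).source) :
    ∀ᶠ w in 𝓝 (extChartAt I x z), w ∈ (extChartAt I x).target ∧
      (extChartAt I x).symm w ∈ (extChartAt I y).source := by
  have ht : (extChartAt I x).target ∈ 𝓝 (extChartAt I x z) :=
    (isOpen_extChartAt_target x).mem_nhds ((extChartAt I x).map_source h.1)
  refine (eventually_mem_set.2 ht).and ?_
  refine (continuousAt_extChartAt_symm' h.1).eventually ?_
  rw [(extChartAt I x).left_inv h.1]
  exact (isOpen_extChartAt_source y).mem_nhds h.2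

theorem contDiffAt_extChartAt_comp_symm {E H N : Type*} [NormedAddCommGroup E]
    [NormedSpace ℝ E] [TopologicalSpace H] {I : ModelWithCorners ℝ E H} [TopologicalSpace N]
    [ChartedSpace H N] {n : WithTop ℕ∞} [IsManifold I n N] [I.Boundaryless] {x y z : N}
    (h : z ∈ (extChartAt I x).source ∩ (extChartAt I y).source) :
    ContDiffAt ℝ n (extChartAt I y ∘ (extChartAt I x).symm) (extChartAt I x z) := by
  have hs : extChartAt I x z ∈ ((extChartAt I x).symm ≫ extChartAt I y).source := by
    rw [PartialEquiv.trans_source'', PartialEquiv.symm_symm, PartialEquiv.symm_target]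
    exact mem_image_of_mem _ h
  have := contDiffWithinAt_ext_coord_change (n := n) y x hs
  rwa [I.range_eq_univ, contDiffWithinAt_univ] at this

/-- The coordinate changes of the cotangent bundle preserve the symplectic form. -/
theorem modelForm_tangentCoordChange {z₁ z₀ z : Cotangent M}
    (h : z ∈ (extChartAt phaseI z₁).source ∩ (extChartAt phaseI z₀).source) (u v : PhaseModel) :
    modelForm (tangentCoordChange phaseI z₁ z₀ z u) (tangentCoordChange phaseI z₁ z₀ z v) =
      modelForm u v := by
  set τ : PhaseModel → PhaseModel := extChartAt phaseI z₀ ∘ (extChartAt phaseI z₁).symm with hτ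
  set w₀ := extChartAt phaseI z₁ z with hw₀
  have hsmooth : ContDiffAt ℝ 2 τ w₀ := contDiffAt_extChartAt_comp_symm h
  rw [← (hasFDerivAt_tangentCoordChange h).fderiv]
  -- It remains to see that the change of charts preserves the tautological form at all nearby
  -- points, not only at `w₀`, since the identity gets differentiated.
  refine symplectic_fderiv_of_tautological (ContinuousLinearMap.id ℝ (Plane →L[ℝ] ℝ)) hsmooth ?_ u v
  simp only [ContinuousLinearMap.id_apply]
  have hopen : ∀ᶠ w in 𝓝 w₀, w ∈ (extChartAt phaseI z₁).target ∧
      (extChartAt phaseI z₁).symm w ∈ (extChartAt phaseI z₀).source :=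
    eventually_mem_target_and_symm_mem_source h
  filter_upwards [hopen.eventually_nhds] with w hw u
  obtain ⟨hwt, hws⟩ := hw.self_of_nhds
  set z' := (extChartAt phaseI z₁).symm w with hz'
  have hz's : z' ∈ (extChartAt phaseI z₁).source := (extChartAt phaseI z₁).map_target hwt
  have hwz : w = extChartAt phaseI z₁ z' := ((extChartAt phaseI z₁).right_inv hwt).symm
  have hb1 : z'.1 ∈ (extChartAt 𝓘(ℝ, Plane) z₁.1).source := by
    rw [extChartAt_source]; exact (mem_extChartAt_cotangent_source _ _).1 hz's
  have hb0 : z'.1 ∈ (extChartAt 𝓘(ℝ, Plane) z₀.1).source := by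
    rw [extChartAt_source]; exact (mem_extChartAt_cotangent_source _ _).1 hws
  have hτ' : HasFDerivAt τ (tangentCoordChange phaseI z₁ z₀ z') w := by
    rw [hwz]; exact hasFDerivAt_tangentCoordChange ⟨hz's, hws⟩
  have hbase : HasFDerivAt (extChartAt 𝓘(ℝ, Plane) z₀.1 ∘ (extChartAt 𝓘(ℝ, Plane) z₁.1).symm)
      (tangentCoordChange 𝓘(ℝ, Plane) z₁.1 z₀.1 z'.1) w.1 := by
    rw [hwz, extChartAt_cotangent_fst]; exact hasFDerivAt_tangentCoordChange ⟨hb1, hb0⟩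
  -- The position after the change of charts depends on the position only, so its derivative is the
  -- coordinate change of the base.
  have hfst : (fderiv ℝ τ w u).1 = tangentCoordChange 𝓘(ℝ, Plane) z₁.1 z₀.1 z'.1 u.1 := by
    have h1 := hτ'.fst
    have h2 := hbase.comp w (hasFDerivAt_fst (𝕜 := ℝ) (E := Plane) (F := Plane →L[ℝ] ℝ))
    have h3 := h2.congr_of_eventuallyEq (f₁ := fun w => (τ w).1) ?_
    · rw [hτ'.fderiv]
      exact congrArg (fun L => L u) (h1.unique h3)
    · filter_upwards [hw] with w' hw'
      have hs := (extChartAt phaseI z₁).map_target hw'.1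
      have : w'.1 = extChartAt 𝓘(ℝ, Plane) z₁.1 ((extChartAt phaseI z₁).symm w').1 := by
        rw [← extChartAt_cotangent_fst, (extChartAt phaseI z₁).right_inv hw'.1]
      simp only [hτ, Function.comp_apply, extChartAt_cotangent_fst]
      rw [this, (extChartAt 𝓘(ℝ, Plane) z₁.1).left_inv]
      rw [extChartAt_source]; exact (mem_extChartAt_cotangent_source _ _).1 hs
  rw [hfst]
  have e0 : (τ w).2 = (extChartAt phaseI z₀ z').2 := rfl
  rw [e0, extChartAt_cotangent_snd _ _ hws]
  conv_rhs => rw [hwz, extChartAt_cotangent_snd _ _ hz's]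
  rw [tangentCoordChange_comp ⟨⟨hb1, hb0⟩, mem_extChartAt_source _⟩]

end Cotangent

/-! ### The Hamilton flow on the compact energy surface -/

section HamiltonFlow

variable {M : Type*} [TopologicalSpace M] [ChartedSpace Plane M] [IsManifold 𝓘(ℝ, Plane) ω M]
  {p : Cotangent M → ℝ}

theorem ContMDiff.contDiffAt_comp_extChartAt_symm (hp : ContMDiff phaseI 𝓘(ℝ, ℝ) ω p)
    (z₀ : Cotangent M) {w : PhaseModel} (hw : w ∈ (extChartAt phaseI z₀).target) :
    ContDiffAt ℝ ω (p ∘ (extChartAt phaseI z₀).symm) w := by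
  have h1 : ContMDiffAt 𝓘(ℝ, PhaseModel) phaseI ω (extChartAt phaseI z₀).symm w :=
    (contMDiffOn_extChartAt_symm z₀).contMDiffAt ((isOpen_extChartAt_target z₀).mem_nhds hw)
  exact ((hp _).comp w h1).contDiffAt

theorem differential_apply (hp : ContMDiff phaseI 𝓘(ℝ, ℝ) ω p) {z₀ z : Cotangent M}
    (h : z ∈ (extChartAt phaseI z₀).source) (u : PhaseModel) :
    differential p z u = fderiv ℝ (p ∘ (extChartAt phaseI z₀).symm) (extChartAt phaseI z₀ z)
      (tangentCoordChange phaseI z z₀ z u) := by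
  have h1 : differential p z = fderiv ℝ (p ∘ (extChartAt phaseI z).symm) (extChartAt phaseI z z) := by
    have hd : MDifferentiableAt phaseI 𝓘(ℝ, ℝ) p z := (hp z).mdifferentiableAt (by simp)
    have h2 : HasFDerivWithinAt (p ∘ (extChartAt phaseI z).symm) (differential p z)
        (range phaseI) (extChartAt phaseI z z) := hd.hasMFDerivAt.2
    rw [ModelWithCorners.range_eq_univ] at h2
    exact (hasFDerivWithinAt_univ.1 h2).fderiv.symm
  have hD := hasFDerivAt_tangentCoordChange (I := phaseI) (x := z) (y := z₀) (z := z)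
    ⟨mem_extChartAt_source z, h⟩
  have hP : HasFDerivAt (p ∘ (extChartAt phaseI z₀).symm)
      (fderiv ℝ (p ∘ (extChartAt phaseI z₀).symm) (extChartAt phaseI z₀ z))
      ((extChartAt phaseI z₀ ∘ (extChartAt phaseI z).symm) (extChartAt phaseI z z)) := by
    have e : (extChartAt phaseI z₀ ∘ (extChartAt phaseI z).symm) (extChartAt phaseI z z) =
        extChartAt phaseI z₀ z := by
      simp only [Function.comp_apply, (extChartAt phaseI z).left_inv (mem_extChartAt_source z)]
    rw [e]
    exact ((hp.contDiffAt_comp_extChartAt_symm z₀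
      ((extChartAt phaseI z₀).map_source h)).differentiableAt (by simp)).hasFDerivAt
  have hc := hP.comp _ hD
  have he : (p ∘ (extChartAt phaseI z).symm) =ᶠ[𝓝 (extChartAt phaseI z z)]
      ((p ∘ (extChartAt phaseI z₀).symm) ∘ (extChartAt phaseI z₀ ∘ (extChartAt phaseI z).symm)) := by
    filter_upwards [eventually_mem_target_and_symm_mem_source (I := phaseI)
      ⟨mem_extChartAt_source z, h⟩] with w hw
    simp only [Function.comp_apply]
    rw [(extChartAt phaseI z₀).left_inv hw.2]
  rw [h1, (hc.congr_of_eventuallyEq he).fderiv]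
  rfl

/-- The coordinate change is symplectic and carries `dp` along, so both sides pair equally with
every vector. The field is defined at `z` through the preferred chart at `z`, which need not vary
continuously with `z`. Reading it in one fixed chart is what makes its smoothness visible. -/
theorem tangentCoordChange_hamiltonField (hp : ContMDiff phaseI 𝓘(ℝ, ℝ) ω p) {z₀ z : Cotangent M}
    (h : z ∈ (extChartAt phaseI z₀).source) :
    tangentCoordChange phaseI z z₀ z (hamiltonField p z) =
      modelHamilton (fderiv ℝ (p ∘ (extChartAt phaseI z₀).symm) (extChartAt phaseI z₀ z)) := by
  change tangentCoordChange phaseI z z₀ z (modelHamilton (differential p z)) = _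
  rw [← sub_eq_zero]
  refine eq_zero_of_modelForm_eq_zero fun v => ?_
  have hz : z ∈ (extChartAt phaseI z).source := mem_extChartAt_source z
  have hv : v = tangentCoordChange phaseI z z₀ z (tangentCoordChange phaseI z₀ z z v) := by
    rw [tangentCoordChange_comp ⟨⟨h, hz⟩, h⟩, tangentCoordChange_self h]
  rw [modelForm_sub_left, modelForm_modelHamilton, sub_neg_eq_add, hv,
    modelForm_tangentCoordChange ⟨hz, h⟩, ← differential_apply hp h, modelForm_modelHamilton,
    neg_add_cancel]

theorem contMDiff_hamiltonField (hp : ContMDiff phaseI 𝓘(ℝ, ℝ) ω p) :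
    ContMDiff phaseI phaseI.tangent 1
      (fun z ↦ (⟨z, hamiltonField p z⟩ : TangentBundle phaseI (Cotangent M))) := by
  intro z₀
  rw [Bundle.contMDiffAt_totalSpace]
  refine ⟨contMDiffAt_id, ?_⟩
  have hs : (extChartAt phaseI z₀).source ∈ 𝓝 z₀ := extChartAt_source_mem_nhds z₀
  have he : (fun z => (trivializationAt PhaseModel (TangentSpace phaseI) z₀
        (⟨z, hamiltonField p z⟩ : TangentBundle phaseI (Cotangent M))).2) =ᶠ[𝓝 z₀]
      fun z => modelHamilton (fderiv ℝ (p ∘ (extChartAt phaseI z₀).symm) (extChartAt phaseI z₀ z)) := by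
    filter_upwards [hs] with z hz
    rw [← tangentCoordChange_hamiltonField hp hz]
    rfl
  refine ContMDiffAt.congr_of_eventuallyEq ?_ he
  have h1 : ContDiffAt ℝ 1 (fun w => modelHamilton (fderiv ℝ (p ∘ (extChartAt phaseI z₀).symm) w))
      (extChartAt phaseI z₀ z₀) := by
    refine contDiff_modelHamilton.contDiffAt.comp _ ?_
    exact (hp.contDiffAt_comp_extChartAt_symm z₀ (mem_extChartAt_target z₀)).fderiv_right le_top
  exact (h1.contMDiffAt).comp z₀ contMDiffAt_extChartAt

/-- A function whose derivative along the vector field vanishes is constant along its integral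
curves. -/
theorem IsMIntegralCurveOn.apply_eq_of_differential_eq_zero {v : ∀ z : Cotangent M, TangentSpace phaseI z}
    {f : Cotangent M → ℝ} (hf : ContMDiff phaseI 𝓘(ℝ, ℝ) ω f)
    (hfv : ∀ z, differential f z (v z) = 0) {γ : ℝ → Cotangent M} {a b : ℝ}
    (hγ : IsMIntegralCurveOn γ v (Ioo a b)) {s t : ℝ} (hs : s ∈ Ioo a b) (ht : t ∈ Ioo a b) :
    f (γ s) = f (γ t) := by
  have hd : ∀ t ∈ Ioo a b, HasFDerivAt (f ∘ γ) (0 : ℝ →L[ℝ] ℝ) t := by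
    intro t ht
    have h1 := (hγ t ht).hasMFDerivAt (Ioo_mem_nhds ht.1 ht.2)
    have h2 : HasMFDerivAt phaseI 𝓘(ℝ, ℝ) f (γ t) (mfderiv phaseI 𝓘(ℝ, ℝ) f (γ t)) :=
      ((hf (γ t)).mdifferentiableAt (by simp)).hasMFDerivAt
    refine HasFDerivAt.congr_fderiv (h2.comp t h1).hasFDerivAt ?_
    ext
    change differential f (γ t) ((1 : ℝ) • v (γ t)) = 0
    rw [one_smul]
    exact hfv (γ t)
  exact (convex_Ioo a b).is_const_of_fderivWithin_eq_zero (𝕜 := ℝ) (f := f ∘ γ)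
    (fun t ht => (hd t ht).differentiableAt.differentiableWithinAt)
    (fun t ht => by rw [fderivWithin_of_isOpen isOpen_Ioo ht, (hd t ht).fderiv]) hs ht

theorem differential_hamiltonField_self (z : Cotangent M) :
    differential p z (hamiltonField p z) = 0 := by
  have h := modelForm_modelHamilton (differential p z) (modelHamilton (differential p z))
  have : hamiltonField p z = modelHamilton (differential p z) := rfl
  rw [this]
  simp only [modelForm, sub_self] at h
  linarith

/-- Dominated convergence for integrals depending on a point of `T*M` requires countably generated
neighborhood filters. -/
instance : FirstCountableTopology (Cotangent M) :=
  ⟨fun z => by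
    rw [← map_extChartAt_symm_nhdsWithin_range (I := phaseI) z]
    infer_instance⟩

variable [T2Space M]

/-- Integral curves are unique in a Hausdorff manifold, so the choice made in `hamiltonFlow` is
immaterial. -/
theorem hamiltonFlow_eq (hp : ContMDiff phaseI 𝓘(ℝ, ℝ) ω p) {γ : ℝ → Cotangent M}
    (hγ : IsMIntegralCurve (I := phaseI) γ (hamiltonField p)) (t : ℝ) :
    hamiltonFlow p t (γ 0) = γ t := by
  have h : ∃ γ' : ℝ → Cotangent M, γ' 0 = γ 0 ∧
    IsMIntegralCurve (I := phaseI) γ' (hamiltonField p) := ⟨γ, rfl, hγ⟩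
  rw [hamiltonFlow, dif_pos h]
  exact congrFun (isMIntegralCurve_Ioo_eq_of_contMDiff_boundaryless (t₀ := 0)
    (contMDiff_hamiltonField hp) h.choose_spec.2 hγ h.choose_spec.1) t

/-- `p` is conserved, hence the compact set `p⁻¹(0)` is invariant and no curve in it can escape in
finite time. -/
theorem exists_hamilton_integralCurve (hp : ContMDiff phaseI 𝓘(ℝ, ℝ) ω p)
    (hcompact : IsCompact (p ⁻¹' {0})) {z : Cotangent M} (hz : p z = 0) :
    ∃ γ : ℝ → Cotangent M, γ 0 = z ∧ IsMIntegralCurve (I := phaseI) γ (hamiltonField p) := by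
  refine exists_isMIntegralCurve_of_compact_invariant (contMDiff_hamiltonField hp) hcompact ?_ hz
  intro γ a hγ h0 t ht
  have h0m : (0 : ℝ) ∈ Ioo (-a) a := ⟨by linarith [ht.1, ht.2], by linarith [ht.1, ht.2]⟩
  have := hγ.apply_eq_of_differential_eq_zero hp differential_hamiltonField_self h0m ht
  change p (γ t) = 0
  rw [← this]; exact h0

section CompactEnergySurface

variable (hp : ContMDiff phaseI 𝓘(ℝ, ℝ) ω p) (hcompact : IsCompact (p ⁻¹' {0}))
include hp hcompact

theorem isMIntegralCurve_hamiltonFlow {z : Cotangent M} (hz : p z = 0) :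
    IsMIntegralCurve (I := phaseI) (fun t => hamiltonFlow p t z) (hamiltonField p) := by
  obtain ⟨γ, rfl, hγ⟩ := exists_hamilton_integralCurve hp hcompact hz
  simpa only [hamiltonFlow_eq hp hγ] using hγ

theorem hamiltonFlow_zero {z : Cotangent M} (hz : p z = 0) : hamiltonFlow p 0 z = z := by
  obtain ⟨γ, rfl, hγ⟩ := exists_hamilton_integralCurve hp hcompact hz
  exact hamiltonFlow_eq hp hγ 0

theorem apply_hamiltonFlow {f : Cotangent M → ℝ} (hf : ContMDiff phaseI 𝓘(ℝ, ℝ) ω f)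
    (hpf : ∀ z, differential f z (hamiltonField p z) = 0) {z : Cotangent M} (hz : p z = 0) (t : ℝ) :
    f (hamiltonFlow p t z) = f z := by
  have h := (isMIntegralCurve_hamiltonFlow hp hcompact hz).isMIntegralCurveOn
    (Ioo (-(|t| + 1)) (|t| + 1))
  have h1 := h.apply_eq_of_differential_eq_zero hf hpf (s := t) (t := 0)
    (abs_lt.1 (lt_add_one _)) (abs_lt.1 (by simp; positivity))
  rw [hamiltonFlow_zero hp hcompact hz] at h1
  exact h1

theorem continuousOn_hamiltonFlow (t : ℝ) : ContinuousOn (hamiltonFlow p t) (p ⁻¹' {0}) := by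
  refine continuousOn_flow_of_compact_invariant (φ := hamiltonFlow p) (contMDiff_hamiltonField hp)
    hcompact (fun x hx => hamiltonFlow_zero hp hcompact hx)
    (fun x hx => isMIntegralCurve_hamiltonFlow hp hcompact hx) ?_ t
  intro t z hz
  exact (apply_hamiltonFlow hp hcompact hp differential_hamiltonField_self hz t).trans hz

theorem continuous_hamiltonFlow_time {z : Cotangent M} (hz : p z = 0) :
    Continuous fun t => hamiltonFlow p t z :=
  (isMIntegralCurve_hamiltonFlow hp hcompact hz).continuous

theorem continuousOn_flowAverage {q : Cotangent M → ℝ} (hq : Continuous q) (T : ℝ) :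
    ContinuousOn (flowAverage p q T) (p ⁻¹' {0}) := by
  refine ContinuousOn.mul continuousOn_const ?_
  obtain ⟨C, hC⟩ := hcompact.exists_bound_of_continuousOn hq.continuousOn
  intro z hz
  refine intervalIntegral.continuousWithinAt_of_dominated_interval (bound := fun _ => C) ?_ ?_ ?_ ?_
  · filter_upwards [self_mem_nhdsWithin] with w hw
    exact (hq.comp (continuous_hamiltonFlow_time hp hcompact hw)).aestronglyMeasurable
  · filter_upwards [self_mem_nhdsWithin] with w hw
    refine Eventually.of_forall fun t _ => hC _ ?_
    exact (apply_hamiltonFlow hp hcompact hp differential_hamiltonField_self hw t).trans hw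
  · exact intervalIntegrable_const
  · exact Eventually.of_forall fun t _ => hq.continuousAt.comp_continuousWithinAt
      (continuousOn_hamiltonFlow hp hcompact t z hz)

end CompactEnergySurface

end HamiltonFlow

/-! ### The flow in action-angle coordinates -/

/-- The average of `Q` over the segment from `x` to `x + T w`. -/
noncomputable def lineAverage {V E : Type*} [AddCommGroup V] [Module ℝ V] [NormedAddCommGroup E]
    [NormedSpace ℝ E] (Q : V → E) (w : V) (T : ℝ) (x : V) : E :=
  T⁻¹ • ∫ t in (0 : ℝ)..T, Q (x + t • w)

theorem finrank_phaseModel : Module.finrank ℝ PhaseModel = 4 := by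
  have h : Module.finrank ℝ (Plane →L[ℝ] ℝ) = 2 := by
    rw [← (LinearMap.toContinuousLinearMap (𝕜 := ℝ) (E := Plane) (F' := ℝ)).finrank_eq,
      Module.finrank_linearMap]
    simp
  rw [Module.finrank_prod, h]
  simp

namespace ActionAngleChart

variable {M : Type*} [TopologicalSpace M] [ChartedSpace Plane M] [IsManifold 𝓘(ℝ, Plane) ω M]
  {p f : Cotangent M → ℝ} {a₀ : ℝ} (c : ActionAngleChart p f a₀)

/-- The frequency vector of the torus with parameter `a`. -/
noncomputable def frequencyVector (a : ℝ) : Fin 2 → ℝ := fun i => c.frequency i a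

theorem contMDiffAt_κ (x : Fin 2 → ℝ) {ξ : Fin 2 → ℝ} (hξ : ξ ∈ c.B) :
    ContMDiffAt 𝓘(ℝ, (Fin 2 → ℝ) × (Fin 2 → ℝ)) phaseI ω c.κ (x, ξ) :=
  c.analytic_κ.contMDiffAt ((isOpen_univ.prod c.isOpen_B).mem_nhds ⟨mem_univ _, hξ⟩)

theorem continuous_κ_left {ξ : Fin 2 → ℝ} (hξ : ξ ∈ c.B) : Continuous fun x => c.κ (x, ξ) :=
  continuous_iff_continuousAt.2 fun x =>
    (c.contMDiffAt_κ x hξ).continuousAt.comp (f := fun x => (x, ξ)) (by fun_prop)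

theorem κ_periodic (x : Fin 2 → ℝ) {ξ : Fin 2 → ℝ} (hξ : ξ ∈ c.B) (k : Fin 2 → ℤ) :
    c.κ (fun i => x i + 2 * Real.pi * k i, ξ) = c.κ (x, ξ) :=
  ((c.κ_eq_iff x _ ξ hξ ξ hξ).2 ⟨rfl, k, fun _ => rfl⟩).symm

/-- The form on the source is nondegenerate, so `D` is injective, and both spaces have dimension
four. -/
theorem surjective_of_symplectic (D : (Fin 2 → ℝ) × (Fin 2 → ℝ) →L[ℝ] PhaseModel)
    (h : ∀ u v, modelForm (D u) (D v) = (∑ i, u.2 i * v.1 i) - ∑ i, v.2 i * u.1 i) :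
    Function.Surjective D := by
  have hinj : Function.Injective D := by
    rw [injective_iff_map_eq_zero]
    intro u hu
    have h0 : ∀ v : (Fin 2 → ℝ) × (Fin 2 → ℝ), (∑ i, u.2 i * v.1 i) - ∑ i, v.2 i * u.1 i = 0 := fun v => by
      rw [← h, hu]; simp [modelForm]
    refine Prod.ext (funext fun i => ?_) (funext fun i => ?_)
    · simpa [Pi.single_apply] using h0 (0, Pi.single i 1)
    · simpa [Pi.single_apply] using h0 (Pi.single i 1, 0)
  exact (LinearMap.injective_iff_surjective_of_finrank_eq_finrank (f := D.toLinearMap)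
    (by rw [finrank_phaseModel]; simp)).1 hinj

/-- Since `p ∘ κ` depends on the actions alone, `dp ∘ dκ = Σ ω_i dξ_i`. As `κ` is symplectic, the
image of `(ω, 0)` pairs with every `dκ(v)` like `H_p` does, and the vectors `dκ(v)` exhaust the
tangent space. Hence the flow is the translation of the angles with velocity `ω`. -/
theorem mfderiv_κ_frequency (hp : ContMDiff phaseI 𝓘(ℝ, ℝ) ω p) (x : Fin 2 → ℝ) {a : ℝ}
    (ha : c.action a ∈ c.B) :
    mfderiv 𝓘(ℝ, (Fin 2 → ℝ) × (Fin 2 → ℝ)) phaseI c.κ (x, c.action a)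
      ((c.frequencyVector a, 0) : (Fin 2 → ℝ) × (Fin 2 → ℝ)) =
        hamiltonField p (c.κ (x, c.action a)) := by
  set z := c.κ (x, c.action a) with hz
  let D : (Fin 2 → ℝ) × (Fin 2 → ℝ) →L[ℝ] PhaseModel :=
    mfderiv 𝓘(ℝ, (Fin 2 → ℝ) × (Fin 2 → ℝ)) phaseI c.κ (x, c.action a)
  have hD : ∀ u v, modelForm (D u) (D v) = (∑ i, u.2 i * v.1 i) - ∑ i, v.2 i * u.1 i :=
    fun u v => c.symplectic_κ x _ ha u v
  have hκ : HasMFDerivAt 𝓘(ℝ, (Fin 2 → ℝ) × (Fin 2 → ℝ)) phaseI c.κ (x, c.action a) D :=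
    ((c.contMDiffAt_κ x ha).mdifferentiableAt (by simp)).hasMFDerivAt
  have hpd : HasMFDerivAt phaseI 𝓘(ℝ, ℝ) p z (mfderiv phaseI 𝓘(ℝ, ℝ) p z) :=
    ((hp z).mdifferentiableAt (by simp)).hasMFDerivAt
  have h1 : HasFDerivAt (p ∘ c.κ) ((differential p z).comp D) (x, c.action a) :=
    (hpd.comp _ hκ).hasFDerivAt
  have hg : HasFDerivAt (fun ξ : Fin 2 → ℝ => p (c.κ (0, ξ)))
      (fderiv ℝ (fun ξ : Fin 2 → ℝ => p (c.κ (0, ξ))) (c.action a)) (c.action a) := by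
    refine DifferentiableAt.hasFDerivAt ?_
    have : ContMDiffAt 𝓘(ℝ, (Fin 2 → ℝ) × (Fin 2 → ℝ)) 𝓘(ℝ, ℝ) ω (p ∘ c.κ) (0, c.action a) :=
      (hp _).comp _ (c.contMDiffAt_κ 0 ha)
    exact (this.contDiffAt.differentiableAt (by simp)).comp (c.action a)
      (f := fun ξ : Fin 2 → ℝ => ((0 : Fin 2 → ℝ), ξ)) (by fun_prop)
  have h2 := hg.comp (x, c.action a) (hasFDerivAt_snd (𝕜 := ℝ) (E := Fin 2 → ℝ) (F := Fin 2 → ℝ))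
  have h3 := h2.congr_of_eventuallyEq (f₁ := p ∘ c.κ) (by
    filter_upwards [(isOpen_univ.prod c.isOpen_B).mem_nhds
      (show (x, c.action a) ∈ univ ×ˢ c.B from ⟨mem_univ _, ha⟩)] with w hw
    exact c.p_indep_angle w.1 w.2 hw.2)
  have hdp : ∀ v, differential p z (D v) = ∑ i, v.2 i * c.frequency i a := by
    intro v
    have e : differential p z (D v) =
        fderiv ℝ (fun ξ : Fin 2 → ℝ => p (c.κ (0, ξ))) (c.action a) v.2 :=
      congrArg (fun L => L v) (h1.unique h3)
    rw [e]
    conv_lhs => rw [pi_eq_sum_univ' v.2]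
    simp only [map_sum, map_smul, smul_eq_mul, frequency]
  change D (c.frequencyVector a, 0) = modelHamilton (differential p z)
  rw [← sub_eq_zero]
  refine eq_zero_of_modelForm_eq_zero fun w => ?_
  obtain ⟨v, rfl⟩ := surjective_of_symplectic D hD w
  rw [modelForm_sub_left, modelForm_modelHamilton, hD, hdp]
  simp [frequencyVector]

theorem isMIntegralCurve_κ (hp : ContMDiff phaseI 𝓘(ℝ, ℝ) ω p) (x : Fin 2 → ℝ) {a : ℝ}
    (ha : c.action a ∈ c.B) :
    IsMIntegralCurve (I := phaseI) (fun t : ℝ => c.κ (x + t • c.frequencyVector a, c.action a))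
      (hamiltonField p) := by
  intro t
  have hκ : HasMFDerivAt 𝓘(ℝ, (Fin 2 → ℝ) × (Fin 2 → ℝ)) phaseI c.κ
      (x + t • c.frequencyVector a, c.action a) _ :=
    ((c.contMDiffAt_κ (x + t • c.frequencyVector a) ha).mdifferentiableAt (by simp)).hasMFDerivAt
  have hl : HasDerivAt (fun t : ℝ => (x + t • c.frequencyVector a, c.action a))
      ((c.frequencyVector a, 0) : (Fin 2 → ℝ) × (Fin 2 → ℝ)) t := by
    refine HasDerivAt.prodMk ?_ (hasDerivAt_const _ _)
    simpa using ((hasDerivAt_id t).smul_const (c.frequencyVector a)).const_add x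
  have h := hκ.comp t hl.hasFDerivAt.hasMFDerivAt
  refine HasMFDerivAt.congr_mfderiv h ?_
  have e := c.mfderiv_κ_frequency hp (x + t • c.frequencyVector a) ha
  have e1 : (1 : ℝ) • ((c.frequencyVector a, 0) : (Fin 2 → ℝ) × (Fin 2 → ℝ)) =
    (c.frequencyVector a, 0) := one_smul _ _
  let D : (Fin 2 → ℝ) × (Fin 2 → ℝ) →L[ℝ] PhaseModel :=
    mfderiv 𝓘(ℝ, (Fin 2 → ℝ) × (Fin 2 → ℝ)) phaseI c.κ (x + t • c.frequencyVector a, c.action a)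
  ext
  exact ((congrArg D e1).trans e).trans (one_smul ℝ _).symm

theorem hamiltonFlow_κ [T2Space M] (hp : ContMDiff phaseI 𝓘(ℝ, ℝ) ω p) (x : Fin 2 → ℝ) {a : ℝ}
    (ha : c.action a ∈ c.B) (t : ℝ) :
    hamiltonFlow p t (c.κ (x, c.action a)) = c.κ (x + t • c.frequencyVector a, c.action a) := by
  have := hamiltonFlow_eq hp (c.isMIntegralCurve_κ hp x ha) t
  simpa using this

theorem flowAverage_κ [T2Space M] (hp : ContMDiff phaseI 𝓘(ℝ, ℝ) ω p) (q : Cotangent M → ℝ)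
    (x : Fin 2 → ℝ) {a : ℝ} (ha : c.action a ∈ c.B) (T : ℝ) :
    flowAverage p q T (c.κ (x, c.action a)) =
      lineAverage (fun x => q (c.κ (x, c.action a))) (c.frequencyVector a) T x := by
  simp only [flowAverage, lineAverage, c.hamiltonFlow_κ hp x ha, smul_eq_mul]

end ActionAngleChart

/-! ### Averages along lines -/

section LineAverage

variable {V E : Type*} [NormedAddCommGroup V] [NormedSpace ℝ V] [NormedAddCommGroup E]
  [NormedSpace ℝ E]

theorem intervalIntegrable_line {V E : Type*} [NormedAddCommGroup V] [NormedSpace ℝ V]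
    [NormedAddCommGroup E] {Q : V → E} (hQ : Continuous Q) (w x : V) (a b : ℝ) :
    IntervalIntegrable (fun t : ℝ => Q (x + t • w)) volume a b :=
  (hQ.comp (by fun_prop)).intervalIntegrable a b

theorem lineAverage_sub {Q P : V → E} (hQ : Continuous Q) (hP : Continuous P) (w : V) (T : ℝ)
    (x : V) : lineAverage (fun x => Q x - P x) w T x = lineAverage Q w T x - lineAverage P w T x := by
  simp only [lineAverage]
  rw [intervalIntegral.integral_sub (intervalIntegrable_line hQ w x _ _)
    (intervalIntegrable_line hP w x _ _), smul_sub]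

theorem lineAverage_add {Q P : V → E} (hQ : Continuous Q) (hP : Continuous P) (w : V) (T : ℝ)
    (x : V) : lineAverage (fun x => Q x + P x) w T x = lineAverage Q w T x + lineAverage P w T x := by
  simp only [lineAverage]
  rw [intervalIntegral.integral_add (intervalIntegrable_line hQ w x _ _)
    (intervalIntegrable_line hP w x _ _), smul_add]

theorem norm_lineAverage_le {Q : V → E} {C : ℝ} (hC : ∀ x, ‖Q x‖ ≤ C) (w : V) {T : ℝ} (hT : 0 < T)
    (x : V) : ‖lineAverage Q w T x‖ ≤ C := by
  rw [lineAverage, norm_smul, norm_inv, Real.norm_of_nonneg hT.le, inv_mul_le_iff₀ hT]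
  have := intervalIntegral.norm_integral_le_of_norm_le_const (a := 0) (b := T) (C := C)
    (f := fun t : ℝ => Q (x + t • w)) (fun t _ => hC _)
  rwa [sub_zero, abs_of_pos hT, mul_comm] at this

theorem continuous_lineAverage [CompleteSpace E] {Q : V → E} (hQ : Continuous Q) (w : V) (T : ℝ) :
    Continuous (lineAverage Q w T) := by
  refine continuous_const.smul ?_
  exact intervalIntegral.continuous_parametric_intervalIntegral_of_continuous'
    (f := fun x t => Q (x + t • w)) (hQ.comp (by fun_prop)) 0 T

theorem norm_lineAverage_sub_le {Q P : V → E} (hQ : Continuous Q) (hP : Continuous P) {C : ℝ}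
    (hC : ∀ x, ‖Q x - P x‖ ≤ C) (w : V) {T : ℝ} (hT : 0 < T) (x : V) :
    ‖lineAverage Q w T x - lineAverage P w T x‖ ≤ C := by
  rw [← lineAverage_sub hQ hP]
  exact norm_lineAverage_le hC w hT x

end LineAverage

/-! ### Ergodic averages on the torus by trigonometric approximation -/

section Trigonometric

/-- The fundamental domain of the torus `ℝ² / 2πℤ²`. -/
def torusBox : Set (Fin 2 → ℝ) := Icc 0 (fun _ => 2 * Real.pi)

theorem isCompact_torusBox : IsCompact torusBox := isCompact_Icc

theorem torusBox_eq_pi : torusBox = univ.pi fun _ => Icc 0 (2 * Real.pi) := by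
  rw [torusBox, ← pi_univ_Icc]; rfl

theorem Continuous.integrableOn_torusBox {E : Type*} [NormedAddCommGroup E] {Q : (Fin 2 → ℝ) → E}
    (hQ : Continuous Q) : IntegrableOn Q torusBox :=
  hQ.continuousOn.integrableOn_compact isCompact_torusBox

theorem volume_torusBox : volume.real torusBox = (2 * Real.pi) ^ 2 := by
  rw [torusBox, Measure.real, Real.volume_Icc_pi_toReal]
  · simp [sq]
  · intro i; simp [Real.pi_pos.le]

/-- The character `exp(i k·x)` of the torus. -/
noncomputable def torusChar (k : Fin 2 → ℤ) (x : Fin 2 → ℝ) : ℂ :=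
  ∏ i, Complex.exp (k i * x i * Complex.I)

/-- The averages of `P` in direction `w` converge uniformly, to a constant if `w` is
nonresonant, and they have the same mean value as `P`. -/
structure AveragesConverge (w : Fin 2 → ℝ) (P : (Fin 2 → ℝ) → ℂ) : Prop where
  continuous : Continuous P
  cauchy : ∀ ε > 0, ∃ T₀ > 0, ∀ T ≥ T₀, ∀ T' ≥ T₀, ∀ x,
    ‖lineAverage P w T x - lineAverage P w T' x‖ ≤ ε
  osc : (∀ k : Fin 2 → ℤ, ∑ i, k i * w i = 0 → k = 0) →
    ∀ ε > 0, ∃ T₀ > 0, ∀ T ≥ T₀, ∀ x y, ‖lineAverage P w T x - lineAverage P w T y‖ ≤ ε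
  mean : ∀ T > 0, ∫ x in torusBox, lineAverage P w T x = ∫ x in torusBox, P x

namespace AveragesConverge

variable {w : Fin 2 → ℝ}

/-- Averaging does not increase the supremum norm, uniformly in `T`, so every property of the
structure survives uniform limits by an `ε/3` argument. -/
theorem of_approx {Q : (Fin 2 → ℝ) → ℂ} (hQ : Continuous Q)
    (h : ∀ ε > 0, ∃ P, AveragesConverge w P ∧ ∀ x, ‖Q x - P x‖ ≤ ε) : AveragesConverge w Q where
  continuous := hQ
  cauchy := by
    intro ε hε
    obtain ⟨P, hP, hPQ⟩ := h (ε / 3) (by positivity)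
    obtain ⟨T₀, hT₀, hT⟩ := hP.cauchy (ε / 3) (by positivity)
    refine ⟨T₀, hT₀, fun T h1 T' h2 x => ?_⟩
    have e1 := norm_lineAverage_sub_le hQ hP.continuous hPQ w (hT₀.trans_le h1) x
    have e2 := norm_lineAverage_sub_le hQ hP.continuous hPQ w (hT₀.trans_le h2) x
    have e3 := hT T h1 T' h2 x
    rw [← dist_eq_norm] at *
    have := dist_triangle4 (lineAverage Q w T x) (lineAverage P w T x) (lineAverage P w T' x)
      (lineAverage Q w T' x)
    rw [dist_comm (lineAverage P w T' x)] at this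
    linarith
  osc := by
    intro hw ε hε
    obtain ⟨P, hP, hPQ⟩ := h (ε / 3) (by positivity)
    obtain ⟨T₀, hT₀, hT⟩ := hP.osc hw (ε / 3) (by positivity)
    refine ⟨T₀, hT₀, fun T h1 x y => ?_⟩
    have e1 := norm_lineAverage_sub_le hQ hP.continuous hPQ w (hT₀.trans_le h1) x
    have e2 := norm_lineAverage_sub_le hQ hP.continuous hPQ w (hT₀.trans_le h1) y
    have e3 := hT T h1 x y
    rw [← dist_eq_norm] at *
    have := dist_triangle4 (lineAverage Q w T x) (lineAverage P w T x) (lineAverage P w T y)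
      (lineAverage Q w T y)
    rw [dist_comm (lineAverage P w T y)] at this
    linarith
  mean := by
    intro T hT
    have key : ∀ ε > 0, ‖(∫ x in torusBox, lineAverage Q w T x) - ∫ x in torusBox, Q x‖ ≤
        2 * (2 * Real.pi) ^ 2 * ε := by
      intro ε hε
      obtain ⟨P, hP, hPQ⟩ := h ε hε
      have bound : ∀ F G : (Fin 2 → ℝ) → ℂ, Continuous F → Continuous G →
          (∀ x, ‖F x - G x‖ ≤ ε) →
          dist (∫ x in torusBox, F x) (∫ x in torusBox, G x) ≤ ε * (2 * Real.pi) ^ 2 := by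
        intro F G hF hG hFG
        rw [dist_eq_norm, ← integral_sub hF.integrableOn_torusBox hG.integrableOn_torusBox,
          ← volume_torusBox]
        exact norm_setIntegral_le_of_norm_le_const isCompact_torusBox.measure_lt_top
          (fun x _ => hFG x)
      have e1 := bound _ _ (continuous_lineAverage hQ w T) (continuous_lineAverage hP.continuous w T)
        (norm_lineAverage_sub_le hQ hP.continuous hPQ w hT)
      have e2 := bound _ _ hQ hP.continuous hPQ
      rw [hP.mean T hT] at e1
      rw [← dist_eq_norm]
      have := dist_triangle_right (∫ x in torusBox, lineAverage Q w T x) (∫ x in torusBox, Q x)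
        (∫ x in torusBox, P x)
      linarith
    rw [← sub_eq_zero, ← norm_le_zero_iff]
    refine le_of_forall_pos_le_add fun ε hε => ?_
    have := key (ε / (2 * (2 * Real.pi) ^ 2)) (by positivity)
    rwa [mul_div_cancel₀ _ (by positivity), ← zero_add ε] at this

theorem add {P Q : (Fin 2 → ℝ) → ℂ} (hP : AveragesConverge w P) (hQ : AveragesConverge w Q) :
    AveragesConverge w (fun x => P x + Q x) where
  continuous := hP.continuous.add hQ.continuous
  cauchy := by
    intro ε hε
    obtain ⟨T₀, hT₀, hT⟩ := hP.cauchy (ε / 2) (by positivity)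
    obtain ⟨T₁, hT₁, hT'⟩ := hQ.cauchy (ε / 2) (by positivity)
    refine ⟨max T₀ T₁, lt_max_of_lt_left hT₀, fun T h1 T' h2 x => ?_⟩
    rw [lineAverage_add hP.continuous hQ.continuous, lineAverage_add hP.continuous hQ.continuous,
      add_sub_add_comm]
    have e1 := hT T (le_of_max_le_left h1) T' (le_of_max_le_left h2) x
    have e2 := hT' T (le_of_max_le_right h1) T' (le_of_max_le_right h2) x
    exact (norm_add_le _ _).trans (by linarith)
  osc := by
    intro hw ε hε
    obtain ⟨T₀, hT₀, hT⟩ := hP.osc hw (ε / 2) (by positivity)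
    obtain ⟨T₁, hT₁, hT'⟩ := hQ.osc hw (ε / 2) (by positivity)
    refine ⟨max T₀ T₁, lt_max_of_lt_left hT₀, fun T h1 x y => ?_⟩
    rw [lineAverage_add hP.continuous hQ.continuous, lineAverage_add hP.continuous hQ.continuous,
      add_sub_add_comm]
    have e1 := hT T (le_of_max_le_left h1) x y
    have e2 := hT' T (le_of_max_le_right h1) x y
    exact (norm_add_le _ _).trans (by linarith)
  mean := by
    intro T hT
    simp only [lineAverage_add hP.continuous hQ.continuous]
    rw [integral_add (continuous_lineAverage hP.continuous w T).integrableOn_torusBox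
      (continuous_lineAverage hQ.continuous w T).integrableOn_torusBox,
      integral_add hP.continuous.integrableOn_torusBox hQ.continuous.integrableOn_torusBox,
      hP.mean T hT, hQ.mean T hT]

theorem const_mul {P : (Fin 2 → ℝ) → ℂ} (c : ℂ) (hP : AveragesConverge w P) :
    AveragesConverge w (fun x => c * P x) := by
  have e : ∀ T x, lineAverage (fun x => c * P x) w T x = c * lineAverage P w T x := by
    intro T x
    simp only [lineAverage]
    rw [intervalIntegral.integral_const_mul, mul_smul_comm]
  have hδ : ∀ ε > (0 : ℝ), 0 < ε / (‖c‖ + 1) ∧ ∀ z : ℂ, ‖z‖ ≤ ε / (‖c‖ + 1) → ‖c * z‖ ≤ ε := by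
    intro ε hε
    refine ⟨by positivity, fun z hz => ?_⟩
    rw [norm_mul]
    rw [le_div_iff₀ (by positivity)] at hz
    nlinarith [norm_nonneg z, norm_nonneg c]
  refine ⟨continuous_const.mul hP.continuous, ?_, ?_, ?_⟩
  · intro ε hε
    obtain ⟨T₀, hT₀, hT⟩ := hP.cauchy _ (hδ ε hε).1
    refine ⟨T₀, hT₀, fun T h1 T' h2 x => ?_⟩
    rw [e, e, ← mul_sub]
    exact (hδ ε hε).2 _ (hT T h1 T' h2 x)
  · intro hw ε hε
    obtain ⟨T₀, hT₀, hT⟩ := hP.osc hw _ (hδ ε hε).1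
    refine ⟨T₀, hT₀, fun T h1 x y => ?_⟩
    rw [e, e, ← mul_sub]
    exact (hδ ε hε).2 _ (hT T h1 x y)
  · intro T hT
    simp only [e]
    rw [integral_const_mul, integral_const_mul, hP.mean T hT]

theorem integral_torusChar {k : Fin 2 → ℤ} (hk : k ≠ 0) : ∫ x in torusBox, torusChar k x = 0 := by
  obtain ⟨i, hi⟩ := Function.ne_iff.1 hk
  have h1 : ∫ x in torusBox, torusChar k x =
      ∏ i, ∫ t in Icc 0 (2 * Real.pi), Complex.exp (k i * (t : ℝ) * Complex.I) := by
    rw [torusBox_eq_pi, volume_pi, Measure.restrict_pi_pi]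
    exact integral_fintype_prod_eq_prod (fun i (t : ℝ) => Complex.exp (k i * t * Complex.I))
  rw [h1]
  refine Finset.prod_eq_zero (Finset.mem_univ i) ?_
  rw [integral_Icc_eq_integral_Ioc, ← intervalIntegral.integral_of_le (by positivity)]
  have hc : (k i * Complex.I : ℂ) ≠ 0 := by simpa using hi
  have h2 : ∀ t : ℝ, Complex.exp (k i * t * Complex.I) = Complex.exp (k i * Complex.I * t) := by
    intro t; congr 1; ring
  simp only [h2]
  rw [integral_exp_mul_complex hc]
  have h3 : Complex.exp (k i * Complex.I * ((2 * Real.pi : ℝ) : ℂ)) = 1 := by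
    rw [Complex.exp_eq_one_iff]
    exact ⟨k i, by push_cast; ring⟩
  rw [h3]
  simp

theorem torusChar_norm (k : Fin 2 → ℤ) (x : Fin 2 → ℝ) : ‖torusChar k x‖ = 1 := by
  rw [torusChar, norm_prod]
  refine Finset.prod_eq_one fun i _ => ?_
  have := Complex.norm_exp_ofReal_mul_I (k i * x i)
  push_cast at this
  exact this

theorem torusChar_line (k : Fin 2 → ℤ) (x : Fin 2 → ℝ) (t : ℝ) :
    torusChar k (x + t • w) =
      torusChar k x * Complex.exp (((∑ i, k i * w i : ℝ) : ℂ) * Complex.I * t) := by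
  simp only [torusChar, Fin.prod_univ_two, Fin.sum_univ_two, ← Complex.exp_add]
  congr 1
  simp
  ring

/-- Along the line a character is multiplied by `exp(i t k·w)`. If `k·w = 0` the average is the
character itself, and nonresonance then forces `k = 0`. Otherwise the average is `O(1/T)` and `k ≠
0`, so both means vanish. -/
theorem torusChar_averages (k : Fin 2 → ℤ) : AveragesConverge w (torusChar k) := by
  have hcont : Continuous (torusChar k) := by
    unfold torusChar; fun_prop
  set c : ℝ := ∑ i, k i * w i with hc
  have hline : ∀ T x, lineAverage (torusChar k) w T x =
      torusChar k x * (T⁻¹ * ∫ t in (0 : ℝ)..T, Complex.exp ((c : ℂ) * Complex.I * t)) := by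
    intro T x
    simp only [lineAverage, torusChar_line, ← hc]
    rw [intervalIntegral.integral_const_mul, Complex.real_smul]
    push_cast
    ring
  by_cases h0 : c = 0
  · have hline' : ∀ T > 0, ∀ x, lineAverage (torusChar k) w T x = torusChar k x := by
      intro T hT x
      have hT' : (T : ℂ) ≠ 0 := by exact_mod_cast hT.ne'
      rw [hline, h0]
      simp [hT']
    refine ⟨hcont, ?_, ?_, ?_⟩
    · intro ε hε
      refine ⟨1, one_pos, fun T h1 T' h2 x => ?_⟩
      rw [hline' T (by linarith), hline' T' (by linarith), sub_self, norm_zero]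
      exact hε.le
    · intro hw ε hε
      have hk : k = 0 := hw k (by rw [← hc]; exact h0)
      refine ⟨1, one_pos, fun T h1 x y => ?_⟩
      rw [hline' T (by linarith), hline' T (by linarith), hk]
      simpa [torusChar] using hε.le
    · intro T hT
      simp only [hline' T hT]
  · have hsmall : ∀ T > 0, ∀ x, ‖lineAverage (torusChar k) w T x‖ ≤ T⁻¹ * (2 / |c|) := by
      intro T hT x
      have hcI : (c * Complex.I : ℂ) ≠ 0 := by simpa using h0
      rw [hline, norm_mul, torusChar_norm, one_mul, integral_exp_mul_complex hcI, norm_mul,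
        Complex.norm_real, Real.norm_of_nonneg (inv_nonneg.2 hT.le), norm_div, norm_mul,
        Complex.norm_real, Complex.norm_I, mul_one, Real.norm_eq_abs]
      gcongr
      refine (norm_sub_le _ _).trans ?_
      have e1 : ∀ t : ℝ, ‖Complex.exp (c * Complex.I * t)‖ = 1 := by
        intro t
        have := Complex.norm_exp_ofReal_mul_I (c * t)
        rw [← this]
        congr 2
        push_cast
        ring
      rw [e1, e1]
      norm_num
    have hev : ∀ ε > 0, ∃ T₀ > 0, ∀ T ≥ T₀, ∀ x, ‖lineAverage (torusChar k) w T x‖ ≤ ε / 2 := by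
      intro ε hε
      refine ⟨(2 / |c|) / (ε / 2), by positivity, fun T hT x => ?_⟩
      have hT0 : 0 < T := lt_of_lt_of_le (by positivity) hT
      refine (hsmall T hT0 x).trans ?_
      rw [inv_mul_le_iff₀ hT0]
      rwa [ge_iff_le, div_le_iff₀ (by positivity)] at hT
    refine ⟨hcont, ?_, ?_, ?_⟩
    · intro ε hε
      obtain ⟨T₀, hT₀, hT⟩ := hev ε hε
      refine ⟨T₀, hT₀, fun T h1 T' h2 x => (norm_sub_le _ _).trans ?_⟩
      linarith [hT T h1 x, hT T' h2 x]
    · intro _ ε hε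
      obtain ⟨T₀, hT₀, hT⟩ := hev ε hε
      refine ⟨T₀, hT₀, fun T h1 x y => (norm_sub_le _ _).trans ?_⟩
      linarith [hT T h1 x, hT T h1 y]
    · intro T hT
      have hk : k ≠ 0 := by
        rintro rfl
        exact h0 (by simp [hc])
      simp only [hline]
      rw [integral_mul_const, integral_torusChar hk, zero_mul]

end AveragesConverge

/-- A continuous function that is `2π`-periodic in both variables is a uniform limit of
trigonometric polynomials. -/
theorem exists_trigonometric_approx {Q : (Fin 2 → ℝ) → ℂ} (hQ : Continuous Q)
    (hper : ∀ (x : Fin 2 → ℝ) (k : Fin 2 → ℤ), Q (fun i => x i + 2 * Real.pi * k i) = Q x)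
    {ε : ℝ} (hε : 0 < ε) :
    ∃ P ∈ Submodule.span ℂ (range torusChar), ∀ x, ‖Q x - P x‖ ≤ ε := by
  -- After the scaling by `2π` the function descends to the torus of period one, where the span of
  -- the characters is dense in the continuous functions.
  let π' : (Fin 2 → ℝ) → UnitAddTorus (Fin 2) := Pi.map fun _ t => ((t : ℝ) : UnitAddCircle)
  have hπ : IsOpenQuotientMap π' :=
    IsOpenQuotientMap.piMap fun _ => QuotientAddGroup.isOpenQuotientMap_mk
  let πc : C(Fin 2 → ℝ, UnitAddTorus (Fin 2)) := ⟨π', hπ.continuous⟩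
  have hπc : IsQuotientMap πc := hπ.isQuotientMap
  let Q' : C(Fin 2 → ℝ, ℂ) := ⟨fun x => Q ((2 * Real.pi) • x), hQ.comp (by fun_prop)⟩
  have hlift : ∀ x y, π' x = π' y → Q' x = Q' y := by
    intro x y hxy
    have h1 : ∀ i, ∃ n : ℤ, y i = x i + n := by
      intro i
      obtain ⟨n, hn⟩ := AddSubgroup.mem_zmultiples_iff.1 (QuotientAddGroup.eq.1 (congrFun hxy i))
      refine ⟨n, ?_⟩
      simp at hn
      linarith
    choose k hk using h1
    change Q _ = Q _
    rw [← hper ((2 * Real.pi) • x) k]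
    congr 1
    ext i
    simp [hk i]
    ring
  let G : C(UnitAddTorus (Fin 2), ℂ) := IsQuotientMap.lift hπc Q' hlift
  have hG : ∀ x, G (π' x) = Q ((2 * Real.pi) • x) := fun x =>
    ContinuousMap.congr_fun (IsQuotientMap.lift_comp hπc Q' hlift) x
  have hmem : G ∈ closure ((Submodule.span ℂ (range <| UnitAddTorus.mFourier (d := Fin 2)) :
      Submodule ℂ C(UnitAddTorus (Fin 2), ℂ)) : Set C(UnitAddTorus (Fin 2), ℂ)) := by
    rw [← Submodule.topologicalClosure_coe, UnitAddTorus.span_mFourier_closure_eq_top]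
    trivial
  obtain ⟨P', hP', hd⟩ := Metric.mem_closure_iff.1 hmem ε hε
  let L : C(UnitAddTorus (Fin 2), ℂ) →ₗ[ℂ] ((Fin 2 → ℝ) → ℂ) :=
    { toFun := fun g x => g (π' ((2 * Real.pi)⁻¹ • x))
      map_add' := fun _ _ => rfl
      map_smul' := fun _ _ => rfl }
  refine ⟨L P', ?_, fun x => ?_⟩
  · have h2 : L P' ∈ (Submodule.span ℂ (range <| UnitAddTorus.mFourier (d := Fin 2))).map L :=
      Submodule.mem_map_of_mem hP'
    rw [Submodule.map_span, ← range_comp] at h2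
    convert h2 using 3
    ext k x
    simp only [torusChar, Function.comp, L, LinearMap.coe_mk, AddHom.coe_mk, UnitAddTorus.mFourier,
      ContinuousMap.coe_mk, π', Pi.map_apply]
    refine Finset.prod_congr rfl fun i _ => ?_
    rw [fourier_coe_apply]
    congr 1
    have : (Real.pi : ℂ) ≠ 0 := by exact_mod_cast Real.pi_ne_zero
    simp
    field_simp
  · have h3 : Q x = G (π' ((2 * Real.pi)⁻¹ • x)) := by
      rw [hG, smul_inv_smul₀ (by positivity)]
    rw [h3]
    change ‖G _ - P' _‖ ≤ ε
    rw [← dist_eq_norm]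
    exact (ContinuousMap.dist_apply_le_dist _).trans hd.le

/-- This is Weyl's argument: the properties hold for characters and pass to linear combinations and
uniform limits. -/
theorem averagesConverge_of_periodic {Q : (Fin 2 → ℝ) → ℂ} (hQ : Continuous Q)
    (hper : ∀ (x : Fin 2 → ℝ) (k : Fin 2 → ℤ), Q (fun i => x i + 2 * Real.pi * k i) = Q x)
    (w : Fin 2 → ℝ) : AveragesConverge w Q := by
  refine AveragesConverge.of_approx hQ fun ε hε => ?_
  obtain ⟨P, hP, h⟩ := exists_trigonometric_approx hQ hper hε
  refine ⟨P, ?_, h⟩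
  clear h
  induction hP using Submodule.span_induction with
  | mem x hx =>
    obtain ⟨k, rfl⟩ := hx
    exact AveragesConverge.torusChar_averages k
  | zero =>
    simpa using! (AveragesConverge.torusChar_averages (w := w) 0).const_mul 0
  | add x y _ _ hx hy => exact hx.add hy
  | smul c x _ hx => exact hx.const_mul c

end Trigonometric

/-! ### Oscillation of periodic functions with short period -/

section PeriodicOscillation

theorem Function.Periodic.abs_sub_le_of_abs_deriv_le {h : ℝ → ℝ} {P C : ℝ} (hP : 0 < P)
    (hper : Function.Periodic h P) (hd : Differentiable ℝ h) (hC : ∀ t, |deriv h t| ≤ C) (x y : ℝ) :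
    |h x - h y| ≤ P * C := by
  obtain ⟨z, hz, hzy⟩ := hper.exists_mem_Ico hP y x
  have h1 := Convex.norm_image_sub_le_of_norm_deriv_le (s := univ) (f := h) (C := C) (x := z) (y := x)
    (fun t _ => hd t) (fun t _ => hC t) convex_univ trivial trivial
  rw [hzy]
  have h2 : |x - z| ≤ P := by
    rw [abs_sub_comm, abs_of_nonneg (by linarith [hz.1])]
    linarith [hz.2]
  have hC0 : 0 ≤ C := (abs_nonneg _).trans (hC 0)
  rw [Real.norm_eq_abs, Real.norm_eq_abs] at h1
  nlinarith

/-- The oscillation of a function of period `P` is bounded by `P ^ N` times a bound for its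
derivative of order `N ≥ 1`. -/
theorem Function.Periodic.abs_sub_le_of_abs_iteratedDeriv_le {P C : ℝ} (hP : 0 < P) (N : ℕ) :
    ∀ {h : ℝ → ℝ}, Function.Periodic h P → ContDiff ℝ (N + 1 : ℕ) h →
      (∀ t, |iteratedDeriv (N + 1) h t| ≤ C) → ∀ x y, |h x - h y| ≤ P ^ (N + 1) * C := by
  induction N with
  | zero =>
    intro h hper hd hC x y
    rw [zero_add, pow_one]
    refine hper.abs_sub_le_of_abs_deriv_le hP (hd.differentiable (by simp)) ?_ x y
    simpa [iteratedDeriv_one] using hC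
  | succ N ih =>
    intro h hper hd hC x y
    have hd' : ContDiff ℝ (N + 1 : ℕ) (deriv h) := by
      have : ContDiff ℝ ((N + 1 : ℕ) + 1) h := by exact_mod_cast hd
      exact (contDiff_succ_iff_deriv.1 this).2.2
    have hper' : Function.Periodic (deriv h) P := by
      intro t
      have : (fun s => h (s + P)) = h := funext hper
      rw [← deriv_comp_add_const, this]
    have hih := ih hper' hd' (fun t => by rw [← iteratedDeriv_succ']; exact hC t)
    have hdiff : Differentiable ℝ h := hd.differentiable (by simp)
    -- By Rolle the derivative of a periodic function has a zero, so its size is bounded by its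
    -- oscillation. Each further derivative thus gains one factor `P`.
    obtain ⟨ξ, -, hξ⟩ := exists_deriv_eq_zero (f := h) hP hdiff.continuous.continuousOn
      (by simpa using (hper 0).symm)
    have := hper.abs_sub_le_of_abs_deriv_le hP hdiff (C := P ^ (N + 1) * C)
      (fun t => by simpa [hξ] using hih t ξ) x y
    calc _ ≤ _ := this
      _ = _ := by ring

end PeriodicOscillation

/-! ### Line averages in nonresonant and in rational directions -/

section TorusAverage

variable {Q : (Fin 2 → ℝ) → ℝ} (hQ : Continuous Q)
  (hper : ∀ (x : Fin 2 → ℝ) (k : Fin 2 → ℤ), Q (fun i => x i + 2 * Real.pi * k i) = Q x)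
include hQ hper

theorem averagesConverge_ofReal (w : Fin 2 → ℝ) : AveragesConverge w fun x => (Q x : ℂ) :=
  averagesConverge_of_periodic (by fun_prop) (fun x k => by rw [hper]) w

omit hQ hper in
theorem lineAverage_ofReal {V : Type*} [AddCommGroup V] [Module ℝ V] (Q : V → ℝ) (w : V) (T : ℝ)
    (x : V) : lineAverage (fun x => (Q x : ℂ)) w T x = (lineAverage Q w T x : ℝ) := by
  simp only [lineAverage]
  rw [intervalIntegral.integral_ofReal]
  simp

/-- The line averages of a continuous function on the torus converge uniformly. -/
theorem lineAverage_cauchy (w : Fin 2 → ℝ) {ε : ℝ} (hε : 0 < ε) :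
    ∃ T₀ > 0, ∀ T ≥ T₀, ∀ T' ≥ T₀, ∀ x, |lineAverage Q w T x - lineAverage Q w T' x| ≤ ε := by
  obtain ⟨T₀, hT₀, h⟩ := (averagesConverge_ofReal hQ hper w).cauchy ε hε
  refine ⟨T₀, hT₀, fun T h1 T' h2 x => ?_⟩
  have := h T h1 T' h2 x
  rwa [lineAverage_ofReal, lineAverage_ofReal, ← Complex.ofReal_sub, Complex.norm_real] at this

/-- In nonresonant directions the line averages become constant. -/
theorem lineAverage_osc {w : Fin 2 → ℝ} (hw : ∀ k : Fin 2 → ℤ, ∑ i, k i * w i = 0 → k = 0)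
    {ε : ℝ} (hε : 0 < ε) :
    ∃ T₀ > 0, ∀ T ≥ T₀, ∀ x y, |lineAverage Q w T x - lineAverage Q w T y| ≤ ε := by
  obtain ⟨T₀, hT₀, h⟩ := (averagesConverge_ofReal hQ hper w).osc hw ε hε
  refine ⟨T₀, hT₀, fun T h1 x y => ?_⟩
  have := h T h1 x y
  rwa [lineAverage_ofReal, lineAverage_ofReal, ← Complex.ofReal_sub, Complex.norm_real] at this

/-- The line averages take the mean value. -/
theorem exists_lineAverage_eq_mean (w : Fin 2 → ℝ) {T : ℝ} (hT : 0 < T) :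
    ∃ x, lineAverage Q w T x = ((2 * Real.pi) ^ 2)⁻¹ * ∫ x in torusBox, Q x := by
  have hmean : ∫ x in torusBox, lineAverage Q w T x = ∫ x in torusBox, Q x := by
    have := (averagesConverge_ofReal hQ hper w).mean T hT
    simp only [lineAverage_ofReal] at this
    rw [integral_complex_ofReal, integral_complex_ofReal] at this
    exact_mod_cast this
  have hc : Continuous (lineAverage Q w T) := continuous_lineAverage hQ w T
  set m := ((2 * Real.pi) ^ 2)⁻¹ * ∫ x in torusBox, Q x with hm
  have hpos : (0 : ℝ) < (2 * Real.pi) ^ 2 := by positivity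
  have hne : volume torusBox ≠ 0 := by
    intro h0
    have := volume_torusBox
    rw [Measure.real, h0, ENNReal.toReal_zero] at this
    exact hpos.ne this
  have hint : ∫ x in torusBox, (lineAverage Q w T x - m) = 0 := by
    rw [integral_sub hc.integrableOn_torusBox (continuous_const.integrableOn_torusBox), hmean,
      setIntegral_const, volume_torusBox, smul_eq_mul, hm, mul_inv_cancel_left₀ hpos.ne', sub_self]
  have hex := isPreconnected_univ (α := Fin 2 → ℝ)
  by_contra hcon
  push Not at hcon
  -- If the mean were not taken, connectedness would give the difference a constant sign, against
  -- the vanishing of its integral.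
  have hsign : (∀ x, 0 < lineAverage Q w T x - m) ∨ (∀ x, 0 < -(lineAverage Q w T x - m)) := by
    by_contra h
    push Not at h
    obtain ⟨⟨x, hx⟩, ⟨y, hy⟩⟩ := h
    obtain ⟨z, -, hz⟩ := hex.intermediate_value₂ (f := lineAverage Q w T) (g := fun _ => m)
      (mem_univ x) (mem_univ y) hc.continuousOn continuousOn_const (by linarith) (by linarith)
    exact hcon z hz
  have hpositive : ∀ g : (Fin 2 → ℝ) → ℝ, Continuous g → (∀ x, 0 < g x) →
      ∫ x in torusBox, g x ≠ 0 := by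
    intro g hg hgp h0
    rw [setIntegral_eq_zero_iff_of_nonneg_ae (Eventually.of_forall fun x => (hgp x).le)
      hg.integrableOn_torusBox] at h0
    have h1 : ∀ᵐ x ∂(volume.restrict torusBox), False := by
      filter_upwards [h0] with x hx
      exact (hgp x).ne' hx
    rw [ae_iff] at h1
    simp at h1
    exact hne h1
  rcases hsign with h | h
  · exact hpositive _ (hc.sub continuous_const) h hint
  · refine hpositive (fun x => -(lineAverage Q w T x - m)) (hc.sub continuous_const).neg h ?_
    rw [integral_neg, hint, neg_zero]

omit hQ hper in
theorem sum_range_add_eq_of_periodic {H : ℕ → ℝ} {N : ℕ} (hH : ∀ l, H (l + N) = H l) (r : ℕ) :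
    ∑ l ∈ Finset.range N, H (l + r) = ∑ l ∈ Finset.range N, H l := by
  induction r with
  | zero => simp
  | succ r ih =>
    have h1 := Finset.sum_range_succ (fun l => H (l + r)) N
    have h2 := Finset.sum_range_succ' (fun l => H (l + r)) N
    have h3 : H (N + r) = H (0 + r) := by rw [zero_add, add_comm, hH]
    have h4 : ∀ l, H (l + 1 + r) = H (l + (r + 1)) := fun l => by congr 1; ring
    simp only [h4] at h2
    rw [← ih]
    linarith

/-- If the slope of the direction `w` is the rational number `r`, the oscillation of the
average of `Q` over suitable times is bounded by a power of the denominator of `r`. -/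
theorem exists_lineAverage_osc_le_of_rational {w : Fin 2 → ℝ} (hw : w 0 ≠ 0) {r : ℚ}
    (hr : w 1 = r * w 0) {N : ℕ} {C : ℝ}
    (hsmooth : ∀ x, ContDiff ℝ (N + 1 : ℕ) fun s : ℝ => Q (x + s • Pi.single 1 1))
    (hC : ∀ x s, |iteratedDeriv (N + 1) (fun s : ℝ => Q (x + s • Pi.single 1 1)) s| ≤ C) :
    ∃ T ≥ 1, ∀ x y, |lineAverage Q w T x - lineAverage Q w T y| ≤
      2 * ((2 * Real.pi / r.den) ^ (N + 1) * C) := by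
  set e : Fin 2 → ℝ := Pi.single 1 1 with he
  have hn : (0 : ℝ) < r.den := by exact_mod_cast r.pos
  -- `τ` is the time of one turn of the first angle and `σ` its sense. Meanwhile the second angle
  -- advances by `2π m / r.den` with `m` prime to `r.den`.
  set τ : ℝ := 2 * Real.pi / |w 0| with hτ
  have hτ0 : 0 < τ := by positivity
  obtain ⟨σ, hσ, hσ1⟩ : ∃ σ : ℤ, τ * w 0 = 2 * Real.pi * σ ∧ IsUnit σ := by
    rcases lt_or_gt_of_ne hw with h | h
    · refine ⟨-1, ?_, by simp⟩
      rw [hτ, abs_of_neg h]; field_simp; simp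
    · refine ⟨1, ?_, by simp⟩
      rw [hτ, abs_of_pos h]; field_simp; simp
  have hτw1 : τ * w 1 = 2 * Real.pi / r.den * (σ * r.num : ℤ) := by
    have : (r : ℝ) = r.num / r.den := by exact_mod_cast (Rat.num_div_den r).symm
    rw [hr, mul_left_comm, hσ, this]
    push_cast
    ring
  set m : ℤ := σ * r.num with hm
  have hcop : IsCoprime m (r.den : ℤ) := by
    rw [hm, isCoprime_mul_unit_left_left hσ1]
    exact Rat.isCoprime_num_den r
  -- The orbit closes after `r.den` turns. The averaging time is `k` closed orbits, with `k` so
  -- large that it is at least one, as the definition of `Q_∞` requires.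
  obtain ⟨k, hk⟩ := exists_nat_gt (1 / (r.den * τ))
  have hk0 : (0 : ℝ) < k := lt_of_le_of_lt (by positivity) hk
  set L : ℕ := r.den * k with hL
  have hLr : (L : ℝ) = r.den * k := by push_cast [hL]; ring
  have hL0 : (0 : ℝ) < L := by rw [hLr]; positivity
  have hT1 : 1 ≤ L * τ := by
    rw [div_lt_iff₀ (by positivity)] at hk
    rw [hLr]; nlinarith
  -- translation by integer multiples of the closed orbit steps
  have hper1 : ∀ x (j : ℤ), Q (x + (2 * Real.pi * j) • e) = Q x := by
    intro x j
    rw [← hper x (Pi.single 1 j)]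
    congr 1
    ext i
    fin_cases i <;> simp [he]
  have hper0 : ∀ x (j : ℤ), Q (x + (2 * Real.pi * j) • Pi.single 0 1) = Q x := by
    intro x j
    rw [← hper x (Pi.single 0 j)]
    congr 1
    ext i
    fin_cases i <;> simp
  have hstep : ∀ x (l : ℕ), Q (x + (l * τ) • w) = Q (x + (2 * Real.pi / r.den * (l * m)) • e) := by
    intro x l
    rw [← hper0 (x + (2 * Real.pi / r.den * (l * m)) • e) (l * σ)]
    congr 1
    ext i
    fin_cases i
    · simp [he, mul_assoc, hσ]; ring
    · simp [he, mul_assoc, hτw1]; ring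
  -- The translates by `2π l m / r.den`, `l < L = r.den * k`, meet each residue class modulo `r.den`
  -- exactly `k` times. Hence `G` is `2π / r.den`-periodic in the second angle, while its
  -- derivatives obey the same bounds as those of `Q`.
  let G : (Fin 2 → ℝ) → ℝ := fun x =>
    (L : ℝ)⁻¹ * ∑ l ∈ Finset.range L, Q (x + (2 * Real.pi / r.den * (l * m)) • e)
  have hGc : Continuous G := by
    refine continuous_const.mul (continuous_finsetSum _ fun (l : ℕ) _ => ?_)
    exact hQ.comp (by fun_prop)
  have hGe : ∀ x, G (x + (2 * Real.pi / r.den) • e) = G x := by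
    intro x
    -- `u'` is a natural number inverse to `m` modulo `r.den`. Shifting the summation index by `u'`
    -- translates the second angle by `2π / r.den` up to full turns.
    obtain ⟨u, v, huv⟩ := hcop
    obtain ⟨u', hu'⟩ : ∃ u' : ℕ, ∃ v' : ℤ, (u' : ℤ) * m = 1 + v' * r.den := by
      refine ⟨(u % r.den).toNat, -v - (u / r.den) * m, ?_⟩
      have hden : (r.den : ℤ) ≠ 0 := by exact_mod_cast r.den_ne_zero
      rw [Int.toNat_of_nonneg (Int.emod_nonneg _ hden), Int.emod_def]
      linear_combination huv
    obtain ⟨v', hv'⟩ := hu'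
    simp only [G]
    congr 1
    rw [← sum_range_add_eq_of_periodic (N := L) (r := u')
      (H := fun l => Q (x + (2 * Real.pi / r.den * (l * m)) • e)) ?_]
    · refine Finset.sum_congr rfl fun l _ => ?_
      have hv'' : (u' : ℝ) * m = 1 + v' * r.den := by exact_mod_cast hv'
      rw [← hper1 _ v']
      congr 1
      rw [add_assoc, add_assoc, ← add_smul, ← add_smul]
      congr 2
      field_simp
      push_cast
      linear_combination (-1 : ℝ) * hv''
    · intro l
      rw [← hper1 (x + (2 * Real.pi / r.den * (l * m)) • e) (k * m)]
      congr 1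
      rw [add_assoc, ← add_smul]
      congr 2
      push_cast
      rw [hLr]
      field_simp
  have hosc : ∀ (x : Fin 2 → ℝ) (s : ℝ), |G (x + s • e) - G x| ≤ (2 * Real.pi / r.den) ^ (N + 1) * C := by
    intro x s
    have hGs : (fun s : ℝ => G (x + s • e)) = fun s => (L : ℝ)⁻¹ * ∑ l ∈ Finset.range L,
        Q (x + (2 * Real.pi / r.den * (l * m)) • e + s • e) := by
      ext s
      simp only [G]
      congr 1
      refine Finset.sum_congr rfl fun l _ => ?_
      congr 1
      abel
    have hcd : ∀ l ∈ Finset.range L, ContDiff ℝ (N + 1 : ℕ)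
        fun s : ℝ => Q (x + (2 * Real.pi / r.den * (l * m)) • e + s • e) := fun l _ => hsmooth _
    have h1 : ContDiff ℝ (N + 1 : ℕ) fun s : ℝ => G (x + s • e) := by
      rw [hGs]
      exact contDiff_const.mul (ContDiff.sum hcd)
    have h2 : Function.Periodic (fun s : ℝ => G (x + s • e)) (2 * Real.pi / r.den) := by
      intro s
      change G (x + (s + 2 * Real.pi / r.den) • e) = G (x + s • e)
      rw [add_smul, ← add_assoc, hGe]
    have h3 : ∀ t, |iteratedDeriv (N + 1) (fun s : ℝ => G (x + s • e)) t| ≤ C := by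
      intro t
      rw [hGs, iteratedDeriv_const_mul_field, iteratedDeriv_fun_sum
        (fun l hl => (hcd l hl).contDiffAt), abs_mul, abs_of_pos (inv_pos.2 hL0),
        inv_mul_le_iff₀ hL0]
      refine (Finset.abs_sum_le_sum_abs _ _).trans ?_
      refine (Finset.sum_le_card_nsmul _ _ C fun l _ => hC _ t).trans ?_
      simp
    have := Function.Periodic.abs_sub_le_of_abs_iteratedDeriv_le (by positivity) N h2 h1 h3 s 0
    simpa using this
  have havg : ∀ x, lineAverage Q w (L * τ) x = τ⁻¹ * ∫ t in (0 : ℝ)..τ, G (x + t • w) := by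
    intro x
    have hint : ∀ a b : ℝ, IntervalIntegrable (fun t : ℝ => Q (x + t • w)) volume a b :=
      fun a b => intervalIntegrable_line hQ w x a b
    have h1 : ∫ t in (0 : ℝ)..(L * τ), Q (x + t • w) =
        ∑ l ∈ Finset.range L, ∫ t in (l * τ : ℝ)..((l + 1 : ℕ) * τ), Q (x + t • w) := by
      have := intervalIntegral.sum_integral_adjacent_intervals (μ := volume)
        (f := fun t : ℝ => Q (x + t • w)) (a := fun l : ℕ => (l * τ : ℝ)) (n := L)
        (fun l _ => hint _ _)
      rw [this]; simp
    have h2 : ∀ l : ℕ, ∫ t in (l * τ : ℝ)..((l + 1 : ℕ) * τ), Q (x + t • w) =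
        ∫ t in (0 : ℝ)..τ, Q (x + t • w + (2 * Real.pi / r.den * (l * m)) • e) := by
      intro l
      have := intervalIntegral.integral_comp_add_right (a := 0) (b := τ)
        (fun t : ℝ => Q (x + t • w)) (l * τ)
      rw [show (0 : ℝ) + l * τ = l * τ by ring,
        show τ + l * τ = ((l + 1 : ℕ) : ℝ) * τ by push_cast; ring] at this
      rw [← this]
      refine intervalIntegral.integral_congr fun t _ => ?_
      rw [add_smul, ← add_assoc, hstep]
    simp only [lineAverage, G, smul_eq_mul]
    rw [h1, Finset.sum_congr rfl fun l _ => h2 l, intervalIntegral.integral_const_mul,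
      intervalIntegral.integral_finsetSum]
    · rw [mul_inv]; ring
    · intro l _
      exact (hQ.comp (by fun_prop)).intervalIntegrable _ _
  have hGw : ∀ (x : Fin 2 → ℝ) (a b : ℝ), IntervalIntegrable (fun t : ℝ => G (x + t • w)) volume a b :=
    fun x a b => intervalIntegrable_line hGc w x a b
  have hG0 : ∀ c a b : ℝ, IntervalIntegrable
      (fun t : ℝ => G ((c + t * w 0) • Pi.single 0 1)) volume a b :=
    fun c a b => (hGc.comp (by fun_prop)).intervalIntegrable a b
  -- With the second angle frozen at zero only the first angle moves, and its mean over a full turn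
  -- does not depend on the starting point.
  have hbase : ∀ x : Fin 2 → ℝ, ∫ t in (0 : ℝ)..τ, G ((x 0 + t * w 0) • Pi.single 0 1) =
      ∫ t in (0 : ℝ)..τ, G ((t * w 0) • Pi.single 0 1) := by
    intro x
    have hp : Function.Periodic (fun t : ℝ => G ((t * w 0) • Pi.single 0 1)) τ := by
      intro t
      simp only [G]
      congr 1
      refine Finset.sum_congr rfl fun l _ => ?_
      rw [add_mul, hσ, add_smul, add_right_comm, hper0]
    have h1 := hp.intervalIntegral_add_eq (x 0 / w 0) 0
    have h2 := intervalIntegral.integral_comp_add_right (a := 0) (b := τ)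
      (fun t : ℝ => G ((t * w 0) • Pi.single 0 1)) (x 0 / w 0)
    rw [zero_add] at h1 h2
    rw [← h1, add_comm, ← h2]
    refine intervalIntegral.integral_congr fun t _ => ?_
    congr 2
    field_simp
    ring
  set δ : ℝ := (2 * Real.pi / r.den) ^ (N + 1) * C with hδ
  -- Freezing the second angle changes `G` by at most its oscillation `δ` in that angle. All
  -- averages are therefore within `δ` of one common number, whence the factor `2` in the statement.
  have hclose : ∀ x : Fin 2 → ℝ, |lineAverage Q w (L * τ) x -
      τ⁻¹ * ∫ t in (0 : ℝ)..τ, G ((t * w 0) • Pi.single 0 1)| ≤ δ := by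
    intro x
    rw [havg, ← hbase x, ← mul_sub, ← intervalIntegral.integral_sub (hGw _ _ _) (hG0 _ _ _), abs_mul, abs_of_pos (inv_pos.2 hτ0),
      inv_mul_le_iff₀ hτ0]
    have := intervalIntegral.norm_integral_le_of_norm_le_const (a := 0) (b := τ) (C := δ)
      (f := fun t : ℝ => G (x + t • w) - G ((x 0 + t * w 0) • Pi.single 0 1)) fun t _ => by
        have hx : x + t • w = (x 0 + t * w 0) • Pi.single 0 1 + (x 1 + t * w 1) • e := by
          ext i
          fin_cases i <;> simp [he]
        rw [hx]
        exact hosc _ _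
    rw [sub_zero, abs_of_pos hτ0, mul_comm] at this
    exact this
  refine ⟨L * τ, hT1, fun x y => ?_⟩
  have h1 := abs_le.1 (hclose x)
  have h2 := abs_le.1 (hclose y)
  rw [abs_le]
  constructor <;> linarith [h1.1, h1.2, h2.1, h2.2]

end TorusAverage

/-! ### From Cauchy estimates at a point to bounds in a neighborhood -/

section CauchyEstimates

variable {E F : Type*} [NormedAddCommGroup E] [NormedSpace ℝ E] [NormedAddCommGroup F]
  [NormedSpace ℝ F] [CompleteSpace F]

/-- The radius must depend on the estimates only, whereas analyticity of `f` represents it by its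
Taylor series on an unspecified ball. The estimates make the Taylor series converge on the ball of
radius `1/R`. The identity theorem propagates the equality with `f`, and on half the radius a
geometric series bounds the sum. -/
theorem norm_le_of_cauchyEstimates {f : E → F} {y₀ : E} {r A R : ℝ} (hr : 0 < r) (hR : 0 < R)
    (hf : AnalyticOnNhd ℝ f (Metric.ball y₀ r))
    (hb : ∀ n : ℕ, ‖iteratedFDeriv ℝ n f y₀‖ ≤ A * R ^ n * n.factorial) :
    ∀ y ∈ Metric.ball y₀ (min r (2 * R)⁻¹), ‖f y‖ ≤ 2 * A := by
  let P : FormalMultilinearSeries ℝ E F := fun n =>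
    ((n.factorial : ℝ)⁻¹) • iteratedFDeriv ℝ n f y₀
  have hP : ∀ n, ‖P n‖ ≤ A * R ^ n := fun n => by
    have hn : (0 : ℝ) < n.factorial := by positivity
    simp only [P, norm_smul, norm_inv, Real.norm_natCast]
    rw [inv_mul_le_iff₀ hn]
    linarith [hb n]
  let R' : NNReal := ⟨R⁻¹, by positivity⟩
  have hrad : (R' : ENNReal) ≤ P.radius := by
    refine P.le_radius_of_bound A fun n => ?_
    calc ‖P n‖ * (R⁻¹) ^ n ≤ A * R ^ n * (R⁻¹) ^ n := by gcongr; exact hP n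
      _ = A := by rw [mul_assoc, ← mul_pow, mul_inv_cancel₀ hR.ne', one_pow, mul_one]
  have hR'pos : (0 : ENNReal) < R' := by
    have : (0 : NNReal) < R' := by
      rw [← NNReal.coe_pos]; exact inv_pos.2 hR
    exact_mod_cast this
  have hball : HasFPowerSeriesOnBall P.sum P 0 P.radius :=
    P.hasFPowerSeriesOnBall (hR'pos.trans_le hrad)
  set g : E → F := fun y => P.sum (y - y₀) with hg
  have hgan : AnalyticOnNhd ℝ g (Metric.ball y₀ R⁻¹) := by
    intro y hy
    have h1 : AnalyticAt ℝ P.sum (y - y₀) := by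
      refine hball.analyticOnNhd _ (Metric.eball_subset_eball hrad ?_)
      rw [Metric.eball_coe]
      rw [Metric.mem_ball, dist_eq_norm] at hy
      rw [mem_ball_zero_iff]
      exact hy
    exact h1.comp_of_eq (f := fun y => y - y₀) (by fun_prop) rfl
  set ρ := min r (2 * R)⁻¹ with hρ
  have hρ0 : 0 < ρ := lt_min hr (by positivity)
  have hρr : ρ ≤ r := min_le_left _ _
  have hρR' : ρ ≤ (2 * R)⁻¹ := min_le_right _ _
  have hρR : ρ ≤ R⁻¹ := hρR'.trans (by
    apply inv_anti₀ hR; linarith)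
  have heq : EqOn f g (Metric.ball y₀ ρ) := by
    refine AnalyticOnNhd.eqOn_of_preconnected_of_eventuallyEq
      (hf.mono (Metric.ball_subset_ball hρr)) (hgan.mono (Metric.ball_subset_ball hρR))
      (convex_ball y₀ ρ).isPreconnected (Metric.mem_ball_self hρ0) ?_
    obtain ⟨p, s, hs⟩ := hf y₀ (Metric.mem_ball_self hr)
    have hmem : Metric.eball y₀ (min s R') ∈ 𝓝 y₀ :=
      Metric.eball_mem_nhds _ (lt_min hs.r_pos hR'pos)
    filter_upwards [hmem] with y hy
    have h1 : y - y₀ ∈ Metric.eball (0 : E) s := by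
      have := Metric.eball_subset_eball (min_le_left _ _) hy
      simpa [edist_eq_enorm_sub] using this
    have h2 := hs.hasSum_iteratedFDeriv h1
    have h3 : y - y₀ ∈ Metric.eball (0 : E) P.radius := by
      have := Metric.eball_subset_eball ((min_le_right _ _).trans hrad) hy
      simpa [edist_eq_enorm_sub] using this
    have h4 := hball.hasSum h3
    rw [zero_add] at h4
    rw [add_sub_cancel] at h2
    exact h2.unique h4
  intro y hy
  rw [heq hy]
  have hyn : ‖y - y₀‖ < (2 * R)⁻¹ := by
    rw [← dist_eq_norm]; exact lt_of_lt_of_le hy hρR'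
  have hA : 0 ≤ A := by
    have := (norm_nonneg _).trans (hP 0); simpa using this
  have hgeom := hasSum_geometric_two.mul_left A
  rw [mul_comm A 2] at hgeom
  refine tsum_of_norm_bounded hgeom fun n => ?_
  refine ((P n).le_opNorm _).trans ?_
  simp only [Finset.prod_const, Finset.card_univ, Fintype.card_fin]
  calc ‖P n‖ * ‖y - y₀‖ ^ n ≤ (A * R ^ n) * ((2 * R)⁻¹) ^ n := by
        gcongr
        · exact hP n
    _ = A * (1 / 2) ^ n := by
        rw [mul_assoc, ← mul_pow]; congr 2; field_simp

end CauchyEstimates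

/-- The derivative again satisfies Cauchy estimates, with `A * R` and `2 * R`, because `n + 1 ≤ 2 ^
n`. The target space is quantified inside, since each differentiation changes it, and after `ρ` and
`C`, which are common to all functions. -/
theorem exists_norm_iteratedFDeriv_le_of_cauchyEstimates {E : Type} [NormedAddCommGroup E]
    [NormedSpace ℝ E] (m : ℕ) : ∀ A R r : ℝ, 0 < R → 0 < r → ∃ ρ > 0, ∃ C : ℝ,
    ∀ (F : Type) [NormedAddCommGroup F] [NormedSpace ℝ F] [CompleteSpace F] (f : E → F) (y₀ : E),
      AnalyticOnNhd ℝ f (Metric.ball y₀ r) →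
      (∀ n : ℕ, ‖iteratedFDeriv ℝ n f y₀‖ ≤ A * R ^ n * n.factorial) →
      ∀ y ∈ Metric.ball y₀ ρ, ‖iteratedFDeriv ℝ m f y‖ ≤ C := by
  induction m with
  | zero =>
    intro A R r hR hr
    refine ⟨min r (2 * R)⁻¹, lt_min hr (by positivity), 2 * A, ?_⟩
    intro F _ _ _ f y₀ hf hb y hy
    rw [norm_iteratedFDeriv_zero]
    exact norm_le_of_cauchyEstimates hr hR hf hb y hy
  | succ m ih =>
    intro A R r hR hr
    obtain ⟨ρ, hρ, C, h⟩ := ih (A * R) (2 * R) r (by positivity) hr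
    refine ⟨ρ, hρ, C, ?_⟩
    intro F _ _ _ f y₀ hf hb y hy
    rw [← norm_iteratedFDeriv_fderiv]
    refine h (E →L[ℝ] F) (fderiv ℝ f) y₀ hf.fderiv (fun n => ?_) y hy
    rw [norm_iteratedFDeriv_fderiv]
    refine (hb (n + 1)).trans ?_
    have hA : 0 ≤ A := by
      have := (norm_nonneg _).trans (hb 0); simpa using this
    have h2 : ((n : ℝ) + 1) ≤ 2 ^ n := by exact_mod_cast (Nat.lt_two_pow_self (n := n))
    rw [Nat.factorial_succ, mul_pow]
    push_cast
    calc A * R ^ (n + 1) * (((n : ℝ) + 1) * n.factorial)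
        ≤ A * R ^ (n + 1) * (2 ^ n * n.factorial) := by gcongr
      _ = A * R * (2 ^ n * R ^ n) * n.factorial := by ring

/-- Smoothness at a point extends to open neighborhoods, which turns the Faà di Bruno bound on sets
into one at a point. -/
theorem norm_iteratedFDeriv_comp_le_of_contDiffAt {E F G : Type*} [NormedAddCommGroup E]
    [NormedSpace ℝ E] [NormedAddCommGroup F] [NormedSpace ℝ F] [NormedAddCommGroup G]
    [NormedSpace ℝ G] {g : F → G} {f : E → F} {x : E} {n : ℕ} {C D : ℝ}
    (hg : ContDiffAt ℝ n g (f x)) (hf : ContDiffAt ℝ n f x)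
    (hC : ∀ i ≤ n, ‖iteratedFDeriv ℝ i g (f x)‖ ≤ C)
    (hD : ∀ i, 1 ≤ i → i ≤ n → ‖iteratedFDeriv ℝ i f x‖ ≤ D ^ i) :
    ‖iteratedFDeriv ℝ n (g ∘ f) x‖ ≤ n.factorial * C * D ^ n := by
  obtain ⟨t, ht, htg⟩ := hg.eventually (by simp) |>.exists_mem
  obtain ⟨t', ht't, ht'o, hxt'⟩ := mem_nhds_iff.1 ht
  have hpre : ∀ᶠ y in 𝓝 x, ContDiffAt ℝ n f y ∧ f y ∈ t' :=
    (hf.eventually (by simp)).and (hf.continuousAt (ht'o.mem_nhds hxt'))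
  obtain ⟨s, hs, hso, hxs⟩ := eventually_nhds_iff.1 hpre
  have hg' : ContDiffOn ℝ n g t' := fun y hy => (htg y (ht't hy)).contDiffWithinAt
  have hf' : ContDiffOn ℝ n f s := fun y hy => (hs y hy).1.contDiffWithinAt
  have := norm_iteratedFDerivWithin_comp_le hg' hf' le_rfl ht'o.uniqueDiffOn hso.uniqueDiffOn
    (fun y hy => (hs y hy).2) hxs (C := C) (D := D)
    (fun i hi => by rw [iteratedFDerivWithin_of_isOpen i ht'o hxt']; exact hC i hi)
    (fun i hi hi' => by rw [iteratedFDerivWithin_of_isOpen i hso hxs]; exact hD i hi hi')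
  rwa [iteratedFDerivWithin_of_isOpen n hso hxs] at this

theorem norm_iteratedFDeriv_affine_le {E : Type*} [NormedAddCommGroup E] [NormedSpace ℝ E]
    (x v : E) (hv : ‖v‖ ≤ 1) {i : ℕ} (hi : 1 ≤ i) (s : ℝ) :
    ‖iteratedFDeriv ℝ i (fun s : ℝ => x + s • v) s‖ ≤ 1 := by
  obtain ⟨j, rfl⟩ := Nat.exists_eq_add_of_le' hi
  rw [← norm_iteratedFDeriv_fderiv]
  have hfd : fderiv ℝ (fun s : ℝ => x + s • v) = fun _ => ContinuousLinearMap.toSpanSingleton ℝ v := by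
    funext s
    refine HasFDerivAt.fderiv ?_
    exact ((ContinuousLinearMap.toSpanSingleton ℝ v).hasFDerivAt.const_add x)
  rw [hfd]
  rcases Nat.eq_zero_or_pos j with rfl | hj
  · rw [norm_iteratedFDeriv_zero]; simpa using hv
  · rw [iteratedFDeriv_const_of_ne hj.ne']; simp

theorem exists_add_two_pi_mem_torusBox (x : Fin 2 → ℝ) :
    ∃ k : Fin 2 → ℤ, (fun i => x i + 2 * Real.pi * k i) ∈ torusBox := by
  refine ⟨fun i => -toIcoDiv Real.two_pi_pos 0 (x i), ?_⟩
  have hi : ∀ i, x i + 2 * Real.pi * (-toIcoDiv Real.two_pi_pos 0 (x i) : ℤ) ∈ Ico 0 (2 * Real.pi) :=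
    fun i => by
      have h := toIcoMod_mem_Ico Real.two_pi_pos 0 (x i)
      rw [← self_sub_toIcoDiv_zsmul] at h
      push_cast
      simpa [sub_eq_add_neg, mul_comm] using h
  exact ⟨fun i => (hi i).1, fun i => (hi i).2.le⟩

/-! ### Uniform bounds for an analytic family near a torus -/

section Uniform

variable {M : Type*} [TopologicalSpace M] [ChartedSpace Plane M] [IsManifold 𝓘(ℝ, Plane) ω M]
  {p f : Cotangent M → ℝ} {a₀ : ℝ}

/-- The members of a uniformly analytic family have locally uniformly bounded derivatives. -/
theorem UniformlyAnalyticOn.exists_bound {F : Set (Cotangent M → ℝ)} {K : Set (Cotangent M)}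
    (hF : UniformlyAnalyticOn F K) (hF_an : ∀ q ∈ F, ContMDiff phaseI 𝓘(ℝ, ℝ) ω q)
    {z : Cotangent M} (hz : z ∈ K) (m : ℕ) :
    ∃ C : ℝ, ∀ᶠ y in 𝓝 (extChartAt phaseI z z), ∀ q ∈ F,
      ‖iteratedFDeriv ℝ m (q ∘ (extChartAt phaseI z).symm) y‖ ≤ C := by
  obtain ⟨R, hR⟩ := hF z hz
  obtain ⟨r, hr, hball⟩ := Metric.isOpen_iff.1 (isOpen_extChartAt_target (I := phaseI) z)
    (extChartAt phaseI z z) (mem_extChartAt_target z)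
  -- The given `R` may be negative or zero, hence `max |R| 1`. It occurs twice because `R ^ (n + 1)
  -- = R * R ^ n`.
  obtain ⟨ρ, hρ, C, h⟩ := exists_norm_iteratedFDeriv_le_of_cauchyEstimates (E := PhaseModel) m
    (max |R| 1) (max |R| 1) r (by positivity) hr
  refine ⟨C, ?_⟩
  filter_upwards [Metric.ball_mem_nhds _ hρ] with y hy q hq
  refine h ℝ _ _ (fun w hw => ?_) (fun n => ?_) y hy
  · exact ((hF_an q hq).contDiffAt_comp_extChartAt_symm z (hball hw)).analyticAt
  · refine (hR q hq n).trans ?_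
    have h1 : R ^ (n + 1) ≤ (max |R| 1) ^ (n + 1) :=
      (le_abs_self _).trans (by rw [abs_pow]; gcongr; exact le_max_left _ _)
    calc R ^ (n + 1) * (n.factorial : ℝ) ≤ (max |R| 1) ^ (n + 1) * n.factorial := by gcongr
      _ = _ := by ring

namespace ActionAngleChart

variable (c : ActionAngleChart p f a₀)

theorem contDiffAt_comp_κ {q : Cotangent M → ℝ} (hq : ContMDiff phaseI 𝓘(ℝ, ℝ) ω q)
    (x : Fin 2 → ℝ) {ξ : Fin 2 → ℝ} (hξ : ξ ∈ c.B) : ContDiffAt ℝ ω (q ∘ c.κ) (x, ξ) :=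
  ContMDiffAt.contDiffAt ((hq _).comp _ (c.contMDiffAt_κ x hξ))

/-- In a chart `φ` one has `q ∘ κ = (q ∘ φ⁻¹) ∘ (φ ∘ κ)`. The outer factor is bounded uniformly in
`q`, and the inner one is a fixed analytic map. -/
theorem exists_bound_near {F : Set (Cotangent M → ℝ)} {K : Set (Cotangent M)}
    (hF : UniformlyAnalyticOn F K) (hF_an : ∀ q ∈ F, ContMDiff phaseI 𝓘(ℝ, ℝ) ω q)
    (x₀ : Fin 2 → ℝ) {ξ₀ : Fin 2 → ℝ} (hξ₀ : ξ₀ ∈ c.B) (hK : c.κ (x₀, ξ₀) ∈ K) (N : ℕ) :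
    ∃ C : ℝ, ∀ᶠ w in 𝓝 (x₀, ξ₀), ∀ q ∈ F, ‖iteratedFDeriv ℝ N (q ∘ c.κ) w‖ ≤ C := by
  set φ := extChartAt phaseI (c.κ (x₀, ξ₀)) with hφ
  set h : (Fin 2 → ℝ) × (Fin 2 → ℝ) → PhaseModel := φ ∘ c.κ with hh
  have hcont : ContinuousAt c.κ (x₀, ξ₀) := (c.contMDiffAt_κ x₀ hξ₀).continuousAt
  have hh_an : AnalyticAt ℝ h (x₀, ξ₀) := by
    have : ContMDiffAt 𝓘(ℝ, (Fin 2 → ℝ) × (Fin 2 → ℝ)) 𝓘(ℝ, PhaseModel) ω h (x₀, ξ₀) :=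
      (contMDiffAt_extChartAt (I := phaseI)).comp _ (c.contMDiffAt_κ x₀ hξ₀)
    exact this.contDiffAt.analyticAt
  choose C hC using fun i => hF.exists_bound hF_an hK i
  have hD : ∀ i, ∃ D : ℝ, ∀ᶠ w in 𝓝 (x₀, ξ₀), ‖iteratedFDeriv ℝ i h w‖ ≤ D := fun i => by
    have hc : ContinuousAt (iteratedFDeriv ℝ i h) (x₀, ξ₀) := by
      obtain ⟨u, hu, hxu⟩ := hh_an.exists_mem_nhds_analyticOnNhd
      exact (hxu.iteratedFDeriv i _ (mem_of_mem_nhds hu)).continuousAt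
    exact ⟨‖iteratedFDeriv ℝ i h (x₀, ξ₀)‖ + 1, (hc.norm.eventually (gt_mem_nhds (lt_add_one _))).mono
      fun _ h => le_of_lt h⟩
  choose D hD using hD
  set C' := ∑ i ∈ Finset.range (N + 1), |C i| with hC'
  -- The bound for compositions wants the `i`-th derivative below `D' ^ i`. The summand `1` gives
  -- `D' ≥ 1`, so that `D' ≤ D' ^ i` for `i ≥ 1`.
  set D' := 1 + ∑ i ∈ Finset.range (N + 1), |D i| with hD'
  have hD'1 : 1 ≤ D' := by
    have : 0 ≤ ∑ i ∈ Finset.range (N + 1), |D i| := Finset.sum_nonneg fun _ _ => abs_nonneg _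
    linarith
  refine ⟨N.factorial * C' * D' ^ N, ?_⟩
  have hCev : ∀ᶠ w in 𝓝 (x₀, ξ₀), ∀ i ∈ Finset.range (N + 1), ∀ q ∈ F,
      ‖iteratedFDeriv ℝ i (q ∘ φ.symm) (h w)‖ ≤ C i :=
    (Filter.eventually_all_finset _).2 fun i _ => hh_an.continuousAt.eventually (hC i)
  have hDev : ∀ᶠ w in 𝓝 (x₀, ξ₀), ∀ i ∈ Finset.range (N + 1), ‖iteratedFDeriv ℝ i h w‖ ≤ D i :=
    (Filter.eventually_all_finset _).2 fun i _ => hD i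
  have hsrc : ∀ᶠ w in 𝓝 (x₀, ξ₀), ∀ᶠ w' in 𝓝 w, c.κ w' ∈ φ.source := by
    rw [eventually_eventually_nhds]
    exact hcont (extChartAt_source_mem_nhds (I := phaseI) _)
  filter_upwards [hCev, hDev, hsrc, hh_an.eventually_analyticAt] with w hw1 hw2 hw3 hw4 q hq
  have heq : q ∘ c.κ =ᶠ[𝓝 w] (q ∘ φ.symm) ∘ h := by
    filter_upwards [hw3] with w' hw'
    simp only [Function.comp, hh]
    rw [φ.left_inv hw']
  rw [heq.iteratedFDeriv ℝ N |>.eq_of_nhds]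
  have htarget : h w ∈ φ.target := φ.map_source hw3.self_of_nhds
  refine norm_iteratedFDeriv_comp_le_of_contDiffAt
    (((hF_an q hq).contDiffAt_comp_extChartAt_symm _ htarget).of_le le_top)
    (hw4.contDiffAt.of_le le_top) (fun i hi => ?_) (fun i hi hi' => ?_)
  · have him : i ∈ Finset.range (N + 1) := Finset.mem_range.2 (by omega)
    refine ((hw1 i him q hq).trans (le_abs_self _)).trans ?_
    exact Finset.single_le_sum (f := fun i => |C i|) (fun _ _ => abs_nonneg _) him
  · have him : i ∈ Finset.range (N + 1) := Finset.mem_range.2 (by omega)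
    refine ((hw2 i him).trans (le_abs_self _)).trans ?_
    have h1 := Finset.single_le_sum (f := fun i => |D i|) (fun _ _ => abs_nonneg _) him
    calc |D i| ≤ D' := by simp only [hD']; linarith
      _ ≤ D' ^ i := le_self_pow₀ hD'1 (by omega)

/-- `q ∘ κ` is periodic in the angles, so a bound over the fundamental domain holds everywhere. -/
theorem norm_iteratedFDeriv_comp_κ_le {q : Cotangent M → ℝ} {ξ : Fin 2 → ℝ} (hξ : ξ ∈ c.B) {n : ℕ}
    {C : ℝ} (hC : ∀ x ∈ torusBox, ‖iteratedFDeriv ℝ n (q ∘ c.κ) (x, ξ)‖ ≤ C) (x : Fin 2 → ℝ) :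
    ‖iteratedFDeriv ℝ n (q ∘ c.κ) (x, ξ)‖ ≤ C := by
  obtain ⟨k, hk⟩ := exists_add_two_pi_mem_torusBox x
  set v : (Fin 2 → ℝ) × (Fin 2 → ℝ) := (fun i => 2 * Real.pi * k i, 0) with hv
  have heq : (fun w => (q ∘ c.κ) (w + v)) =ᶠ[𝓝 (x, ξ)] q ∘ c.κ := by
    filter_upwards [(isOpen_univ.prod c.isOpen_B).mem_nhds ⟨mem_univ x, hξ⟩] with w hw
    have := c.κ_periodic w.1 hw.2 k
    simp only [Function.comp, hv]
    rw [← this]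
    congr 2
    ext i
    · simp
    · simp
  rw [← heq.iteratedFDeriv ℝ n |>.eq_of_nhds, iteratedFDeriv_comp_add_right]
  have hpt : (x, ξ) + v = (fun i => x i + 2 * Real.pi * k i, ξ) := by
    ext i <;> simp [hv]
  rw [hpt]
  exact hC _ hk

theorem contDiff_angle_line {q : Cotangent M → ℝ} (hq : ContMDiff phaseI 𝓘(ℝ, ℝ) ω q) {ξ : Fin 2 → ℝ}
    (hξ : ξ ∈ c.B) (n : ℕ) (x v : Fin 2 → ℝ) :
    ContDiff ℝ n fun s : ℝ => q (c.κ (x + s • v, ξ)) := by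
  refine contDiff_iff_contDiffAt.2 fun s => ?_
  refine ContDiffAt.comp (g := q ∘ c.κ) (f := fun s : ℝ => (x + s • v, ξ)) s
    ((c.contDiffAt_comp_κ hq _ hξ).of_le le_top) ?_
  fun_prop

/-- The angular derivatives of the members of a uniformly analytic family are uniformly bounded near a
torus. -/
theorem exists_bound_angle_line {F : Set (Cotangent M → ℝ)} {K : Set (Cotangent M)}
    (hF : UniformlyAnalyticOn F K) (hF_an : ∀ q ∈ F, ContMDiff phaseI 𝓘(ℝ, ℝ) ω q)
    {ξ₀ : Fin 2 → ℝ} (hξ₀ : ξ₀ ∈ c.B) (hK : ∀ x, c.κ (x, ξ₀) ∈ K) (N : ℕ) :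
    ∃ C : ℝ, ∀ᶠ ξ in 𝓝 ξ₀, ∀ q ∈ F, ∀ (x : Fin 2 → ℝ) (s : ℝ),
      |iteratedDeriv N (fun s : ℝ => q (c.κ (x + s • Pi.single 1 1, ξ))) s| ≤ C := by
  -- Compactness of the box yields one neighborhood of `ξ₀` valid for all angles.
  have hbox (N : ℕ) : ∃ C : ℝ, ∀ᶠ ξ in 𝓝 ξ₀, ∀ x ∈ torusBox, ∀ q ∈ F,
      ‖iteratedFDeriv ℝ N (q ∘ c.κ) (x, ξ)‖ ≤ C := by
    refine isCompact_torusBox.induction_on (p := fun A => ∃ C : ℝ, ∀ᶠ ξ in 𝓝 ξ₀, ∀ x ∈ A, ∀ q ∈ F,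
      ‖iteratedFDeriv ℝ N (q ∘ c.κ) (x, ξ)‖ ≤ C) ⟨0, by simp⟩ ?_ ?_ ?_
    · rintro A B hAB ⟨C, hC⟩
      exact ⟨C, hC.mono fun ξ h x hx => h x (hAB hx)⟩
    · rintro A B ⟨C, hC⟩ ⟨C', hC'⟩
      refine ⟨max C C', ?_⟩
      filter_upwards [hC, hC'] with ξ h h' x hx q hq
      rcases hx with hx | hx
      · exact (h x hx q hq).trans (le_max_left _ _)
      · exact (h' x hx q hq).trans (le_max_right _ _)
    · intro x₀ _
      obtain ⟨C, hC⟩ := c.exists_bound_near hF hF_an x₀ hξ₀ (hK x₀) N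
      rw [nhds_prod_eq, eventually_prod_iff] at hC
      obtain ⟨pa, hpa, pb, hpb, h⟩ := hC
      exact ⟨{x | pa x}, mem_nhdsWithin_of_mem_nhds hpa, C, hpb.mono fun ξ hξ x hx => h hx hξ⟩
  choose C hC using hbox
  set C' := ∑ i ∈ Finset.range (N + 1), |C i| with hC'
  refine ⟨N.factorial * C' * 1 ^ N, ?_⟩
  have hCev : ∀ᶠ ξ in 𝓝 ξ₀, ∀ i ∈ Finset.range (N + 1), ∀ x ∈ torusBox, ∀ q ∈ F,
      ‖iteratedFDeriv ℝ i (q ∘ c.κ) (x, ξ)‖ ≤ C i :=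
    (Filter.eventually_all_finset _).2 fun i _ => hC i
  filter_upwards [hCev, c.isOpen_B.mem_nhds hξ₀] with ξ hξC hξB q hq x s
  rw [← Real.norm_eq_abs, ← norm_iteratedFDeriv_eq_norm_iteratedDeriv]
  have hline : (fun s : ℝ => q (c.κ (x + s • Pi.single 1 1, ξ))) =
      (q ∘ c.κ) ∘ fun s : ℝ => (x, ξ) + s • ((Pi.single 1 1, 0) : (Fin 2 → ℝ) × (Fin 2 → ℝ)) := by
    funext s
    simp
  have hpt : (x, ξ) + s • ((Pi.single 1 1, 0) : (Fin 2 → ℝ) × (Fin 2 → ℝ)) =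
      (x + s • Pi.single 1 1, ξ) := by simp
  rw [hline]
  refine norm_iteratedFDeriv_comp_le_of_contDiffAt ?_ ?_ (fun i hi => ?_) (fun i hi _ => ?_)
  · rw [hpt]
    exact (c.contDiffAt_comp_κ (hF_an q hq) _ hξB).of_le le_top
  · fun_prop
  · have him : i ∈ Finset.range (N + 1) := Finset.mem_range.2 (by omega)
    rw [hpt]
    refine le_trans ?_ ((le_abs_self (C i)).trans
      (Finset.single_le_sum (f := fun i => |C i|) (fun _ _ => abs_nonneg _) him))
    exact c.norm_iteratedFDeriv_comp_κ_le hξB (fun y hy => hξC i him y hy q hq) _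
  · rw [one_pow]
    refine norm_iteratedFDeriv_affine_le _ _ ?_ hi s
    rw [Prod.norm_mk, norm_zero, Pi.norm_single]
    simp

end ActionAngleChart

end Uniform

/-! ### Maps to the projective line and isolated level sets -/

theorem projRatio_eq_infty_iff {u v : ℝ} : projRatio u v = OnePoint.infty ↔ v = 0 := by
  unfold projRatio
  split_ifs with h
  · simp [h]
  · simp [h]

theorem projRatio_of_ne_zero {u v : ℝ} (hv : v ≠ 0) : projRatio u v = ((u / v : ℝ) : OnePoint ℝ) := by
  simp [projRatio, hv]

theorem projRatio_eq_coe_iff {u v y : ℝ} (h : u ≠ 0 ∨ v ≠ 0) :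
    projRatio u v = (y : OnePoint ℝ) ↔ u - y * v = 0 := by
  unfold projRatio
  split_ifs with hv
  · have hu : u ≠ 0 := h.resolve_right (not_not.2 hv)
    simp [hv, hu]
  · rw [OnePoint.coe_eq_coe, div_eq_iff hv, sub_eq_zero]

@[simp] theorem finitePart_coe (x : ℝ) : finitePart (x : OnePoint ℝ) = x := rfl

/-- Near each point of `A` each value is either taken identically or not taken except possibly at
the point. -/
def IsRigidOn {X : Type*} (r : ℝ → X) (A : Set ℝ) : Prop :=
  ∀ a ∈ A, ∀ x, (∀ᶠ b in 𝓝[A] a, r b = x) ∨ ∀ᶠ b in 𝓝[A \ {a}] a, r b ≠ x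

/-- The points near which `r` equals `x` form a relatively open set. By rigidity its complement in
`A` is relatively open too, so the whole component of `a` would lie in it and `r` would be constant
there. -/
theorem IsRigidOn.not_eventually_eq {X : Type*} {r : ℝ → X} {A : Set ℝ} (h : IsRigidOn r A)
    (hnc : NonconstantOnComponents r A) {a : ℝ} (ha : a ∈ A) (x : X) :
    ¬ ∀ᶠ b in 𝓝[A] a, r b = x := by
  intro h0
  set u : Set ℝ := {b | ∀ᶠ b' in 𝓝 b, b' ∈ A → r b' = x} with hu
  set v : Set ℝ := {b | ∀ᶠ b' in 𝓝 b, b' ∈ A → b' ∉ u} with hv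
  have hCA : connectedComponentIn A a ⊆ A := connectedComponentIn_subset A a
  have hau : a ∈ u := eventually_nhdsWithin_iff.1 h0
  have hcover : connectedComponentIn A a ⊆ u ∪ v := by
    intro b hb
    by_cases hbu : b ∈ u
    · exact Or.inl hbu
    right
    rcases h b (hCA hb) x with h1 | h1
    · exact absurd (eventually_nhdsWithin_iff.1 h1) hbu
    · rw [eventually_nhdsWithin_iff] at h1
      filter_upwards [h1] with b' hb' hb'A hb'u
      by_cases hbb : b' = b
      · exact hbu (hbb ▸ hb'u)
      · exact hb' ⟨hb'A, hbb⟩ (hb'u.self_of_nhds hb'A)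
  have hCu : connectedComponentIn A a ⊆ u := by
    intro b hb
    by_contra hbu
    obtain ⟨b', hb', hb'u, hb'v⟩ := isPreconnected_connectedComponentIn u v isOpen_setOfPred_eventually_nhds
      isOpen_setOfPred_eventually_nhds hcover ⟨a, mem_connectedComponentIn ha, hau⟩
      ⟨b, hb, (hcover hb).resolve_left hbu⟩
    exact (hb'v.self_of_nhds (hCA hb')) hb'u
  refine hnc a ha fun b hb => ?_
  rw [(hCu hb).self_of_nhds (hCA hb), hau.self_of_nhds ha]

theorem AnalyticOn.isRigidOn {g : ℝ → ℝ} {A : Set ℝ} (hg : AnalyticOn ℝ g A) : IsRigidOn g A := by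
  intro a ha x
  obtain ⟨G, -, hgG, hG⟩ := (hg a ha).exists_analyticAt
  rcases hG.eventually_eq_or_eventually_ne (analyticAt_const (v := x)) with h | h
  · left
    filter_upwards [nhdsWithin_le_nhds h, self_mem_nhdsWithin] with b hb hbA
    rw [hgG (mem_insert_of_mem _ hbA), hb]
  · right
    filter_upwards [nhdsWithin_mono a (fun b hb => hb.2 : A \ {a} ⊆ {a}ᶜ) h, self_mem_nhdsWithin]
      with b hb hbA
    rw [hgG (mem_insert_of_mem _ hbA.1)]
    exact hb

theorem ProjAnalyticOn.exists_analyticAt {r : ℝ → OnePoint ℝ} {A : Set ℝ} (hr : ProjAnalyticOn r A)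
    {a : ℝ} (ha : a ∈ A) : ∃ u v : ℝ → ℝ, AnalyticAt ℝ u a ∧ AnalyticAt ℝ v a ∧
      (∀ᶠ b in 𝓝 a, u b ≠ 0 ∨ v b ≠ 0) ∧ ∀ᶠ b in 𝓝[A] a, r b = projRatio (u b) (v b) := by
  obtain ⟨u, v, hu, hv, h0, he⟩ := hr a ha
  obtain ⟨u', hu1, hu2, hu3⟩ := hu.exists_analyticAt
  obtain ⟨v', hv1, hv2, hv3⟩ := hv.exists_analyticAt
  refine ⟨u', v', hu3, hv3, ?_, ?_⟩
  · rw [hu1, hv1] at h0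
    rcases h0 with h0 | h0
    · exact (hu3.continuousAt.eventually_ne h0).mono fun _ h => Or.inl h
    · exact (hv3.continuousAt.eventually_ne h0).mono fun _ h => Or.inr h
  · filter_upwards [he, self_mem_nhdsWithin] with b hb hbA
    rw [hb, hu2 (mem_insert_of_mem _ hbA), hv2 (mem_insert_of_mem _ hbA)]

/-- The value `∞` is taken where `v = 0` and the value `y` where `u - y v = 0`. Either way the level
set is the zero set of an analytic function, to which isolation of zeros applies. -/
theorem ProjAnalyticOn.isRigidOn {r : ℝ → OnePoint ℝ} {A : Set ℝ} (hr : ProjAnalyticOn r A) :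
    IsRigidOn r A := by
  intro a ha x
  obtain ⟨u, v, hu, hv, h0, he⟩ := hr.exists_analyticAt ha
  obtain ⟨D, hD, hDx⟩ : ∃ D : ℝ → ℝ, AnalyticAt ℝ D a ∧ ∀ b, (u b ≠ 0 ∨ v b ≠ 0) →
      (projRatio (u b) (v b) = x ↔ D b = 0) := by
    induction x using OnePoint.rec with
    | infty => exact ⟨v, hv, fun b _ => projRatio_eq_infty_iff⟩
    | coe y => exact ⟨fun b => u b - y * v b, hu.sub (analyticAt_const.mul hv),
        fun b hb => projRatio_eq_coe_iff hb⟩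
  rcases hD.eventually_eq_zero_or_eventually_ne_zero with h | h
  · left
    filter_upwards [nhdsWithin_le_nhds h, nhdsWithin_le_nhds h0, he] with b h1 h2 h3
    rw [h3]; exact (hDx b h2).2 h1
  · right
    filter_upwards [nhdsWithin_mono a (fun b hb => hb.2 : A \ {a} ⊆ {a}ᶜ) h, nhdsWithin_le_nhds h0,
      nhdsWithin_mono a sdiff_subset he] with b h1 h2 h3
    rw [h3]; exact fun h4 => h1 ((hDx b h2).1 h4)

theorem eventually_eq_of_eventually_deriv_eq_zero {G : ℝ → ℝ} {a : ℝ} (hG : AnalyticAt ℝ G a)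
    (h : ∀ᶠ b in 𝓝 a, deriv G b = 0) : ∀ᶠ b in 𝓝 a, G b = G a := by
  obtain ⟨ε, hε, hball⟩ := Metric.eventually_nhds_iff_ball.1 (h.and hG.eventually_analyticAt)
  filter_upwards [Metric.ball_mem_nhds a hε] with b hb
  exact Metric.isOpen_ball.is_const_of_deriv_eq_zero (convex_ball a ε).isPreconnected
    (fun y hy => (hball y hy).2.differentiableAt.differentiableWithinAt)
    (fun y hy => (hball y hy).1) hb (Metric.mem_ball_self hε)

theorem AnalyticAt.eventually_deriv_ne_zero {G : ℝ → ℝ} {a : ℝ} (hG : AnalyticAt ℝ G a)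
    (h : ¬ ∀ᶠ b in 𝓝 a, G b = G a) : ∀ᶠ b in 𝓝[≠] a, deriv G b ≠ 0 :=
  hG.deriv.eventually_eq_zero_or_eventually_ne_zero.resolve_left fun h' =>
    h (eventually_eq_of_eventually_deriv_eq_zero hG h')

/-! ### Analytic local models of `g` and of the rotation number -/

section LocalModel

variable {J S : Set ℝ} {rot : ℝ → OnePoint ℝ} {g : ℝ → ℝ}

/-- Analytic extensions of `g` and of the rotation number near a point at which the latter is finite. -/
theorem exists_local_model (hrot_an : ProjAnalyticOn rot (J \ S))
    (hrot_nc : NonconstantOnComponents rot (J \ S)) (hg_an : AnalyticOn ℝ g (J \ S))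
    (hg_nc : NonconstantOnComponents g (J \ S)) (hS : S.Finite) {a : ℝ} (ha : a ∈ J \ S)
    (hfin : rot a ≠ OnePoint.infty) :
    ∃ G U : ℝ → ℝ, AnalyticAt ℝ G a ∧ AnalyticAt ℝ U a ∧
      (∀ᶠ b in 𝓝[J] a, b ∉ S ∧ g b = G b ∧ rot b = (U b : OnePoint ℝ)) ∧
      ∀ᶠ b in 𝓝[≠] a, deriv G b ≠ 0 ∧ deriv U b ≠ 0 := by
  have hnhds : 𝓝[J \ S] a = 𝓝[J] a := by
    rw [sdiff_eq]
    exact nhdsWithin_inter_of_mem' (nhdsWithin_le_nhds (hS.isClosed.isOpen_compl.mem_nhds ha.2))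
  obtain ⟨G, hGa, hgG, hG⟩ := (hg_an a ha).exists_analyticAt
  obtain ⟨u, v, hu, hv, h0, he⟩ := hrot_an.exists_analyticAt ha
  have hva : v a ≠ 0 := fun h => hfin (by
    rw [he.self_of_nhdsWithin ha]; exact projRatio_eq_infty_iff.2 h)
  have hU : AnalyticAt ℝ (fun b => u b / v b) a := hu.div hv hva
  have hGev : ∀ᶠ b in 𝓝[J \ S] a, g b = G b := by
    filter_upwards [self_mem_nhdsWithin] with b hb using hgG (mem_insert_of_mem _ hb)
  have hUev : ∀ᶠ b in 𝓝[J \ S] a, rot b = ((u b / v b : ℝ) : OnePoint ℝ) := by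
    filter_upwards [he, nhdsWithin_le_nhds (hv.continuousAt.eventually_ne hva)] with b h1 h2
    rw [h1, projRatio_of_ne_zero h2]
  refine ⟨G, fun b => u b / v b, hG, hU, ?_, ?_⟩
  · rw [← hnhds]
    filter_upwards [hGev, hUev, self_mem_nhdsWithin] with b h1 h2 h3 using ⟨h3.2, h1, h2⟩
  -- A derivative vanishing identically near `a` would make `g`, respectively `rot`, locally
  -- constant, and by rigidity constant on a component.
  · refine (hG.eventually_deriv_ne_zero fun h => ?_).and (hU.eventually_deriv_ne_zero fun h => ?_)
    · refine hg_an.isRigidOn.not_eventually_eq hg_nc ha (G a) ?_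
      filter_upwards [hGev, nhdsWithin_le_nhds h] with b h1 h2
      rw [h1, h2]
    · refine hrot_an.isRigidOn.not_eventually_eq hrot_nc ha ((u a / v a : ℝ) : OnePoint ℝ) ?_
      filter_upwards [hUev, nhdsWithin_le_nhds h] with b h1 h2
      rw [h1, h2]

/-- The interval of parameters has no isolated points. -/
theorem uniqueDiffOn_of_nonconstantOnComponents (hJ : J.OrdConnected)
    (hg_nc : NonconstantOnComponents g (J \ S)) (h : (J \ S).Nonempty) : UniqueDiffOn ℝ J := by
  obtain ⟨a, ha⟩ := h
  have := hg_nc a ha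
  push Not at this
  obtain ⟨b, hb, hba⟩ := this
  have hbJ : b ∈ J \ S := connectedComponentIn_subset _ _ hb
  have hnt : J.Nontrivial := ⟨a, ha.1, b, hbJ.1, fun h => hba (by rw [h])⟩
  exact uniqueDiffOn_convex hJ.convex (hJ.convex.nontrivial_iff_nonempty_interior.1 hnt)

end LocalModel

/-! ### Good values: finite preimages and small complement -/

/-- A good value has finitely many preimages. -/
theorem finite_preimage_of_mem_goodValues {J S : Set ℝ} {rot : ℝ → OnePoint ℝ} {g : ℝ → ℝ} {α d : ℝ}
    (hJ : IsCompact J) (hg : ContinuousOn g J) (hα : 0 < α) {F₀ : ℝ}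
    (hF₀ : F₀ ∈ goodValues J S rot g α d) : {a | a ∈ J ∧ g a = F₀}.Finite := by
  have hclosed : IsClosed {a | a ∈ J ∧ g a = F₀} := by
    have := hg.preimage_isClosed_of_isClosed hJ.isClosed (isClosed_singleton (x := F₀))
    exact this
  have hcompact : IsCompact {a | a ∈ J ∧ g a = F₀} := hJ.of_isClosed_subset hclosed fun a h => h.1
  by_contra hinf
  obtain ⟨a, ha, hacc⟩ := Set.Infinite.exists_accPt_of_subset_isCompact hinf hcompact subset_rfl
  have hreg : a ∈ regularParams J S rot g α d := by
    by_contra h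
    exact hF₀.2 ⟨a, ⟨ha.1, h⟩, ha.2⟩
  have hne : derivWithin g J a ≠ 0 := by
    have := hreg.2.2
    intro h0
    rw [h0, abs_zero] at this
    linarith
  -- Differentiability comes from the lower bound itself: `derivWithin` has the default value `0`
  -- where the derivative does not exist. An accumulation point of the level set is then impossible.
  have hd : HasDerivWithinAt g (derivWithin g J a) J a := by
    refine DifferentiableWithinAt.hasDerivWithinAt ?_
    by_contra h
    exact hne (derivWithin_zero_of_not_differentiableWithinAt h)
  have hev := hd.eventually_ne hne (c := F₀)
  rw [accPt_iff_frequently_nhdsNE, frequently_iff] at hacc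
  rw [eventually_nhdsWithin_iff] at hev
  obtain ⟨b, hb, hb'⟩ := hacc (U := {b | b ∈ J \ {a} → g b ≠ F₀} ∩ {a}ᶜ)
    (inter_mem (nhdsWithin_le_nhds hev) self_mem_nhdsWithin)
  exact hb.1 ⟨hb'.1, hb.2⟩ hb'.2

theorem LipschitzOnWith.volume_image_le {K : NNReal} {f : ℝ → ℝ} {s : Set ℝ}
    (h : LipschitzOnWith K f s) : volume (f '' s) ≤ K * volume s := by
  have := h.hausdorffMeasure_image_le (d := 1) zero_le_one
  rwa [hausdorffMeasure_real, ENNReal.rpow_one] at this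

/-- A local inverse of `U` is Lipschitz and therefore maps null sets to null sets. -/
theorem exists_nhds_volume_inter_preimage_eq_zero {U : ℝ → ℝ} {x U' : ℝ} (hU : HasStrictDerivAt U U' x)
    (hU' : U' ≠ 0) {L : Set ℝ} (hL : volume L = 0) : ∃ N ∈ 𝓝 x, volume (N ∩ U ⁻¹' L) = 0 := by
  have hV := hU.to_localInverse hU'
  obtain ⟨K, t, ht, hK⟩ := hV.hasStrictFDerivAt.exists_lipschitzOnWith
  have hinv : ∀ᶠ y in 𝓝 x, hU.localInverse U U' x hU' (U y) = y :=
    (hU.hasStrictFDerivAt_equiv hU').eventually_left_inverse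
  have hpre : ∀ᶠ y in 𝓝 x, U y ∈ t := hU.hasDerivAt.continuousAt ht
  refine ⟨{y | hU.localInverse U U' x hU' (U y) = y ∧ U y ∈ t}, hinv.and hpre, ?_⟩
  refine measure_mono_null (t := hU.localInverse U U' x hU' '' (t ∩ L)) ?_ ?_
  · rintro y ⟨⟨h1, h2⟩, h3⟩
    exact ⟨U y, ⟨h2, h3⟩, h1⟩
  · have h0 := (hK.mono (inter_subset_left (t := L))).volume_image_le
    rw [measure_mono_null inter_subset_right hL, mul_zero] at h0
    exact le_antisymm h0 bot_le

/-- A number which is irrational and not Liouville with exponent `p` satisfies a Diophantine condition. -/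
theorem exists_diophantine_of_not_liouvilleWith {x p : ℝ} (hx : Irrational x) (h : ¬ LiouvilleWith p x) :
    ∃ α > 0, ∀ m : ℤ, ∀ n : ℕ, 0 < n → α / (n : ℝ) ^ p ≤ |x - m / n| := by
  have h1 : ∀ᶠ n : ℕ in atTop, ∀ m : ℤ, 1 / (n : ℝ) ^ p ≤ |x - m / n| := by
    unfold LiouvilleWith at h
    push Not at h
    have := h 1
    filter_upwards [this] with n hn m
    refine hn m fun hxm => hx ⟨m / n, ?_⟩
    push_cast
    exact hxm.symm
  obtain ⟨N, hN⟩ := eventually_atTop.1 h1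
  -- The Liouville condition controls only large denominators. For each remaining one, irrationality
  -- keeps `n * x` away from its nearest integer.
  have h2 : ∀ n : ℕ, 0 < n → ∃ β > 0, ∀ m : ℤ, β / (n : ℝ) ^ p ≤ |x - m / n| := by
    intro n hn
    have hn' : (0 : ℝ) < n := by exact_mod_cast hn
    have hirr : Irrational (n * x) := hx.natCast_mul hn.ne'
    have hpos : 0 < |n * x - round (n * x)| := abs_pos.2 (sub_ne_zero.2 (hirr.ne_int _))
    refine ⟨(n : ℝ) ^ p * (|n * x - round (n * x)| / n), by positivity, fun m => ?_⟩
    rw [mul_div_cancel_left₀ _ (by positivity), div_le_iff₀ hn']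
    calc |n * x - round (n * x)| ≤ |n * x - m| := round_le _ m
      _ = |x - m / n| * n := by
        rw [← abs_of_pos hn', ← abs_mul, abs_of_pos hn', sub_mul, div_mul_cancel₀ _ hn'.ne', mul_comm]
  choose! β hβ h2 using h2
  obtain ⟨γ, hγ, hγ'⟩ : ∃ γ > 0, ∀ n ∈ Finset.Ico 1 N, γ ≤ β n := by
    rcases (Finset.Ico 1 N).eq_empty_or_nonempty with he | hne
    · exact ⟨1, one_pos, by simp [he]⟩
    · refine ⟨(Finset.Ico 1 N).inf' hne β, ?_, fun n hn => Finset.inf'_le _ hn⟩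
      exact (Finset.lt_inf'_iff hne).2 fun n hn => hβ n (by simp at hn; omega)
  refine ⟨min γ 1, lt_min hγ one_pos, fun m n hn => ?_⟩
  have hnp : (0 : ℝ) < (n : ℝ) ^ p := by
    have : (0 : ℝ) < n := by exact_mod_cast hn
    positivity
  by_cases hnN : N ≤ n
  · refine le_trans ?_ (hN n hnN m)
    gcongr
    exact min_le_right _ _
  · refine le_trans ?_ (h2 n hn m)
    gcongr
    exact (min_le_left _ _).trans (hγ' n (by simp; omega))

/-- Almost every real number is irrational and Liouville with no exponent above two, and `2 + d` is
such an exponent. -/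
theorem volume_not_diophantine {d : ℝ} (hd : 0 < d) :
    volume {x : ℝ | ¬ ∃ α > 0, ∀ m : ℤ, ∀ n : ℕ, 0 < n →
      α / (n : ℝ) ^ (2 + d) ≤ |x - m / n|} = 0 := by
  refine measure_mono_null (t := range ((↑) : ℚ → ℝ) ∪ {x | ¬ ∀ p > (2 : ℝ), ¬ LiouvilleWith p x}) ?_ ?_
  · intro x hx
    by_contra hx'
    rw [mem_union, not_or] at hx'
    have h2 : ∀ p > (2 : ℝ), ¬ LiouvilleWith p x := not_not.1 hx'.2
    exact hx (exists_diophantine_of_not_liouvilleWith hx'.1 (h2 _ (by linarith)))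
  · exact measure_union_null ((countable_range _).measure_zero _) ae_not_liouvilleWith

section LocalModel

variable {J S : Set ℝ} {rot : ℝ → OnePoint ℝ} {g : ℝ → ℝ} {α d : ℝ}

/-- Near a point at which the rotation number is finite the regular parameters are described by
analytic functions. -/
theorem mem_regularParams_iff_of_eventuallyEq (hJu : UniqueDiffOn ℝ J) {G U : ℝ → ℝ} {b : ℝ} (hbJ : b ∈ J)
    (hev : ∀ᶠ y in 𝓝[J] b, y ∉ S ∧ g y = G y ∧ rot y = (U y : OnePoint ℝ))
    (hG : DifferentiableAt ℝ G b) (hU : DifferentiableAt ℝ U b) :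
    b ∈ regularParams J S rot g α d ↔ (∀ s ∈ S, α ≤ |b - s|) ∧ α ≤ |deriv U b| ∧ α ≤ |deriv G b| ∧
      ∀ m : ℤ, ∀ n : ℕ, 0 < n → α / (n : ℝ) ^ (2 + d) ≤ |U b - m / n| := by
  have hb := hev.self_of_nhdsWithin hbJ
  have h1 : derivWithin g J b = deriv G b := by
    rw [Filter.EventuallyEq.derivWithin_eq (hev.mono fun y hy => hy.2.1) hb.2.1]
    exact hG.derivWithin (hJu b hbJ)
  have h2 : derivWithin (fun y => finitePart (rot y)) J b = deriv U b := by
    rw [Filter.EventuallyEq.derivWithin_eq (f := U) (hev.mono fun y hy => by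
      show finitePart (rot y) = U y
      rw [hy.2.2, finitePart_coe]) (by show finitePart (rot b) = U b; rw [hb.2.2, finitePart_coe])]
    exact hU.derivWithin (hJu b hbJ)
  simp only [regularParams, diophantineParams, mem_inter_iff, mem_ofPred_eq, h1, h2, hb.2.2,
    finitePart_coe, Set.mem_sdiff, hbJ, hb.1, ne_eq, OnePoint.coe_ne_infty, not_false_eq_true, true_and]
  tauto

/-- This gives measurability of the bad parameters, needed for continuity of the measure along a
decreasing family. -/
theorem isClosed_diophantine {I : Set ℝ} (hI : IsClosed I) {U : ℝ → ℝ} (hU : ContinuousOn U I) (α d : ℝ) :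
    IsClosed {b ∈ I | ∀ m : ℤ, ∀ n : ℕ, 0 < n → α / (n : ℝ) ^ (2 + d) ≤ |U b - m / n|} := by
  have : {b ∈ I | ∀ m : ℤ, ∀ n : ℕ, 0 < n → α / (n : ℝ) ^ (2 + d) ≤ |U b - m / n|} =
      I ∩ ⋂ (m : ℤ) (n : ℕ) (_ : 0 < n), {b ∈ I | α / (n : ℝ) ^ (2 + d) ≤ |U b - m / n|} := by
    ext b
    simp only [mem_ofPred_eq, mem_inter_iff, mem_iInter]
    exact ⟨fun h => ⟨h.1, fun m n hn => ⟨h.1, h.2 m n hn⟩⟩, fun h => ⟨h.1, fun m n hn => (h.2 m n hn).2⟩⟩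
  rw [this]
  refine hI.inter (isClosed_iInter fun m => isClosed_iInter fun n => isClosed_iInter fun _ => ?_)
  exact ((hU.sub continuousOn_const).abs).preimage_isClosed_of_isClosed hI isClosed_Ici

/-- On a small compact piece `I` of `J` the bad sets decrease with `α`. A point of their
intersection other than `a` has a non-Diophantine value of `U` and `U' ≠ 0` there, so the
intersection is null. Continuity from above and the Lipschitz bound for `g` conclude. -/
theorem tendsto_volume_image_diff_regularParams_local (hJ : IsCompact J) (hJu : UniqueDiffOn ℝ J)
    (hrot_an : ProjAnalyticOn rot (J \ S))
    (hrot_nc : NonconstantOnComponents rot (J \ S)) (hg_an : AnalyticOn ℝ g (J \ S))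
    (hg_nc : NonconstantOnComponents g (J \ S)) (hS : S.Finite) (hd : 0 < d) {a : ℝ} (ha : a ∈ J \ S)
    (hfin : rot a ≠ OnePoint.infty) :
    ∃ I ∈ 𝓝[J] a, Tendsto (fun α => volume (g '' (I \ regularParams J S rot g α d))) (𝓝[>] 0) (𝓝 0) := by
  obtain ⟨G, U, hG, hU, hev, hne⟩ := exists_local_model hrot_an hrot_nc hg_an hg_nc hS ha hfin
  obtain ⟨K, t, ht, hK⟩ := hG.hasStrictDerivAt.hasStrictFDerivAt.exists_lipschitzOnWith
  have hall : ∀ᶠ b in 𝓝 a, AnalyticAt ℝ G b ∧ AnalyticAt ℝ U b ∧ b ∈ t ∧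
      (b ∈ J → ∀ᶠ y in 𝓝[J] b, y ∉ S ∧ g y = G y ∧ rot y = (U y : OnePoint ℝ)) ∧
      (b ≠ a → deriv G b ≠ 0 ∧ deriv U b ≠ 0) := by
    filter_upwards [hG.eventually_analyticAt, hU.eventually_analyticAt, ht,
      eventually_nhdsWithin_iff.1 (eventually_eventually_nhdsWithin.2 hev),
      eventually_nhdsWithin_iff.1 hne] with b h1 h2 h3 h4 h5
    exact ⟨h1, h2, h3, h4, h5⟩
  obtain ⟨δ, hδ, hball⟩ := Metric.eventually_nhds_iff_ball.1 hall
  set I := J ∩ Metric.closedBall a (δ / 2) with hIdef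
  have hIc : IsCompact I := hJ.inter_right Metric.isClosed_closedBall
  have hIball : ∀ b ∈ I, b ∈ J ∧ b ∈ Metric.ball a δ := fun b hb =>
    ⟨hb.1, Metric.closedBall_subset_ball (by linarith) hb.2⟩
  have hiff : ∀ α, ∀ b ∈ I, (b ∈ regularParams J S rot g α d ↔ (∀ s ∈ S, α ≤ |b - s|) ∧
      α ≤ |deriv U b| ∧ α ≤ |deriv G b| ∧
      ∀ m : ℤ, ∀ n : ℕ, 0 < n → α / (n : ℝ) ^ (2 + d) ≤ |U b - m / n|) := fun α b hb => by
    have h := hball b (hIball b hb).2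
    exact mem_regularParams_iff_of_eventuallyEq hJu hb.1 (h.2.2.2.1 hb.1) h.1.differentiableAt
      h.2.1.differentiableAt
  refine ⟨I, inter_mem_nhdsWithin _ (Metric.closedBall_mem_nhds a (by linarith)), ?_⟩
  have hcG : ContinuousOn (deriv G) I := fun b hb =>
    (hball b (hIball b hb).2).1.deriv.continuousAt.continuousWithinAt
  have hcU' : ContinuousOn (deriv U) I := fun b hb =>
    (hball b (hIball b hb).2).2.1.deriv.continuousAt.continuousWithinAt
  have hcU : ContinuousOn U I := fun b hb =>
    (hball b (hIball b hb).2).2.1.continuousAt.continuousWithinAt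
  have hmeas : ∀ α, MeasurableSet (I \ regularParams J S rot g α d) := fun α => by
    have hset : I ∩ regularParams J S rot g α d =
        (⋂ s ∈ S, {b ∈ I | α ≤ |b - s|}) ∩ I ∩ {b ∈ I | α ≤ |deriv U b|} ∩ {b ∈ I | α ≤ |deriv G b|} ∩
        {b ∈ I | ∀ m : ℤ, ∀ n : ℕ, 0 < n → α / (n : ℝ) ^ (2 + d) ≤ |U b - m / n|} := by
      ext b
      by_cases hb : b ∈ I
      · simp only [mem_inter_iff, hb, hiff α b hb, mem_iInter, mem_ofPred_eq, true_and, and_true,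
          and_assoc]
      · simp [hb]
    have hclosed : IsClosed (I ∩ regularParams J S rot g α d) := by
      rw [hset]
      have hIcl := hIc.isClosed
      refine ((((isClosed_biInter fun s _ => ?_).inter hIcl).inter ?_).inter ?_).inter
        (isClosed_diophantine hIcl hcU α d)
      · exact ((continuousOn_id.sub continuousOn_const).abs).preimage_isClosed_of_isClosed hIcl isClosed_Ici
      · exact hcU'.abs.preimage_isClosed_of_isClosed hIcl isClosed_Ici
      · exact hcG.abs.preimage_isClosed_of_isClosed hIcl isClosed_Ici
    rw [← sdiff_self_inter]
    exact hIc.measurableSet.diff hclosed.measurableSet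
  have hmono : ∀ α β : ℝ, 0 < α → α ≤ β → I \ regularParams J S rot g α d ⊆ I \ regularParams J S rot g β d := by
    rintro α β hα hαβ b ⟨hb, hb'⟩
    refine ⟨hb, fun h => hb' ?_⟩
    rw [hiff _ b hb] at h ⊢
    refine ⟨fun s hs => hαβ.trans (h.1 s hs), hαβ.trans h.2.1, hαβ.trans h.2.2.1, fun m n hn =>
      le_trans ?_ (h.2.2.2 m n hn)⟩
    have : (0 : ℝ) < n := by exact_mod_cast hn
    gcongr
  have hnull : volume (⋂ α > (0 : ℝ), I \ regularParams J S rot g α d) = 0 := by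
    set L := {x : ℝ | ¬ ∃ α > 0, ∀ m : ℤ, ∀ n : ℕ, 0 < n →
      α / (n : ℝ) ^ (2 + d) ≤ |x - m / n|} with hL
    refine measure_mono_null (t := {a} ∪ {b ∈ I | deriv U b ≠ 0 ∧ U b ∈ L}) ?_ ?_
    · intro b hb
      rw [mem_iInter₂] at hb
      have hbI : b ∈ I := (hb 1 one_pos).1
      by_cases hba : b = a
      · exact Or.inl hba
      right
      have hloc := hball b (hIball b hbI).2
      obtain ⟨hG0, hU0⟩ := hloc.2.2.2.2 hba
      refine ⟨hbI, hU0, fun ⟨α, hα, hdio⟩ => ?_⟩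
      have hbS : b ∉ S := ((hloc.2.2.2.1 hbI.1).self_of_nhdsWithin hbI.1).1
      obtain ⟨ε, hε, hεS⟩ : ∃ ε > 0, ∀ s ∈ S, ε ≤ |b - s| := by
        obtain ⟨ε, hε, h⟩ := Metric.isOpen_iff.1 hS.isClosed.isOpen_compl b hbS
        refine ⟨ε, hε, fun s hs => not_lt.1 fun hlt => h (a := s) ?_ hs⟩
        rw [Metric.mem_ball, dist_comm, Real.dist_eq]
        exact hlt
      -- The four conditions of regularity hold at `b`, each with its own constant. With the
      -- smallest of them `b` is regular, against its membership in all bad sets.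
      set β := min (min α ε) (min |deriv U b| |deriv G b|) with hβ
      have hβ0 : 0 < β := lt_min (lt_min hα hε) (lt_min (abs_pos.2 hU0) (abs_pos.2 hG0))
      refine (hb β hβ0).2 ((hiff β b hbI).2 ⟨fun s hs => ?_, ?_, ?_, fun m n hn => ?_⟩)
      · exact ((min_le_left _ _).trans (min_le_right _ _)).trans (hεS s hs)
      · exact (min_le_right _ _).trans (min_le_left _ _)
      · exact (min_le_right _ _).trans (min_le_right _ _)
      · refine le_trans ?_ (hdio m n hn)
        have : (0 : ℝ) < n := by exact_mod_cast hn
        have : β ≤ α := (min_le_left _ _).trans (min_le_left _ _)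
        gcongr
    · refine measure_union_null (by simp) (measure_null_of_locally_null _ fun x hx => ?_)
      obtain ⟨N, hN, hN0⟩ := exists_nhds_volume_inter_preimage_eq_zero
        (hball x (hIball x hx.1).2).2.1.hasStrictDerivAt hx.2.1 (volume_not_diophantine hd)
      refine ⟨N ∩ {b ∈ I | deriv U b ≠ 0 ∧ U b ∈ L}, inter_mem (nhdsWithin_le_nhds hN)
        self_mem_nhdsWithin, measure_mono_null ?_ hN0⟩
      rintro b ⟨hb, hb'⟩
      exact ⟨hb, hb'.2.2⟩
  have hlim : Tendsto (fun α => volume (I \ regularParams J S rot g α d)) (𝓝[>] 0) (𝓝 0) := by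
    rw [← hnull]
    exact tendsto_measure_biInter_gt (fun α _ => (hmeas α).nullMeasurableSet) hmono
      ⟨1, one_pos, ((measure_mono sdiff_subset).trans_lt hIc.measure_lt_top).ne⟩
  have hlim' : Tendsto (fun α => (K : ENNReal) * volume (I \ regularParams J S rot g α d)) (𝓝[>] 0) (𝓝 0) := by
    have := ENNReal.Tendsto.const_mul hlim (Or.inr (ENNReal.coe_ne_top (r := K)))
    rwa [mul_zero] at this
  refine tendsto_of_tendsto_of_tendsto_of_le_of_le tendsto_const_nhds hlim' (fun _ => bot_le) fun α => ?_
  have heq : EqOn g G (I \ regularParams J S rot g α d) := fun b hb =>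
    (((hball b (hIball b hb.1).2).2.2.2.1 hb.1.1).self_of_nhdsWithin hb.1.1).2.1
  simp only
  rw [heq.image_eq]
  exact (hK.mono fun b hb => (hball b (hIball b hb.1).2).2.2.1).volume_image_le

/-- The local statement fails to cover only `S` and the poles of `rot`. These are countable, so
their image under `g` lies in an open set `O` of small measure. The part of `J` that `g` does not
map into `O` is compact and is covered by finitely many local pieces. -/
theorem tendsto_volume_diff_goodValues (hJ : IsCompact J) (hJo : J.OrdConnected)
    (hrot_an : ProjAnalyticOn rot (J \ S))
    (hrot_nc : NonconstantOnComponents rot (J \ S)) (hg_an : AnalyticOn ℝ g (J \ S))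
    (hg_cont : ContinuousOn g J)
    (hg_nc : NonconstantOnComponents g (J \ S)) (hS : S.Finite) (hSJ : S ⊆ J) (hd : 0 < d) :
    Tendsto (fun α : ℝ => volume ((g '' J) \ goodValues J S rot g α d)) (𝓝[>] 0) (𝓝 0) := by
  have hgood : ∀ α, (g '' J) \ goodValues J S rot g α d = g '' (J \ regularParams J S rot g α d) := fun α => by
    unfold goodValues
    rw [sdiff_sdiff_cancel_left (image_mono sdiff_subset)]
  simp only [hgood]
  set P := S ∪ {a ∈ J \ S | rot a = OnePoint.infty} with hP
  have hPJ : P ⊆ J := union_subset hSJ fun a ha => ha.1.1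
  -- Poles are isolated in `J \ S` but may accumulate at `S`, so countability is what can be used.
  have hPcount : P.Countable := by
    refine hS.countable.union ?_
    obtain ⟨t, hts, htc, hst⟩ := TopologicalSpace.countable_cover_nhdsWithin
      (s := {a ∈ J \ S | rot a = OnePoint.infty}) (f := fun a => {a}) fun a ha => by
        rcases hrot_an.isRigidOn a ha.1 OnePoint.infty with h | h
        · exact absurd h (hrot_an.isRigidOn.not_eventually_eq hrot_nc ha.1 _)
        · rw [mem_nhdsWithin_iff_eventually]
          filter_upwards [eventually_nhdsWithin_iff.1 h] with b hb hbP
          by_contra hba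
          exact hb ⟨hbP.1, hba⟩ hbP.2
    exact htc.mono (by simpa using hst)
  have hPc : IsCompact P := by
    refine hJ.of_isClosed_subset (isClosed_of_closure_subset fun a ha => ?_) hPJ
    have haJ : a ∈ J := hJ.isClosed.closure_subset_iff.2 hPJ ha
    by_contra haP
    have ha' : a ∈ J \ S ∧ rot a ≠ OnePoint.infty :=
      ⟨⟨haJ, fun h => haP (Or.inl h)⟩, fun h => haP (Or.inr ⟨⟨haJ, fun h => haP (Or.inl h)⟩, h⟩)⟩
    obtain ⟨G, U, -, -, hev, -⟩ := exists_local_model hrot_an hrot_nc hg_an hg_nc hS ha'.1 ha'.2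
    rw [mem_closure_iff_frequently] at ha
    obtain ⟨b, hbP, hb⟩ := (ha.and_eventually (eventually_nhdsWithin_iff.1 hev)).exists
    have := hb (hPJ hbP)
    rcases hbP with h | h
    · exact this.1 h
    · exact OnePoint.coe_ne_infty _ (this.2.2.symm.trans h.2)
  have hgP : volume (g '' P) = 0 := (hPcount.image g).measure_zero _
  rw [ENNReal.tendsto_nhds_zero]
  intro ε hε
  obtain ⟨O, hPO, hO, hOε⟩ := Set.exists_isOpen_lt_of_lt (g '' P) (ε / 2)
    (by rw [hgP]; exact ENNReal.half_pos hε.ne')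
  obtain ⟨O', hO', hOO'⟩ := continuousOn_iff'.1 hg_cont O hO
  have hrest : IsCompact (J \ O') := hJ.diff hO'
  have hrestP : ∀ a ∈ J \ O', a ∉ P := fun a ha haP => by
    have : a ∈ g ⁻¹' O ∩ J := ⟨hPO (mem_image_of_mem g haP), ha.1⟩
    rw [hOO'] at this
    exact ha.2 this.1
  have hlim : Tendsto (fun α => volume (g '' ((J \ O') \ regularParams J S rot g α d))) (𝓝[>] 0) (𝓝 0) := by
    refine hrest.induction_on (p := fun A => Tendsto
      (fun α => volume (g '' (A \ regularParams J S rot g α d))) (𝓝[>] 0) (𝓝 0)) (by simp) ?_ ?_ ?_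
    · intro A B hAB hB
      exact tendsto_of_tendsto_of_tendsto_of_le_of_le tendsto_const_nhds hB (fun _ => bot_le)
        fun α => measure_mono (image_mono (sdiff_subset_sdiff_left hAB))
    · intro A B hA hB
      have := hA.add hB
      rw [add_zero] at this
      refine tendsto_of_tendsto_of_tendsto_of_le_of_le tendsto_const_nhds this (fun _ => bot_le)
        fun α => ?_
      simp only
      rw [union_sdiff_distrib, image_union]
      exact measure_union_le _ _
    · intro a ha
      have haP := hrestP a ha
      have haJS : a ∈ J \ S := ⟨ha.1, fun h => haP (Or.inl h)⟩
      obtain ⟨I, hI, hIlim⟩ := tendsto_volume_image_diff_regularParams_local hJ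
        (uniqueDiffOn_of_nonconstantOnComponents hJo hg_nc ⟨a, haJS⟩) hrot_an hrot_nc hg_an hg_nc hS hd
        haJS (fun h => haP (Or.inr ⟨haJS, h⟩))
      exact ⟨I, nhdsWithin_mono a sdiff_subset hI, hIlim⟩
  filter_upwards [(ENNReal.tendsto_nhds_zero.1 hlim) (ε / 2) (ENNReal.half_pos hε.ne')] with α hα
  calc volume (g '' (J \ regularParams J S rot g α d))
      ≤ volume (O ∪ g '' ((J \ O') \ regularParams J S rot g α d)) := by
        refine measure_mono ?_
        rintro _ ⟨a, ⟨haJ, hareg⟩, rfl⟩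
        by_cases haO : a ∈ O'
        · left
          have : a ∈ g ⁻¹' O ∩ J := by rw [hOO']; exact ⟨haO, haJ⟩
          exact this.1
        · exact Or.inr ⟨a, ⟨⟨haJ, haO⟩, hareg⟩, rfl⟩
    _ ≤ volume O + volume (g '' ((J \ O') \ regularParams J S rot g α d)) := measure_union_le _ _
    _ ≤ ε / 2 + ε / 2 := by gcongr
    _ = ε := ENNReal.add_halves ε

end LocalModel

/-! ### The limit of the averages and its range -/

section TorusLimit

variable {Q : (Fin 2 → ℝ) → ℝ}

theorem lineAverage_periodic (hper : ∀ (x : Fin 2 → ℝ) (k : Fin 2 → ℤ),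
    Q (fun i => x i + 2 * Real.pi * k i) = Q x) (w : Fin 2 → ℝ) (T : ℝ) (x : Fin 2 → ℝ)
    (k : Fin 2 → ℤ) : lineAverage Q w T (fun i => x i + 2 * Real.pi * k i) = lineAverage Q w T x := by
  simp only [lineAverage]
  congr 2
  funext t
  rw [← hper (x + t • w) k]
  congr 1
  funext i
  simp only [Pi.add_apply, Pi.smul_apply, smul_eq_mul]
  ring

theorem range_eq_image_torusBox {l : (Fin 2 → ℝ) → ℝ} (hper : ∀ (x : Fin 2 → ℝ) (k : Fin 2 → ℤ),
    l (fun i => x i + 2 * Real.pi * k i) = l x) : range l = l '' torusBox := by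
  refine Subset.antisymm ?_ (image_subset_range _ _)
  rintro _ ⟨x, rfl⟩
  obtain ⟨k, hk⟩ := exists_add_two_pi_mem_torusBox x
  exact ⟨_, hk, hper x k⟩

theorem isCompact_range_of_periodic {l : (Fin 2 → ℝ) → ℝ} (hl : Continuous l)
    (hper : ∀ (x : Fin 2 → ℝ) (k : Fin 2 → ℤ), l (fun i => x i + 2 * Real.pi * k i) = l x) :
    IsCompact (range l) := by
  rw [range_eq_image_torusBox hper]
  exact isCompact_torusBox.image hl

/-- A long average is a convex combination of values of a shorter one, so it never leaves the
interval of values of the latter. -/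
theorem lineAverage_nat_mul (hQ : Continuous Q) (w : Fin 2 → ℝ) (T : ℝ) {n : ℕ}
    (hn : 0 < n) (x : Fin 2 → ℝ) : lineAverage Q w (n * T) x =
      ∑ j ∈ Finset.range n, (n : ℝ)⁻¹ • lineAverage Q w T (x + (j * T) • w) := by
  have hn' : (0 : ℝ) < n := by exact_mod_cast hn
  have hint : ∀ a b : ℝ, IntervalIntegrable (fun t : ℝ => Q (x + t • w)) volume a b :=
    intervalIntegrable_line hQ w x
  have hsum := intervalIntegral.sum_integral_adjacent_intervals (a := fun j : ℕ => (j : ℝ) * T) (n := n)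
    (fun k _ => hint _ _)
  simp only [Nat.cast_zero, zero_mul] at hsum
  have hpiece : ∀ j : ℕ, lineAverage Q w T (x + (j * T) • w) =
      T⁻¹ * ∫ t in ((j : ℝ) * T)..((j + 1 : ℕ) : ℝ) * T, Q (x + t • w) := fun j => by
    have := intervalIntegral.integral_comp_add_right (a := 0) (b := T)
      (fun t : ℝ => Q (x + t • w)) ((j : ℝ) * T)
    rw [zero_add] at this
    have e : ((j + 1 : ℕ) : ℝ) * T = T + j * T := by push_cast; ring
    rw [e, ← this, lineAverage, smul_eq_mul]
    congr 2
    funext t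
    congr 1
    rw [add_smul, add_assoc, add_comm (t • w)]
  simp only [hpiece, smul_eq_mul, ← Finset.mul_sum]
  rw [hsum, lineAverage, smul_eq_mul, mul_inv, mul_assoc]

variable (hQ : Continuous Q) (hper : ∀ (x : Fin 2 → ℝ) (k : Fin 2 → ℤ),
  Q (fun i => x i + 2 * Real.pi * k i) = Q x)
include hQ hper

/-- The line averages converge, and the range of the limit is the intersection of the ranges of the
averages. -/
theorem exists_lineAverage_limit (w : Fin 2 → ℝ) : ∃ l : (Fin 2 → ℝ) → ℝ,
    (∀ x, Tendsto (fun T => lineAverage Q w T x) atTop (𝓝 (l x))) ∧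
    ⋂ T ∈ Ici (1 : ℝ), range (lineAverage Q w T) = range l := by
  have hlim : ∀ x, ∃ y, Tendsto (fun T => lineAverage Q w T x) atTop (𝓝 y) := fun x => by
    refine cauchySeq_tendsto_of_complete (Metric.cauchySeq_iff.2 fun ε hε => ?_)
    obtain ⟨T₀, -, h⟩ := lineAverage_cauchy hQ hper w (half_pos hε)
    refine ⟨T₀, fun T hT T' hT' => ?_⟩
    rw [Real.dist_eq]
    linarith [h T hT T' hT' x]
  choose l hl using hlim
  have hunif : ∀ ε > 0, ∃ T₀ > 0, ∀ T ≥ T₀, ∀ x, |lineAverage Q w T x - l x| ≤ ε := fun ε hε => by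
    obtain ⟨T₀, hT₀, h⟩ := lineAverage_cauchy hQ hper w hε
    refine ⟨T₀, hT₀, fun T hT x => ?_⟩
    exact le_of_tendsto ((tendsto_const_nhds.sub (hl x)).abs)
      ((eventually_ge_atTop T₀).mono fun T' hT' => h T hT T' hT' x)
  have hlper : ∀ (x : Fin 2 → ℝ) (k : Fin 2 → ℤ), l (fun i => x i + 2 * Real.pi * k i) = l x :=
    fun x k => tendsto_nhds_unique (hl _) (by simpa only [lineAverage_periodic hper] using hl x)
  have hlc : Continuous l := by
    have hu : TendstoUniformly (fun T => lineAverage Q w T) l atTop := by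
      rw [Metric.tendstoUniformly_iff]
      intro ε hε
      obtain ⟨T₀, -, h⟩ := hunif (ε / 2) (half_pos hε)
      filter_upwards [eventually_ge_atTop T₀] with T hT x
      rw [dist_comm, Real.dist_eq]
      linarith [h T hT x]
    exact hu.continuous (Frequently.of_forall fun T => continuous_lineAverage hQ w T)
  refine ⟨l, hl, Subset.antisymm ?_ ?_⟩
  · intro y hy
    rw [← (isCompact_range_of_periodic hlc hlper).isClosed.closure_eq, Metric.mem_closure_iff]
    intro ε hε
    obtain ⟨T₀, -, h⟩ := hunif (ε / 2) (half_pos hε)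
    obtain ⟨x, rfl⟩ := mem_iInter₂.1 hy (max T₀ 1) (mem_Ici.2 (le_max_right _ _))
    refine ⟨l x, mem_range_self x, ?_⟩
    rw [Real.dist_eq]
    linarith [h (max T₀ 1) (le_max_left _ _) x]
  · rintro _ ⟨x, rfl⟩
    rw [mem_iInter₂]
    intro T hT
    have hT0 : (0 : ℝ) < T := lt_of_lt_of_le one_pos hT
    have hc := continuous_lineAverage hQ w T
    have hclosed : IsClosed (range (lineAverage Q w T)) :=
      (isCompact_range_of_periodic hc (lineAverage_periodic hper w T)).isClosed
    -- The averages over the times `n * T` lie in this closed interval, hence so does their limit.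
    have hconv : Convex ℝ (range (lineAverage Q w T)) :=
      (isPreconnected_range hc).ordConnected.convex
    have htend : Tendsto (fun n : ℕ => lineAverage Q w (n * T) x) atTop (𝓝 (l x)) :=
      (hl x).comp (tendsto_natCast_atTop_atTop.atTop_mul_const hT0)
    refine hclosed.mem_of_tendsto htend ?_
    filter_upwards [eventually_gt_atTop 0] with n hn
    rw [lineAverage_nat_mul hQ w T hn]
    have hn' : (n : ℝ) ≠ 0 := by exact_mod_cast hn.ne'
    refine hconv.sum_mem (fun _ _ => by positivity) ?_ fun j _ => mem_range_self _
    simp [hn']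

end TorusLimit

/-! ### `Q_∞` on the regular leaves -/

namespace ActionAngleChart

variable {M : Type*} [TopologicalSpace M] [ChartedSpace Plane M] [IsManifold 𝓘(ℝ, Plane) ω M]
  {p f : Cotangent M → ℝ} {a₀ : ℝ} (c : ActionAngleChart p f a₀)

theorem connectedComponentIn_leaf {a : ℝ} (ha : a ∈ c.V ∩ leafParams p f) {z : Cotangent M}
    (hz : z ∈ leaf p f a) : connectedComponentIn (leaf p f a) z = leaf p f a := by
  refine IsPreconnected.connectedComponentIn ?_ hz
  rw [c.leaf_eq a ha]
  exact isPreconnected_range (c.continuous_κ_left (c.action_mem a ha))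

/-- A regular leaf is a continuous image of the plane, hence connected, and the union over its
components has one term. -/
theorem QInfty_eq [T2Space M] (hp : ContMDiff phaseI 𝓘(ℝ, ℝ) ω p) (q : Cotangent M → ℝ) {a : ℝ}
    (ha : a ∈ c.V ∩ leafParams p f) :
    QInfty p f q a = ⋂ T ∈ Ici (1 : ℝ),
      range (lineAverage (fun x => q (c.κ (x, c.action a))) (c.frequencyVector a) T) := by
  have himage : ∀ T : ℝ, flowAverage p q T '' leaf p f a =
      range (lineAverage (fun x => q (c.κ (x, c.action a))) (c.frequencyVector a) T) := fun T => by
    rw [c.leaf_eq a ha, ← range_comp]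
    congr 1
    funext x
    exact c.flowAverage_κ hp q x (c.action_mem a ha) T
  have hne : c.κ (0, c.action a) ∈ leaf p f a := by
    rw [c.leaf_eq a ha]; exact mem_range_self _
  unfold QInfty
  simp only [← himage]
  refine Subset.antisymm (iUnion₂_subset fun z hz => ?_) fun y hy => mem_iUnion₂.2 ⟨_, hne, ?_⟩
  · rw [c.connectedComponentIn_leaf ha hz]
  · rwa [c.connectedComponentIn_leaf ha hne]

variable {q : Cotangent M → ℝ}

theorem continuous_comp_κ (hq : Continuous q) {ξ : Fin 2 → ℝ} (hξ : ξ ∈ c.B) :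
    Continuous fun x => q (c.κ (x, ξ)) := hq.comp (c.continuous_κ_left hξ)

theorem comp_κ_periodic (q : Cotangent M → ℝ) {ξ : Fin 2 → ℝ} (hξ : ξ ∈ c.B) (x : Fin 2 → ℝ)
    (k : Fin 2 → ℤ) : q (c.κ (fun i => x i + 2 * Real.pi * k i, ξ)) = q (c.κ (x, ξ)) := by
  rw [c.κ_periodic x hξ k]

theorem exists_limit_and_QInfty_eq [T2Space M] (hp : ContMDiff phaseI 𝓘(ℝ, ℝ) ω p) (hq : Continuous q)
    {a : ℝ} (ha : a ∈ c.V ∩ leafParams p f) : ∃ l : Cotangent M → ℝ,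
      (∀ z ∈ leaf p f a, Tendsto (fun T => flowAverage p q T z) atTop (𝓝 (l z))) ∧
      QInfty p f q a = l '' leaf p f a := by
  have hB := c.action_mem a ha
  obtain ⟨l, hl, hrange⟩ := exists_lineAverage_limit (c.continuous_comp_κ hq hB)
    (c.comp_κ_periodic q hB) (c.frequencyVector a)
  have hlim : ∀ x, Tendsto (fun T => flowAverage p q T (c.κ (x, c.action a))) atTop (𝓝 (l x)) := fun x => by
    simpa only [c.flowAverage_κ hp q x hB] using hl x
  -- Defining the limit at the point `z` avoids inverting `κ`, which is not injective in the angles.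
  refine ⟨fun z => limUnder atTop fun T => flowAverage p q T z, fun z hz => ?_, ?_⟩
  · rw [c.leaf_eq a ha] at hz
    obtain ⟨x, rfl⟩ := hz
    exact tendsto_nhds_limUnder ⟨_, hlim x⟩
  · rw [c.QInfty_eq hp q ha, hrange, c.leaf_eq a ha, ← range_comp]
    congr 1
    funext x
    exact (hlim x).limUnder_eq.symm

/-- Translations of the angles preserve the mean, so each average over a time `T ≥ 1` has the same
mean as `q` and attains it. -/
theorem torusAverage_mem_QInfty [T2Space M] (hp : ContMDiff phaseI 𝓘(ℝ, ℝ) ω p) (hq : Continuous q)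
    {a : ℝ} (ha : a ∈ c.V ∩ leafParams p f) : c.torusAverage q a ∈ QInfty p f q a := by
  have hB := c.action_mem a ha
  rw [c.QInfty_eq hp q ha, mem_iInter₂]
  intro T hT
  obtain ⟨x, hx⟩ := exists_lineAverage_eq_mean (c.continuous_comp_κ hq hB)
    (c.comp_κ_periodic q hB) (c.frequencyVector a) (lt_of_lt_of_le one_pos hT)
  exact ⟨x, hx⟩

/-- `Q_∞` is contained in the range of every single average with `T ≥ 1`, so one favorable time
suffices. -/
theorem diam_QInfty_le [T2Space M] (hp : ContMDiff phaseI 𝓘(ℝ, ℝ) ω p) (q : Cotangent M → ℝ) {a : ℝ}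
    (ha : a ∈ c.V ∩ leafParams p f) {T D : ℝ} (hT : 1 ≤ T)
    (h : ∀ x y, |lineAverage (fun x => q (c.κ (x, c.action a))) (c.frequencyVector a) T x -
      lineAverage (fun x => q (c.κ (x, c.action a))) (c.frequencyVector a) T y| ≤ D) :
    Metric.diam (QInfty p f q a) ≤ D := by
  refine Metric.diam_le_of_forall_dist_le ((abs_nonneg _).trans (h 0 0)) fun y hy y' hy' => ?_
  rw [c.QInfty_eq hp q ha, mem_iInter₂] at hy hy'
  obtain ⟨x, rfl⟩ := hy T hT
  obtain ⟨x', rfl⟩ := hy' T hT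
  exact h x x'

theorem diam_QInfty_eq_zero_of_nonresonant [T2Space M] (hp : ContMDiff phaseI 𝓘(ℝ, ℝ) ω p)
    (hq : Continuous q) {a : ℝ} (ha : a ∈ c.V ∩ leafParams p f)
    (hw : ∀ k : Fin 2 → ℤ, ∑ i, k i * c.frequencyVector a i = 0 → k = 0) :
    Metric.diam (QInfty p f q a) = 0 := by
  refine le_antisymm (le_of_forall_pos_le_add fun ε hε => ?_) Metric.diam_nonneg
  have hB := c.action_mem a ha
  obtain ⟨T₀, -, h⟩ := lineAverage_osc (c.continuous_comp_κ hq hB) (c.comp_κ_periodic q hB) hw hε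
  rw [zero_add]
  exact c.diam_QInfty_le hp q ha (le_max_right T₀ 1) (h _ (le_max_left _ _))

end ActionAngleChart

/-! ### Passage to the degenerate leaves -/

section Degenerate

variable {M : Type*} [TopologicalSpace M] [T2Space M] [ChartedSpace Plane M]
  [IsManifold 𝓘(ℝ, Plane) ω M] {p f q : Cotangent M → ℝ}

omit [T2Space M] in
theorem isCompact_leaf (hcompact : IsCompact (p ⁻¹' {0})) (hf : Continuous f) (s : ℝ) :
    IsCompact (leaf p f s) :=
  hcompact.inter_right (isClosed_singleton.preimage hf)

/-- A point that is a limit of points of connected leaves containing points tending to `z` belongs to the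
component of `z`. -/
theorem mem_connectedComponentIn_leaf_of_tendsto (hcompact : IsCompact (p ⁻¹' {0})) (hf : Continuous f)
    {s : ℝ} {l : Filter ℝ} [l.NeBot] (hl : l ≤ 𝓝 s) (hconn : ∀ᶠ a in l, IsPreconnected (leaf p f a))
    {z z' : ℝ → Cotangent M} {y y' : Cotangent M} (hz : ∀ᶠ a in l, z a ∈ leaf p f a)
    (hz' : ∀ᶠ a in l, z' a ∈ leaf p f a) (hy : Tendsto z l (𝓝 y)) (hy' : Tendsto z' l (𝓝 y'))
    (hys : y ∈ leaf p f s) (hys' : y' ∈ leaf p f s) :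
    y' ∈ connectedComponentIn (leaf p f s) y := by
  by_contra hnot
  have : CompactSpace (leaf p f s) := isCompact_iff_compactSpace.1 (isCompact_leaf hcompact hf s)
  -- In a compact Hausdorff space components are intersections of clopen sets, so a clopen set
  -- separates `y'` from `y` inside the leaf.
  rw [connectedComponentIn_eq_image hys, connectedComponent_eq_iInter_isClopen] at hnot
  have hex : ∃ Z : Set (leaf p f s), IsClopen Z ∧ ⟨y, hys⟩ ∈ Z ∧ ⟨y', hys'⟩ ∉ Z := by
    by_contra hno
    push Not at hno
    exact hnot ⟨⟨y', hys'⟩, mem_iInter.2 fun Z => hno Z.1 Z.2.1 Z.2.2, rfl⟩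
  obtain ⟨Z, hZ, hyZ, hyZ'⟩ := hex
  have hA : IsCompact (Subtype.val '' Z) := hZ.isClosed.isCompact.image continuous_subtype_val
  have hB : IsCompact (Subtype.val '' Zᶜ) := hZ.compl.isClosed.isCompact.image continuous_subtype_val
  have hdisj : Disjoint (Subtype.val '' Z) (Subtype.val '' Zᶜ) :=
    (disjoint_image_iff Subtype.val_injective).2 disjoint_compl_right
  obtain ⟨U, V, hU, hV, hAU, hBV, hUV⟩ := SeparatedNhds.of_isCompact_isCompact hA hB hdisj
  have hrest : IsCompact (p ⁻¹' {0} \ (U ∪ V)) := hcompact.diff (hU.union hV)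
  -- The part of the energy surface outside `U ∪ V` is compact and misses `Λ_s`. Leaves with
  -- parameter near `s` miss it too, so they lie in `U ∪ V`. A connected one cannot meet both
  -- disjoint open sets.
  have hs : s ∉ f '' (p ⁻¹' {0} \ (U ∪ V)) := by
    rintro ⟨x, ⟨hx, hxUV⟩, hfx⟩
    have hxs : x ∈ leaf p f s := ⟨hx, hfx⟩
    by_cases hxZ : (⟨x, hxs⟩ : leaf p f s) ∈ Z
    · exact hxUV (Or.inl (hAU ⟨_, hxZ, rfl⟩))
    · exact hxUV (Or.inr (hBV ⟨⟨x, hxs⟩, hxZ, rfl⟩))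
  have hev : ∀ᶠ a in l, leaf p f a ⊆ U ∪ V := by
    filter_upwards [hl ((hrest.image hf).isClosed.isOpen_compl.mem_nhds hs)] with a ha x hx
    by_contra hxUV
    exact ha ⟨x, ⟨hx.1, hxUV⟩, hx.2⟩
  have h1 : ∀ᶠ a in l, z a ∈ U := hy (hU.mem_nhds (hAU ⟨_, hyZ, rfl⟩))
  have h2 : ∀ᶠ a in l, z' a ∈ V := hy' (hV.mem_nhds (hBV ⟨_, hyZ', rfl⟩))
  obtain ⟨a, ha1, ha2, ha3, ha4, ha5, ha6⟩ :=
    (hconn.and (hz.and (hz'.and (hev.and (h1.and h2))))).exists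
  obtain ⟨x, -, hxU, hxV⟩ := ha1 U V hU hV ha4 ⟨_, ha2, ha5⟩ ⟨_, ha3, ha6⟩
  exact Set.disjoint_left.1 hUV hxU hxV

/-- At a limit of parameters of connected leaves the limit of the averages belongs to `Q_∞`. -/
theorem mem_QInfty_of_mem_closure (hp : ContMDiff phaseI 𝓘(ℝ, ℝ) ω p) (hcompact : IsCompact (p ⁻¹' {0}))
    (hf : Continuous f) (hq : Continuous q) {g : ℝ → ℝ} {s : ℝ} {D : Set ℝ}
    (hD : D ⊆ leafParams p f) (hs : s ∈ closure D) (hg : ContinuousWithinAt g D s)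
    (hconn : ∀ a ∈ D, IsPreconnected (leaf p f a))
    (hmem : ∀ a ∈ D, g a ∈ QInfty p f q a) : g s ∈ QInfty p f q s := by
  have hne : (𝓝[D] s).NeBot := mem_closure_iff_nhdsWithin_neBot.1 hs
  -- Along an ultrafilter the points chosen for the different `T` all converge over the same
  -- parameters `a`. This allows limits belonging to different `T` to be compared.
  set l : Ultrafilter ℝ := Ultrafilter.of (𝓝[D] s) with hl
  have hlD : (l : Filter ℝ) ≤ 𝓝[D] s := Ultrafilter.of_le _
  have hls : (l : Filter ℝ) ≤ 𝓝 s := hlD.trans nhdsWithin_le_nhds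
  have hDl : ∀ᶠ a in (l : Filter ℝ), a ∈ D := hlD self_mem_nhdsWithin
  have hMne : Nonempty (Cotangent M) := by
    obtain ⟨b, hb⟩ := closure_nonempty_iff.1 ⟨s, hs⟩
    obtain ⟨x, -⟩ := hD hb
    exact ⟨x⟩
  have hpt : ∀ T ≥ (1 : ℝ), ∀ a, ∃ z, a ∈ D → z ∈ leaf p f a ∧ flowAverage p q T z = g a := by
    intro T hT a
    by_cases ha : a ∈ D
    · have h1 := hmem a ha
      unfold QInfty at h1
      rw [mem_iUnion₂] at h1
      obtain ⟨z, -, hz2⟩ := h1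
      obtain ⟨y, hy, hy'⟩ := mem_iInter₂.1 hz2 T hT
      exact ⟨y, fun _ => ⟨connectedComponentIn_subset _ _ hy, hy'⟩⟩
    · exact ⟨hMne.some, fun h => absurd h ha⟩
  choose! ζ hζ using hpt
  have hlim : ∀ T ≥ (1 : ℝ), ∃ y, Tendsto (ζ T) l (𝓝 y) ∧ y ∈ leaf p f s ∧
      flowAverage p q T y = g s := by
    intro T hT
    have hev : ∀ᶠ a in (l : Filter ℝ), ζ T a ∈ p ⁻¹' {0} :=
      hDl.mono fun a ha => (hζ T hT a ha).1.1
    obtain ⟨y, hy, hle⟩ := hcompact.ultrafilter_le_nhds (l.map (ζ T)) (le_principal_iff.2 hev)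
    have htend : Tendsto (ζ T) l (𝓝 y) := hle
    have hfy : f y = s := by
      refine tendsto_nhds_unique ((hf.tendsto y).comp htend) (Tendsto.congr' ?_ hls)
      exact hDl.mono fun a ha => ((hζ T hT a ha).1.2).symm
    refine ⟨y, htend, ⟨hy, hfy⟩, ?_⟩
    have hA : Tendsto (fun a => flowAverage p q T (ζ T a)) l (𝓝 (flowAverage p q T y)) :=
      ((continuousOn_flowAverage hp hcompact hq T) y hy).tendsto.comp
        (tendsto_nhdsWithin_iff.2 ⟨htend, hev⟩)
    refine tendsto_nhds_unique hA (Tendsto.congr' ?_ (hg.tendsto.mono_left hlD))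
    exact hDl.mono fun a ha => (hζ T hT a ha).2.symm
  -- The component of the limit for `T = 1` contains the limits for all `T`, as required by the
  -- intersection in `Q_∞`.
  obtain ⟨y, hy, hys, -⟩ := hlim 1 le_rfl
  unfold QInfty
  refine mem_iUnion₂.2 ⟨y, hys, mem_iInter₂.2 fun T hT => ?_⟩
  obtain ⟨y', hy', hys', hval⟩ := hlim T hT
  refine ⟨y', ?_, hval⟩
  exact mem_connectedComponentIn_leaf_of_tendsto hcompact hf hls (hDl.mono hconn)
    (hDl.mono fun a ha => (hζ 1 le_rfl a ha).1) (hDl.mono fun a ha => (hζ T hT a ha).1) hy hy' hys hys'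

/-- `Metric.diam` is `0` on unbounded sets, so boundedness is needed before the diameter controls
distances. -/
theorem isBounded_QInfty (hp : ContMDiff phaseI 𝓘(ℝ, ℝ) ω p) (hcompact : IsCompact (p ⁻¹' {0}))
    (hq : Continuous q) (a : ℝ) : Bornology.IsBounded (QInfty p f q a) := by
  have h := (hcompact.image_of_continuousOn (continuousOn_flowAverage hp hcompact hq 1)).isBounded
  refine h.subset ?_
  unfold QInfty
  refine iUnion₂_subset fun z hz y hy => ?_
  obtain ⟨x, hx, rfl⟩ := mem_iInter₂.1 hy 1 (mem_Ici.2 le_rfl)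
  exact ⟨x, (connectedComponentIn_subset _ _ hx).1, rfl⟩

end Degenerate

/-! ### Length of `Q_∞` near a Diophantine torus -/

section Resonance

variable {M : Type*} [TopologicalSpace M] [T2Space M] [ChartedSpace Plane M]
  [IsManifold 𝓘(ℝ, Plane) ω M] {p f : Cotangent M → ℝ}

/-- The exponent `N ≥ 2P` buys the square on the right, which beats the linear growth of `g`. -/
theorem inv_pow_le_of_diophantine {n : ℕ} (hn : 0 < n) {P α e : ℝ} (hα : 0 < α) {N : ℕ}
    (hN : 2 * P ≤ N) (h : α / (n : ℝ) ^ P ≤ e) : ((n : ℝ)⁻¹) ^ N ≤ (e / α) ^ 2 := by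
  have hn1 : (1 : ℝ) ≤ n := by exact_mod_cast hn
  have hn0 : (0 : ℝ) < n := by linarith
  have hpos : (0 : ℝ) < (n : ℝ) ^ P := Real.rpow_pos_of_pos hn0 P
  calc ((n : ℝ)⁻¹) ^ N = ((n : ℝ) ^ (N : ℝ))⁻¹ := by rw [Real.rpow_natCast, inv_pow]
    _ ≤ ((n : ℝ) ^ (2 * P))⁻¹ := by
        apply inv_anti₀ (Real.rpow_pos_of_pos hn0 _)
        exact Real.rpow_le_rpow_of_exponent_le hn1 hN
    _ = (((n : ℝ) ^ P)⁻¹) ^ 2 := by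
        rw [mul_comm, Real.rpow_mul hn0.le, inv_pow]
        norm_cast
    _ ≤ (e / α) ^ 2 := by
        gcongr
        rw [le_div_iff₀ hα, inv_mul_eq_div]
        exact h

/-- A nearby torus with irrational slope contributes length zero. With slope `r` the length is
`O(r.den ^ (-(N + 1)))`. Since `b` is Diophantine and `rot` Lipschitz, `r.den` is large in terms of
`1 / |a - b|`. The resulting quadratic bound lies below `ε * |a - b|` at short distance. -/
theorem exists_diam_QInfty_le_near (hp : ContMDiff phaseI 𝓘(ℝ, ℝ) ω p) {S : Set ℝ} (hSfin : S.Finite)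
    {rot : ℝ → OnePoint ℝ} {g : ℝ → ℝ} {F : Set (Cotangent M → ℝ)} {α d : ℝ}
    (hrot_an : ProjAnalyticOn rot (leafParams p f \ S))
    (hrot_nc : NonconstantOnComponents rot (leafParams p f \ S))
    (hg_an : AnalyticOn ℝ g (leafParams p f \ S))
    (hg_nc : NonconstantOnComponents g (leafParams p f \ S))
    (hF_an : ∀ q ∈ F, ContMDiff phaseI 𝓘(ℝ, ℝ) ω q)
    (hF_unif : UniformlyAnalyticOn F (p ⁻¹' {0})) (hα : 0 < α) {a₁ : ℝ}
    (ha₁ : a₁ ∈ leafParams p f \ S) (hfin : rot a₁ ≠ OnePoint.infty) (c : ActionAngleChart p f a₁)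
    (hrot : ∀ᶠ a in 𝓝[leafParams p f \ S] a₁, rot a = c.rotationNumber a) {ε : ℝ} (hε : 0 < ε) :
    ∃ δ > 0, ∀ q ∈ F, ∀ a ∈ leafParams p f, |a - a₁| < δ →
      ∀ b ∈ regularParams (leafParams p f) S rot g α d, |b - a₁| < δ →
        Metric.diam (QInfty p f q a) ≤ ε * |a - b| := by
  set J := leafParams p f with hJ
  obtain ⟨G, U, -, hU, hev, -⟩ := exists_local_model hrot_an hrot_nc hg_an hg_nc hSfin ha₁ hfin
  obtain ⟨K, t, ht, hK⟩ := hU.hasStrictDerivAt.hasStrictFDerivAt.exists_lipschitzOnWith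
  have hnhds : 𝓝[J \ S] a₁ = 𝓝[J] a₁ := by
    rw [sdiff_eq]
    exact nhdsWithin_inter_of_mem' (nhdsWithin_le_nhds (hSfin.isClosed.isOpen_compl.mem_nhds ha₁.2))
  rw [hnhds] at hrot
  have haV : a₁ ∈ c.V ∩ J := ⟨mem_of_mem_nhds c.V_mem, ha₁.1⟩
  have hVJ : 𝓝[c.V ∩ J] a₁ = 𝓝[J] a₁ := by
    rw [inter_comm]
    exact nhdsWithin_inter_of_mem' (nhdsWithin_le_nhds c.V_mem)
  obtain ⟨N, hN⟩ := exists_nat_ge (2 * (2 + d))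
  obtain ⟨C, hC⟩ := c.exists_bound_angle_line hF_unif hF_an (c.action_mem a₁ haV) (fun x => by
    have : c.κ (x, c.action a₁) ∈ leaf p f a₁ := by
      rw [c.leaf_eq a₁ haV]; exact mem_range_self x
    exact this.1) (N + 1)
  have hact : Tendsto c.action (𝓝[J] a₁) (𝓝 (c.action a₁)) := by
    have := (c.analytic_action a₁ haV).continuousWithinAt
    rwa [ContinuousWithinAt, hVJ] at this
  have hall : ∀ᶠ a in 𝓝[J] a₁, (a ∉ S ∧ g a = G a ∧ rot a = (U a : OnePoint ℝ)) ∧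
      rot a = c.rotationNumber a ∧ a ∈ t ∧ a ∈ c.V ∧ ∀ q ∈ F, ∀ (x : Fin 2 → ℝ) (s : ℝ),
      |iteratedDeriv (N + 1) (fun s : ℝ => q (c.κ (x + s • Pi.single 1 1, c.action a))) s| ≤ C := by
    filter_upwards [hev, hrot, nhdsWithin_le_nhds ht, nhdsWithin_le_nhds c.V_mem, hact hC]
      with a h1 h2 h3 h4 h5 using ⟨h1, h2, h3, h4, h5⟩
  obtain ⟨δ₀, hδ₀, hball⟩ := Metric.eventually_nhds_iff_ball.1 (eventually_nhdsWithin_iff.1 hall)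
  -- The final estimate is `(B / 2) * |a - b| ^ 2`, and the choice of `δ` gives `|a - b| ≤ 2 * ε /
  -- (B + 1)`.
  set B := 4 * ((2 * Real.pi) ^ (N + 1) * |C| * (K / α) ^ 2) with hB
  have hB0 : 0 ≤ B := by positivity
  refine ⟨min δ₀ (ε / (B + 1)), lt_min hδ₀ (by positivity), ?_⟩
  intro q hq a haJ haδ b hb hbδ
  obtain ⟨⟨haS, -, haU⟩, harot, hat, haV', hbound⟩ := hball a (lt_of_lt_of_le haδ (min_le_left _ _)) haJ
  obtain ⟨⟨hbS, -, hbU⟩, -, hbt, -, -⟩ := hball b (lt_of_lt_of_le hbδ (min_le_left _ _)) hb.1.1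
  have haVJ : a ∈ c.V ∩ leafParams p f := ⟨haV', haJ⟩
  have hBa := c.action_mem a haVJ
  have hqc : Continuous q := (hF_an q hq).continuous
  have hratio : projRatio (c.frequency 1 a) (c.frequency 0 a) = (U a : OnePoint ℝ) := by
    rw [← haU, harot]; rfl
  have hf0 : c.frequency 0 a ≠ 0 := fun h => by
    rw [projRatio_eq_infty_iff.2 h] at hratio
    exact (OnePoint.infty_ne_coe _) hratio
  have hf1 : c.frequency 1 a = U a * c.frequency 0 a := by
    have := (projRatio_eq_coe_iff (Or.inr hf0)).1 hratio
    linarith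
  by_cases hirr : Irrational (U a)
  · rw [c.diam_QInfty_eq_zero_of_nonresonant hp hqc haVJ]
    · positivity
    intro k hk
    simp only [Fin.sum_univ_two, ActionAngleChart.frequencyVector, hf1] at hk
    have hk' : (k 0 : ℝ) + k 1 * U a = 0 := by
      have : ((k 0 : ℝ) + k 1 * U a) * c.frequency 0 a = 0 := by linarith
      exact (mul_eq_zero.1 this).resolve_right hf0
    have hk1 : k 1 = 0 := by
      by_contra h1
      have h1' : (k 1 : ℝ) ≠ 0 := by exact_mod_cast h1
      refine hirr ⟨-(k 0 : ℚ) / (k 1 : ℚ), ?_⟩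
      push_cast
      rw [div_eq_iff h1']
      linarith
    have hk0 : k 0 = 0 := by
      rw [hk1] at hk'
      simpa using hk'
    funext i
    fin_cases i
    · exact hk0
    · exact hk1
  · obtain ⟨r, hr⟩ := not_not.1 hirr
    obtain ⟨T, hT, hosc⟩ := exists_lineAverage_osc_le_of_rational (c.continuous_comp_κ hqc hBa)
      (c.comp_κ_periodic q hBa) (w := c.frequencyVector a) hf0 (r := r) (by rw [hr]; exact hf1)
      (fun x => c.contDiff_angle_line (hF_an q hq) hBa (N + 1) x (Pi.single 1 1))
      (fun x s => (hbound q hq x s).trans (le_abs_self C))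
    refine (c.diam_QInfty_le hp q haVJ hT hosc).trans ?_
    have hdio := hb.1.2.2.2.2 r.num r.den r.den_pos
    rw [hbU, finitePart_coe, ← Rat.cast_def, hr] at hdio
    have hlip : |U b - U a| ≤ K * |a - b| := by
      have := hK.dist_le_mul b hbt a hat
      rwa [Real.dist_eq, Real.dist_eq, abs_sub_comm b a] at this
    have hpow := inv_pow_le_of_diophantine r.den_pos hα (N := N + 1) (by push_cast; linarith)
      (hdio.trans hlip)
    have hab : |a - b| ≤ 2 * (ε / (B + 1)) := by
      have h1 := lt_of_lt_of_le haδ (min_le_right _ _)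
      have h2 := lt_of_lt_of_le hbδ (min_le_right _ _)
      have h3 := abs_sub_le a a₁ b
      rw [abs_sub_comm a₁ b] at h3
      linarith
    have hBε : B * (ε / (B + 1)) ≤ ε := by
      rw [← mul_div_assoc, div_le_iff₀ (by positivity)]
      nlinarith
    calc 2 * ((2 * Real.pi / r.den) ^ (N + 1) * |C|)
        = 2 * ((2 * Real.pi) ^ (N + 1) * |C|) * ((r.den : ℝ)⁻¹) ^ (N + 1) := by
          rw [div_eq_mul_inv, mul_pow]; ring
      _ ≤ 2 * ((2 * Real.pi) ^ (N + 1) * |C|) * (K * |a - b| / α) ^ 2 := by gcongr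
      _ = (B / 2) * |a - b| * |a - b| := by rw [hB]; ring
      _ ≤ (B / 2) * (2 * (ε / (B + 1))) * |a - b| := by gcongr
      _ = B * (ε / (B + 1)) * |a - b| := by ring
      _ ≤ ε * |a - b| := by gcongr

end Resonance

/-! ### Linear growth of `g` near the preimage of a good value -/

/-- If `g` is expanding near `a₁`, the distance of its values to a value `F₀` near `g(a₁)` is controlled by
the distance to a point of the preimage of `F₀`, or else to `a₁`. -/
theorem exists_expansion_point {J : Set ℝ} (hJ : J.OrdConnected) {g : ℝ → ℝ} (hg : ContinuousOn g J)
    {a₁ δ A : ℝ} (hA : A ≠ 0) (ha₁ : a₁ ∈ J) (hδ : 0 < δ)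
    (hexp : ∀ x ∈ J, ∀ y ∈ J, |x - a₁| < δ → |y - a₁| < δ →
      |g x - g y - A * (x - y)| ≤ |A| / 2 * |x - y|) :
    ∀ᶠ F₀ in 𝓝 (g a₁), ∃ b ∈ J, |b - a₁| < δ ∧ (g b = F₀ ∨ b = a₁) ∧
      ∀ a ∈ J, |a - a₁| < δ → |A| / 2 * |a - b| ≤ |g a - F₀| := by
  have hA0 : 0 < |A| := abs_pos.2 hA
  have hA2 : A * A = |A| * |A| := (abs_mul_abs_self A).symm
  have hlow : ∀ x ∈ J, ∀ y ∈ J, |x - a₁| < δ → |y - a₁| < δ → |A| / 2 * |x - y| ≤ |g x - g y| := by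
    intro x hx y hy hx' hy'
    have h1 := hexp x hx y hy hx' hy'
    have h2 := abs_sub_abs_le_abs_sub (A * (x - y)) (g x - g y)
    rw [abs_sub_comm (A * (x - y)), abs_mul] at h2
    linarith
  -- Multiplication by `A` makes the function increasing for either sign of the derivative, so that
  -- no separate cases are needed.
  have hmono : ∀ x ∈ J, ∀ y ∈ J, |x - a₁| < δ → |y - a₁| < δ → x ≤ y → A * g x ≤ A * g y := by
    intro x hx y hy hx' hy' hxy
    have h1 := hexp y hy x hx hy' hx'
    rw [abs_of_nonneg (sub_nonneg.2 hxy)] at h1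
    have h2 : |A * (g y - g x - A * (y - x))| ≤ |A| * (|A| / 2 * (y - x)) := by
      rw [abs_mul]; gcongr
    have h3 := (abs_le.1 h2).1
    have h4 : 0 ≤ |A| * |A| * (y - x) := by
      have := sub_nonneg.2 hxy
      positivity
    have h5 : A * (g y - g x - A * (y - x)) = A * g y - A * g x - |A| * |A| * (y - x) := by
      rw [← hA2]; ring
    rw [h5] at h3
    linarith
  have hself : |a₁ - a₁| < δ := by simpa using hδ
  -- Either `J` continues to the right of `a₁` and the intermediate value theorem gives a preimage,
  -- or `a₁` is the right end of `J`, locally.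
  have hright : ∀ᶠ F₀ in 𝓝 (g a₁), A * g a₁ < A * F₀ →
      (∃ b ∈ J, |b - a₁| < δ ∧ g b = F₀) ∨ ∀ a ∈ J, |a - a₁| < δ → a ≤ a₁ := by
    by_cases hr : ∃ r ∈ J, a₁ < r ∧ r < a₁ + δ
    · obtain ⟨r, hrJ, hr1, hr2⟩ := hr
      have hrδ : |r - a₁| < δ := by rw [abs_of_pos (by linarith)]; linarith
      have hlt : A * g a₁ < A * g r := by
        refine lt_of_le_of_ne (hmono a₁ ha₁ r hrJ hself hrδ hr1.le) fun h => ?_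
        have h1 := hlow r hrJ a₁ ha₁ hrδ hself
        rw [mul_left_cancel₀ hA h, sub_self, abs_zero] at h1
        have : 0 < |A| / 2 * |r - a₁| := mul_pos (by linarith) (abs_pos.2 (by linarith))
        linarith
      have hev : ∀ᶠ F₀ in 𝓝 (g a₁), A * F₀ < A * g r :=
        (continuous_const_mul A).continuousAt.eventually_lt continuousAt_const hlt
      filter_upwards [hev] with F₀ h1 h2
      left
      have hIcc : Icc a₁ r ⊆ J := hJ.out ha₁ hrJ
      obtain ⟨b, hb, hbF⟩ := intermediate_value_Icc hr1.le
        (continuousOn_const.mul (hg.mono hIcc) : ContinuousOn (fun x => A * g x) (Icc a₁ r))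
        ⟨h2.le, h1.le⟩
      refine ⟨b, hIcc hb, ?_, mul_left_cancel₀ hA hbF⟩
      rw [abs_of_nonneg (by linarith [hb.1])]; linarith [hb.2]
    · refine Eventually.of_forall fun F₀ _ => Or.inr fun a ha haδ => ?_
      by_contra h
      exact hr ⟨a, ha, not_le.1 h, by linarith [(abs_lt.1 haδ).2]⟩
  have hleft : ∀ᶠ F₀ in 𝓝 (g a₁), A * F₀ < A * g a₁ →
      (∃ b ∈ J, |b - a₁| < δ ∧ g b = F₀) ∨ ∀ a ∈ J, |a - a₁| < δ → a₁ ≤ a := by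
    by_cases hr : ∃ r ∈ J, r < a₁ ∧ a₁ - δ < r
    · obtain ⟨r, hrJ, hr1, hr2⟩ := hr
      have hrδ : |r - a₁| < δ := by rw [abs_of_neg (by linarith)]; linarith
      have hlt : A * g r < A * g a₁ := by
        refine lt_of_le_of_ne (hmono r hrJ a₁ ha₁ hrδ hself hr1.le) fun h => ?_
        have h1 := hlow r hrJ a₁ ha₁ hrδ hself
        rw [mul_left_cancel₀ hA h, sub_self, abs_zero] at h1
        have : 0 < |A| / 2 * |r - a₁| := mul_pos (by linarith) (abs_pos.2 (by linarith))
        linarith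
      have hev : ∀ᶠ F₀ in 𝓝 (g a₁), A * g r < A * F₀ :=
        continuousAt_const.eventually_lt (continuous_const_mul A).continuousAt hlt
      filter_upwards [hev] with F₀ h1 h2
      left
      have hIcc : Icc r a₁ ⊆ J := hJ.out hrJ ha₁
      obtain ⟨b, hb, hbF⟩ := intermediate_value_Icc hr1.le
        (continuousOn_const.mul (hg.mono hIcc) : ContinuousOn (fun x => A * g x) (Icc r a₁))
        ⟨h1.le, h2.le⟩
      refine ⟨b, hIcc hb, ?_, mul_left_cancel₀ hA hbF⟩
      rw [abs_sub_comm, abs_of_nonneg (by linarith [hb.2])]; linarith [hb.1]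
    · refine Eventually.of_forall fun F₀ _ => Or.inr fun a ha haδ => ?_
      by_contra h
      exact hr ⟨a, ha, not_le.1 h, by linarith [(abs_lt.1 haδ).1]⟩
  filter_upwards [hright, hleft] with F₀ h1 h2
  by_cases hpre : ∃ b ∈ J, |b - a₁| < δ ∧ g b = F₀
  · obtain ⟨b, hb, hbδ, rfl⟩ := hpre
    exact ⟨b, hb, hbδ, Or.inl rfl, fun a ha haδ => hlow a ha b hb haδ hbδ⟩
  refine ⟨a₁, ha₁, hself, Or.inr rfl, fun a ha haδ => (hlow a ha a₁ ha₁ haδ hself).trans ?_⟩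
  refine le_of_mul_le_mul_left ?_ hA0
  rw [← abs_mul, ← abs_mul, mul_sub, mul_sub]
  -- Without a preimage, `F₀` lies beyond the value at an end `a₁` of `J`. Then `g a₁` separates `g
  -- a` from `F₀`, so replacing `g a₁` by `F₀` only increases the distance.
  rcases lt_trichotomy (A * g a₁) (A * F₀) with h | h | h
  · have h3 := hmono a ha a₁ ha₁ haδ hself ((h1 h).resolve_left hpre a ha haδ)
    rw [abs_of_nonpos (by linarith), abs_of_nonpos (by linarith)]
    linarith
  · rw [h]
  · have h3 := hmono a₁ ha₁ a ha hself haδ ((h2 h).resolve_left hpre a ha haδ)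
    rw [abs_of_nonneg (by linarith), abs_of_nonneg (by linarith)]
    linarith

/-! ### Comparison of the length of `Q_∞` with `|g - F₀|` -/

section LowerBound

variable {M : Type*} [TopologicalSpace M] [T2Space M] [ChartedSpace Plane M]
  [IsManifold 𝓘(ℝ, Plane) ω M] {p f : Cotangent M → ℝ}

/-- Compactness of `J × K` reduces the claim to a neighborhood of each `(a₁, F₁)`. Off the graph of
`g` a small `σ` suffices. On the graph `a₁` is regular, and the quadratic smallness of the length
meets the linear growth of `|g - F₀|`. -/
theorem exists_diam_QInfty_le_half (hp : ContMDiff phaseI 𝓘(ℝ, ℝ) ω p) {S : Set ℝ} (hSfin : S.Finite)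
    {rot : ℝ → OnePoint ℝ} {g : ℝ → ℝ} {F : Set (Cotangent M → ℝ)} {α d : ℝ}
    (hJc : IsCompact (leafParams p f)) (hJo : (leafParams p f).OrdConnected)
    (chart : ∀ a ∈ leafParams p f \ S, ActionAngleChart p f a)
    (hrot : ∀ (a : ℝ) (ha : a ∈ leafParams p f \ S),
      ∀ᶠ a' in 𝓝[leafParams p f \ S] a, rot a' = (chart a ha).rotationNumber a')
    (hrot_an : ProjAnalyticOn rot (leafParams p f \ S))
    (hrot_nc : NonconstantOnComponents rot (leafParams p f \ S))
    (hg_an : AnalyticOn ℝ g (leafParams p f \ S)) (hg_cont : ContinuousOn g (leafParams p f))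
    (hg_nc : NonconstantOnComponents g (leafParams p f \ S))
    (hF_an : ∀ q ∈ F, ContMDiff phaseI 𝓘(ℝ, ℝ) ω q)
    (hF_unif : UniformlyAnalyticOn F (p ⁻¹' {0})) (hα : 0 < α) {K : Set ℝ} (hK : IsCompact K)
    (hKreg : ∀ a ∈ leafParams p f, g a ∈ K → a ∈ regularParams (leafParams p f) S rot g α d) :
    ∃ σ > 0, ∀ q ∈ F, ∀ a ∈ leafParams p f, ∀ F₀ ∈ K, Metric.diam (QInfty p f q a) ≤ σ →
      Metric.diam (QInfty p f q a) ≤ |g a - F₀| / 2 := by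
  suffices h : ∃ σ > 0, ∀ x ∈ leafParams p f ×ˢ K, ∀ q ∈ F, Metric.diam (QInfty p f q x.1) ≤ σ →
      Metric.diam (QInfty p f q x.1) ≤ |g x.1 - x.2| / 2 by
    obtain ⟨σ, hσ, h⟩ := h
    exact ⟨σ, hσ, fun q hq a ha F₀ hF₀ => h (a, F₀) ⟨ha, hF₀⟩ q hq⟩
  refine (hJc.prod hK).induction_on (p := fun A => ∃ σ > 0, ∀ x ∈ A, ∀ q ∈ F,
    Metric.diam (QInfty p f q x.1) ≤ σ → Metric.diam (QInfty p f q x.1) ≤ |g x.1 - x.2| / 2)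
    ⟨1, one_pos, by simp⟩ ?_ ?_ ?_
  · rintro A B hAB ⟨σ, hσ, h⟩
    exact ⟨σ, hσ, fun x hx => h x (hAB hx)⟩
  · rintro A B ⟨σ, hσ, h⟩ ⟨σ', hσ', h'⟩
    refine ⟨min σ σ', lt_min hσ hσ', fun x hx q hq hdiam => ?_⟩
    rcases hx with hx | hx
    · exact h x hx q hq (hdiam.trans (min_le_left _ _))
    · exact h' x hx q hq (hdiam.trans (min_le_right _ _))
  rintro ⟨a₁, F₁⟩ ⟨ha₁, hF₁⟩
  simp only at ha₁ hF₁
  have hcont : ContinuousWithinAt (fun x : ℝ × ℝ => |g x.1 - x.2|) (leafParams p f ×ˢ K) (a₁, F₁) := by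
    have h1 : ContinuousWithinAt (fun x : ℝ × ℝ => g x.1) (leafParams p f ×ˢ K) (a₁, F₁) :=
      ContinuousWithinAt.comp (g := g) (f := Prod.fst) (t := leafParams p f) (hg_cont a₁ ha₁)
        continuous_fst.continuousWithinAt (fun x hx => hx.1)
    exact (h1.sub continuous_snd.continuousWithinAt).abs
  by_cases heq : g a₁ = F₁
  swap
  · have hpos : 0 < |g a₁ - F₁| := abs_pos.2 (sub_ne_zero.2 heq)
    have hev : ∀ᶠ x in 𝓝[leafParams p f ×ˢ K] (a₁, F₁), |g a₁ - F₁| / 2 < |g x.1 - x.2| :=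
      hcont.eventually (lt_mem_nhds (half_lt_self hpos))
    refine ⟨_, hev, |g a₁ - F₁| / 4, by positivity, fun x hx q hq hdiam => hdiam.trans ?_⟩
    have : |g a₁ - F₁| / 2 < |g x.1 - x.2| := hx
    linarith
  subst heq
  have hreg := hKreg a₁ ha₁ hF₁
  have haJS : a₁ ∈ leafParams p f \ S := hreg.2.1
  have hfin : rot a₁ ≠ OnePoint.infty := hreg.1.2.2.1
  have hJu := uniqueDiffOn_of_nonconstantOnComponents hJo hg_nc ⟨a₁, haJS⟩
  obtain ⟨G, U, hG, hU, hev, -⟩ := exists_local_model hrot_an hrot_nc hg_an hg_nc hSfin haJS hfin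
  have hGα : α ≤ |deriv G a₁| :=
    ((mem_regularParams_iff_of_eventuallyEq hJu ha₁ hev hG.differentiableAt
      hU.differentiableAt).1 hreg).2.2.1
  set A := deriv G a₁ with hA
  have hA0 : 0 < |A| := hα.trans_le hGα
  -- `|A| / 4` is half of the expansion constant `|A| / 2` of `g`, which produces the factor `1 / 2`
  -- of the conclusion.
  obtain ⟨δ₂, hδ₂, hdiam⟩ := exists_diam_QInfty_le_near hp hSfin (d := d) hrot_an hrot_nc hg_an hg_nc hF_an
    hF_unif hα haJS hfin (chart a₁ haJS) (hrot a₁ haJS) (ε := |A| / 4) (by positivity)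
  have hstrict : ∀ᶠ x : ℝ × ℝ in 𝓝 (a₁, a₁), |G x.1 - G x.2 - A * (x.1 - x.2)| ≤ |A| / 2 * |x.1 - x.2| := by
    have := hG.hasStrictDerivAt.hasStrictFDerivAt.isLittleO.def (half_pos hA0)
    filter_upwards [this] with x hx
    simpa [mul_comm] using hx
  obtain ⟨δ₁, hδ₁, hball₁⟩ := Metric.eventually_nhds_iff_ball.1 hstrict
  obtain ⟨δ₃, hδ₃, hball₃⟩ := Metric.eventually_nhds_iff_ball.1 (eventually_nhdsWithin_iff.1 hev)
  set δ := min δ₁ (min δ₂ δ₃) with hδ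
  have hδ0 : 0 < δ := lt_min hδ₁ (lt_min hδ₂ hδ₃)
  have hδ1 : δ ≤ δ₁ := min_le_left _ _
  have hδ2 : δ ≤ δ₂ := (min_le_right _ _).trans (min_le_left _ _)
  have hδ3 : δ ≤ δ₃ := (min_le_right _ _).trans (min_le_right _ _)
  have hexp : ∀ x ∈ leafParams p f, ∀ y ∈ leafParams p f, |x - a₁| < δ → |y - a₁| < δ →
      |g x - g y - A * (x - y)| ≤ |A| / 2 * |x - y| := by
    intro x hx y hy hx' hy'
    rw [(hball₃ x (hx'.trans_le hδ3) hx).2.1, (hball₃ y (hy'.trans_le hδ3) hy).2.1]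
    refine hball₁ (x, y) ?_
    rw [Metric.mem_ball, Prod.dist_eq]
    exact max_lt (hx'.trans_le hδ1) (hy'.trans_le hδ1)
  have hpoint := exists_expansion_point hJo hg_cont (abs_pos.1 hA0) ha₁ hδ0 hexp
  have hnear : ∀ᶠ a in 𝓝 a₁, |a - a₁| < δ := Metric.ball_mem_nhds a₁ hδ0
  have hev2 : ∀ᶠ x in 𝓝[leafParams p f ×ˢ K] (a₁, g a₁), x ∈ leafParams p f ×ˢ K ∧ |x.1 - a₁| < δ ∧
      ∃ b ∈ leafParams p f, |b - a₁| < δ ∧ (g b = x.2 ∨ b = a₁) ∧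
        ∀ a ∈ leafParams p f, |a - a₁| < δ → |A| / 2 * |a - b| ≤ |g a - x.2| := by
    filter_upwards [self_mem_nhdsWithin, nhdsWithin_le_nhds (continuousAt_fst.eventually hnear),
      nhdsWithin_le_nhds (continuousAt_snd.eventually hpoint)] with x h1 h2 h3 using ⟨h1, h2, h3⟩
  -- Near the graph the estimate needs no smallness of the length, so any `σ` will do.
  refine ⟨_, hev2, 1, one_pos, ?_⟩
  rintro ⟨a, F₀⟩ ⟨⟨haJ, hF₀⟩, haδ, b, hbJ, hbδ, hb, hbexp⟩ q hq -
  simp only at haJ hF₀ haδ hb hbexp ⊢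
  -- The comparison point is Diophantine with the same `α`: either its value is in `K`, or it is the
  -- center `a₁`.
  have hbreg : b ∈ regularParams (leafParams p f) S rot g α d := by
    rcases hb with hb | rfl
    · exact hKreg b hbJ (hb ▸ hF₀)
    · exact hreg
  have h1 := hdiam q hq a haJ (haδ.trans_le hδ2) b hbreg (hbδ.trans_le hδ2)
  have h2 := hbexp a haJ haδ
  linarith

/-- The common average belongs to `Q_∞`, also for the degenerate leaves. -/
theorem apply_mem_QInfty (hp : ContMDiff phaseI 𝓘(ℝ, ℝ) ω p) (hcompact : IsCompact (p ⁻¹' {0}))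
    (hf : Continuous f) {S : Set ℝ} (hSfin : S.Finite) (hJu : UniqueDiffOn ℝ (leafParams p f))
    (chart : ∀ a ∈ leafParams p f \ S, ActionAngleChart p f a) {g : ℝ → ℝ}
    (hg_cont : ContinuousOn g (leafParams p f)) {q : Cotangent M → ℝ} (hq : Continuous q)
    (havg : ∀ (a : ℝ) (ha : a ∈ leafParams p f \ S), (chart a ha).torusAverage q a = g a)
    {a : ℝ} (ha : a ∈ leafParams p f) : g a ∈ QInfty p f q a := by
  have hV : ∀ (a : ℝ) (ha : a ∈ leafParams p f \ S), a ∈ (chart a ha).V ∩ leafParams p f :=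
    fun a ha => ⟨mem_of_mem_nhds (chart a ha).V_mem, ha.1⟩
  have hreg : ∀ b ∈ leafParams p f \ S, g b ∈ QInfty p f q b := fun b hb => by
    rw [← havg b hb]
    exact (chart b hb).torusAverage_mem_QInfty hp hq (hV b hb)
  refine mem_QInfty_of_mem_closure hp hcompact hf hq (D := leafParams p f \ S) sdiff_subset ?_
    ((hg_cont a ha).mono sdiff_subset) (fun b hb => ?_) hreg
  -- `J` has no isolated points and `S` is finite, so every parameter is a limit of regular ones.
  · have hacc := (hJu a ha).accPt
    rw [accPt_iff_frequently_nhdsNE] at hacc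
    rw [mem_closure_iff_frequently]
    have hS : ∀ᶠ b in 𝓝[≠] a, b ∉ S := by
      have : (S \ {a})ᶜ ∈ 𝓝 a := (hSfin.sdiff.isClosed.isOpen_compl).mem_nhds (by simp)
      filter_upwards [nhdsWithin_le_nhds this, self_mem_nhdsWithin] with b h1 h2 hbS
      exact h1 ⟨hbS, h2⟩
    exact ((hacc.and_eventually hS).mono fun b hb => ⟨hb.1, hb.2⟩).filter_mono nhdsWithin_le_nhds
  · rw [(chart b hb).leaf_eq b (hV b hb)]
    exact isPreconnected_range ((chart b hb).continuous_κ_left ((chart b hb).action_mem b (hV b hb)))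

end LowerBound

/-! ### Assembly of the four conclusions -/

theorem theorem7p2
    {M : Type*} [TopologicalSpace M] [T2Space M] [ChartedSpace Plane M]
    [IsManifold 𝓘(ℝ, Plane) ω M]
    -- the energy surface `p⁻¹(0)` and the first integral `f`
    (p f : Cotangent M → ℝ)
    (hp : ContMDiff phaseI 𝓘(ℝ, ℝ) ω p) (hf : ContMDiff phaseI 𝓘(ℝ, ℝ) ω f)
    (hcompact : IsCompact (p ⁻¹' {0})) (hconn : IsConnected (p ⁻¹' {0}))
    (hdp : ∀ z, p z = 0 → differential p z ≠ 0)
    (hpf : ∀ z, differential f z (hamiltonField p z) = 0)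
    -- the leaves are tori, with action-angle coordinates, away from a finite set
    (S : Set ℝ) (hSfin : S.Finite) (hSJ : S ⊆ leafParams p f)
    (chart : ∀ a ∈ leafParams p f \ S, ActionAngleChart p f a)
    -- the rotation number
    (rot : ℝ → OnePoint ℝ)
    (hrot : ∀ (a : ℝ) (ha : a ∈ leafParams p f \ S),
      ∀ᶠ a' in 𝓝[leafParams p f \ S] a, rot a' = (chart a ha).rotationNumber a')
    (hrot_an : ProjAnalyticOn rot (leafParams p f \ S))
    (hrot_nc : NonconstantOnComponents rot (leafParams p f \ S))
    -- the torus average, common to the members of a uniformly analytic family of functions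
    (g : ℝ → ℝ) (hg_an : AnalyticOn ℝ g (leafParams p f \ S))
    (hg_cont : ContinuousOn g (leafParams p f))
    (hg_nc : NonconstantOnComponents g (leafParams p f \ S))
    (F : Set (Cotangent M → ℝ))
    (hF_an : ∀ q ∈ F, ContMDiff phaseI 𝓘(ℝ, ℝ) ω q)
    (hF_unif : UniformlyAnalyticOn F (p ⁻¹' {0}))
    (hF_avg : ∀ q ∈ F, ∀ (a : ℝ) (ha : a ∈ leafParams p f \ S),
      (chart a ha).torusAverage q a = g a)
    (d : ℝ) (hd : 0 < d) :
    -- the complement of the set of good values has small measure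
    Tendsto (fun α : ℝ => volume ((g '' leafParams p f) \
        goodValues (leafParams p f) S rot g α d)) (𝓝[>] 0) (𝓝 0) ∧
    -- good values have finitely many preimages
    (∀ α > 0, ∀ F₀ ∈ goodValues (leafParams p f) S rot g α d,
      {a | a ∈ leafParams p f ∧ g a = F₀}.Finite) ∧
    -- `Q_∞(a)` is the range of the limit of the flow averages along the torus `Λ_a`
    (∀ q ∈ F, ∀ a ∈ leafParams p f \ S, ∃ l : Cotangent M → ℝ,
      (∀ z ∈ leaf p f a, Tendsto (fun T => flowAverage p q T z) atTop (𝓝 (l z))) ∧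
      QInfty p f q a = l '' leaf p f a) ∧
    -- the lower bound for the distance
    (∀ α > 0, ∀ K ⊆ goodValues (leafParams p f) S rot g α d, IsCompact K →
      ∃ σ > 0, ∀ q ∈ F, (∀ a ∈ leafParams p f, Metric.diam (QInfty p f q a) ≤ σ) →
        ∀ F₀ ∈ K, ∀ W ∈ 𝓝ˢ {a | a ∈ leafParams p f ∧ g a = F₀},
          ∃ C > 0, ∀ a ∈ leafParams p f \ W, 1 / C ≤ Metric.infDist F₀ (QInfty p f q a)) := by
  
  have hfc : Continuous f := hf.continuous
  have hJc : IsCompact (leafParams p f) := hcompact.image hfc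
  have hJo : (leafParams p f).OrdConnected := (hconn.isPreconnected.image f hfc.continuousOn).ordConnected
  refine ⟨tendsto_volume_diff_goodValues hJc hJo hrot_an hrot_nc hg_an hg_cont hg_nc hSfin hSJ hd,
    fun α hα F₀ hF₀ => finite_preimage_of_mem_goodValues hJc hg_cont hα hF₀,
    fun q hq a ha => (chart a ha).exists_limit_and_QInfty_eq hp (hF_an q hq).continuous
      ⟨mem_of_mem_nhds (chart a ha).V_mem, ha.1⟩, fun α hα K hKgood hK => ?_⟩
  have hKreg : ∀ a ∈ leafParams p f, g a ∈ K → a ∈ regularParams (leafParams p f) S rot g α d := by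
    intro a ha haK
    by_contra h
    exact (hKgood haK).2 ⟨a, ⟨ha, h⟩, rfl⟩
  obtain ⟨σ, hσ, hhalf⟩ := exists_diam_QInfty_le_half hp hSfin hJc hJo chart hrot hrot_an hrot_nc hg_an
    hg_cont hg_nc hF_an hF_unif hα hK hKreg
  refine ⟨σ, hσ, fun q hq hdiam F₀ hF₀ W hW => ?_⟩
  obtain ⟨b, hbJ, rfl⟩ := (hKgood hF₀).1
  have hJu := uniqueDiffOn_of_nonconstantOnComponents hJo hg_nc ⟨b, (hKreg b hbJ hF₀).2.1⟩
  have hqc : Continuous q := (hF_an q hq).continuous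
  have hmem : ∀ a ∈ leafParams p f, g a ∈ QInfty p f q a := fun a ha =>
    apply_mem_QInfty hp hcompact hfc hSfin hJu chart hg_cont hqc (hF_avg q hq) ha
  -- Each point of `Q_∞(a)` is within `|g a - g b| / 2` of `g a`, which is itself in `Q_∞(a)`. This
  -- membership also excludes the empty set, whose `infDist` is `0` by convention.
  have hdist : ∀ a ∈ leafParams p f, |g a - g b| / 2 ≤ Metric.infDist (g b) (QInfty p f q a) := by
    intro a ha
    refine (Metric.le_infDist ⟨_, hmem a ha⟩).2 fun y hy => ?_
    have h1 := Metric.dist_le_diam_of_mem (isBounded_QInfty (f := f) hp hcompact hqc a) (hmem a ha) hy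
    have h2 := hhalf q hq a ha (g b) hF₀ (hdiam a ha)
    have h3 := dist_triangle_right (g a) (g b) y
    rw [Real.dist_eq (g a) (g b)] at h3
    linarith
  -- Removing the interior of `W` leaves a compact set on which `|g - g b|` attains a positive
  -- minimum.
  have hcomp : IsCompact (leafParams p f \ interior W) := hJc.diff isOpen_interior
  have hsub : {a | a ∈ leafParams p f ∧ g a = g b} ⊆ interior W := subset_interior_iff_mem_nhdsSet.2 hW
  rcases (leafParams p f \ interior W).eq_empty_or_nonempty with hemp | hne
  · refine ⟨1, one_pos, fun a ha => ?_⟩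
    have : a ∈ leafParams p f \ interior W := ⟨ha.1, fun h => ha.2 (interior_subset h)⟩
    rw [hemp] at this
    exact absurd this (notMem_empty a)
  · obtain ⟨a₀, ha₀, hmin⟩ := hcomp.exists_isMinOn hne
      (((hg_cont.mono sdiff_subset).sub continuousOn_const).abs :
        ContinuousOn (fun a => |g a - g b|) (leafParams p f \ interior W))
    have hpos : 0 < |g a₀ - g b| :=
      abs_pos.2 (sub_ne_zero.2 fun h => ha₀.2 (hsub ⟨ha₀.1, h⟩))
    refine ⟨2 / |g a₀ - g b|, by positivity, fun a ha => ?_⟩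
    rw [one_div_div]
    refine le_trans ?_ (hdist a ha.1)
    have : |g a₀ - g b| ≤ |g a - g b| := hmin ⟨ha.1, fun h => ha.2 (interior_subset h)⟩
    linarith
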